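/- **Setting.** Let $\Sigma=[0,1]^2$, $\gamma\in[-1,1]$, $\phi_\gamma(x,y)=xy+\frac{\gamma}{3}y^3$, and for $f\in L^2(\mathbb R^2)$ of compact support let $$E f(\xi)=\int f(x,y)\,e^{i[\xi_1x+\xi_2y+\xi_3\phi_\gamma(x,y)]}\,dx\,dy,\qquad \xi\in\mathbb R^3 .$$ Functions on $\Sigma$ are extended by zero to $\mathbb R^2$. Let $0<\epsilon<10^{-10}$, $\delta=\epsilon^2$, $K=e^{\epsilon^{-10}}$, $R\ge1$, $B_R=[-R,R]^3$. *Caps and broadness.* Let $\mu\ge1$. A cap $\tau$ is an axis-parallel square of side length in $[K^{-1},\mu^{1/2}K^{-1}]$, truncated to $\Sigma$ (with non-empty interior after truncation); its center is the center of the untruncated square. Fix a finite family of caps which covers $\Sigma$ and has $K^{-1}$-separated centers, and functions $f_\tau\in L^2$ with $\operatorname{supp} f_\tau\subset\tau$; put $f=\sum_\tau f_\tau$. For $\ell\ge1$ let $\mathcal F_\ell$ be the set of all $\tau\notin\mathcal F_1\cup\dots\cup\mathcal F_{\ell-1}$ whose interior meets $[0,1]\times[(\ell-1)\mu^{1/2}K^{-1/4},\ell\mu^{1/2}K^{-1/4}]$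 (long horizontal ragged strips). If $|\gamma|K^{1/2}\le1$, define in the same way families with $[(m-1)\mu^{1/2}K^{-1/2},m\mu^{1/2}K^{-1/2}]\times[0,1]$ (long vertical ragged strips), and add also all intersections of a horizontal with a vertical family. For functions $g_\tau$ and $g=\sum_\tau g_\tau$, the point $\xi$ is $\alpha$-broad for $Eg$ if $|E(\sum_{\tau\in\mathcal F}g_\tau)(\xi)|\le\alpha|Eg(\xi)|$ for each of these families $\mathcal F$; $\mathrm{Br}_\alpha Eg(\xi)=|Eg(\xi)|$ if $\xi$ is $\alpha$-broad and $0$ otherwise. *Wave packets.* Let $\theta$ run through the grid squares $R^{-1/2}([i,i+1]\times[j,j+1])$, $0\le i,j<R^{1/2}$, let $3\theta$ be the concentric square of three times the side length, and let $\nu(\theta)$ be the unit vector in direction $(\nabla\phi_\gamma,-1)$ at the center of $\theta$. For each $\theta$ let $\mathbb T(\theta)$ be a finite set of tubes (cylinders) $T$ of radius $R^{1/2+\delta}$ and length $4R$ with axes parallel to $\nu(\theta)$ and centers in the plane $\nu(\theta)^\perp$ through the origin, which meet $B_R$, whose axes are $R^{1/2}$-separated, and such that the coaxial tubes of radius $R^{1/2}$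 cover $B_R$. Put $\mathbb T=\bigcup_\theta\mathbb T(\theta)$ and $\nu(T)=\nu(\theta)$ for $T\in\mathbb T(\theta)$. A wave packet decomposition of $g\in L^2$ with constant $C$ is a family $(g_T)_{T\in\mathbb T}$ in $L^2(\mathbb R^2)$ such that 1. $\operatorname{supp}g_T\subset3\theta$ if $T\in\mathbb T(\theta)$; 2. $|Eg_T(\xi)|\le R^{-1000}\|g\|_2$ for $\xi\in B_R\setminus T$; 3. $|Eg(\xi)-\sum_{T}Eg_T(\xi)|\le R^{-1000}\|g\|_2$ for $\xi\in B_R$; 4. $|\int g_{T_1}\overline{g_{T_2}}|\le R^{-1000}\int_{3\theta}|g|^2$ if $T_1,T_2\in\mathbb T(\theta)$ are disjoint; 5. $\sum_{T\in\mathbb T(\theta)}\int|g_T|^2\le C\int_{3\theta}|g|^2$ for each $\theta$. *Tangential and transversal parts.* Let $P$ be a real polynomial on $\mathbb R^3$, $Z(P)$ its zero set, $W$ the $R^{1/2+\delta}$-neighbourhood of $Z(P)$, and $B_j$ a ball of radius $R^{1-\delta}$. Then $\mathbb T_{j,tang}$ is the set of all $T\in\mathbb T$ with $T\cap W\cap B_j\neq\emptyset$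 such that $\mathrm{angle}(\nu(T),T_\zeta Z(P))\le R^{-1/2+2\delta}$ for every $\zeta\in Z(P)\cap2B_j\cap10T$ with $\nabla P(\zeta)\ne0$, and $\mathbb T_{j,trans}$ is the set of all $T\in\mathbb T$ with $T\cap W\cap B_j\ne\emptyset$ for which this angle is $>R^{-1/2+2\delta}$ for at least one such $\zeta$. Given wave packet decompositions $(f_{\tau,T})_T$ of the $f_\tau$, put $f_{\tau,j,tang}=\sum_{T\in\mathbb T_{j,tang}}f_{\tau,T}$, $f_{\tau,j,trans}=\sum_{T\in\mathbb T_{j,trans}}f_{\tau,T}$, and $f_{I,j,trans}=\sum_{\tau\in I}f_{\tau,j,trans}$ for a set $I$ of caps. For the broadness of $E f_{I,j,trans}$ one takes $g_\tau=f_{\tau,j,trans}$ if $\tau\in I$ and $g_\tau=0$ otherwise. Caps $\tau_1,\tau_2$ with centers $z_i=(x_i,y_i)$ are strongly separated if $$\min\{|y_2-y_1|,\max\{|x_2-x_1+\gamma y_2(y_2-y_1)|,|x_2-x_1+\gamma y_1(y_2-y_1)|\}\}\ge10\mu^{1/2}K^{-1},$$ and $\mathrm{Bil}(Ef_{j,tang})=\sup|Ef_{\tau_1,j,tang}|^{1/2}|Ef_{\tau_2,j,tang}|^{1/2}$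 over all strongly separated pairs $\tau_1,\tau_2$ of the family ($0$ if there are none). **Lemma.** There is an absolute constant $C_0$, and for every $0<\epsilon<10^{-10}$ there is $R_0=R_0(\epsilon)\ge1$, such that the following holds for all $R\ge R_0$, all $\gamma\in[-1,1]$ and all tube families $\mathbb T$ as above. Every $g\in L^2(\Sigma)$ has a wave packet decomposition with constant $C_0$. Moreover, for all $\mu\ge1$ and $\alpha\in[K^{-\epsilon},1)$ with $\alpha\mu\le10^{-5}$, all families of caps and functions $f_\tau$ as above, all wave packet decompositions $(f_{\tau,T})_T$ of the $f_\tau$ (with any constant), all $P$ and $B_j$, and all $\xi\in B_R\cap B_j\cap W$, $$\mathrm{Br}_\alpha Ef(\xi)\le2\Big(\sum_I\mathrm{Br}_{60\alpha}Ef_{I,j,trans}(\xi)+K^{100}\,\mathrm{Bil}(Ef_{j,tang})(\xi)+R^{-900}\sum_\tau\|f_\tau\|_2\Big),$$ where the first sum runs over all subsets $I$ of the given family of caps. -/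

import Mathlib

open MeasureTheory Set
open scoped BigOperators

noncomputable section

namespace HypRestriction

/-- The frequency space `ℝ³` with its Euclidean structure. -/
abbrev E3 : Type := EuclideanSpace ℝ (Fin 3)

/-- Complex functions on the plane; a function on `Σ` is extended by zero. -/
abbrev PlaneFun : Type := ℝ × ℝ → ℂ

/-- The square `Σ = [0,1] × [0,1]`. -/
def unitSquare : Set (ℝ × ℝ) := Icc 0 1 ×ˢ Icc 0 1

/-- The phase `φ_γ(x,y) = xy + (γ/3) y³`. -/
def phase (γ : ℝ) (z : ℝ × ℝ) : ℝ := z.1 * z.2 + γ / 3 * z.2 ^ 3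

/-- The extension operator. The integral runs over the plane: for a function that vanishes off `Σ`
this is the integral over `Σ`, while wave packets may stick out of `Σ` a little. -/
def ext (γ : ℝ) (f : PlaneFun) (ξ : E3) : ℂ :=
  ∫ z : ℝ × ℝ,
    f z * Complex.exp (Complex.I * ((ξ 0 * z.1 + ξ 1 * z.2 + ξ 2 * phase γ z : ℝ) : ℂ))

/-- The `L²` norm as a real number. -/
def l2norm (f : PlaneFun) : ℝ := (eLpNorm f 2 volume).toReal

/-- The cube `B_R = [-R,R]³`. -/
def cube (R : ℝ) : Set E3 := {ξ | ∀ i, |ξ i| ≤ R}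

/-- The closed axis-parallel square with given center and side length. -/
def square (c : ℝ × ℝ) (s : ℝ) : Set (ℝ × ℝ) := {z | |z.1 - c.1| ≤ s / 2 ∧ |z.2 - c.2| ≤ s / 2}

/-! ### The caps `τ`, ragged strips and broad points -/

/-- A cap, given by the center and the side length of the square before truncation. -/
structure Cap where
  center : ℝ × ℝ
  side : ℝ

/-- The cap as a set: the square truncated to `Σ`. -/
def Cap.carrier (τ : Cap) : Set (ℝ × ℝ) := square τ.center τ.side ∩ unitSquare

/-- Families of caps covering `Σ`, with side lengths in `[K⁻¹, μ^{1/2} K⁻¹]`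
and `K⁻¹`-separated centers. -/
structure IsCapFamily (K μ : ℝ) (𝒞 : Finset Cap) : Prop where
  le_side : ∀ τ ∈ 𝒞, K⁻¹ ≤ τ.side
  side_le : ∀ τ ∈ 𝒞, τ.side ≤ √μ * K⁻¹
  nondegenerate : ∀ τ ∈ 𝒞, (interior τ.carrier).Nonempty
  cover : ∀ z ∈ unitSquare, ∃ τ ∈ 𝒞, z ∈ τ.carrier
  separated : ∀ τ ∈ 𝒞, ∀ τ' ∈ 𝒞, τ ≠ τ' →
    K⁻¹ ≤ √((τ.center.1 - τ'.center.1) ^ 2 + (τ.center.2 - τ'.center.2) ^ 2)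

open Classical in
/-- The family `𝓕_{ℓ+1}` of a long horizontal ragged strip: the caps whose interior meets
`[0,1] × [ℓ w, (ℓ+1) w]`, `w = μ^{1/2} K^{-1/4}`, and that are in no earlier family, i.e. whose
interior meets no earlier strip. (For large `ℓ` the family is empty.) -/
def horizontalFamily (K μ : ℝ) (𝒞 : Finset Cap) (ℓ : ℕ) : Finset Cap :=
  let strip : ℕ → Set (ℝ × ℝ) := fun k =>
    Icc 0 1 ×ˢ Icc (k * (√μ * K ^ (-(1 / 4) : ℝ))) ((k + 1) * (√μ * K ^ (-(1 / 4) : ℝ)))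
  𝒞.filter fun τ => (interior τ.carrier ∩ strip ℓ).Nonempty ∧
    ∀ k < ℓ, ¬ (interior τ.carrier ∩ strip k).Nonempty

open Classical in
/-- The families of the long vertical ragged strips, of width `μ^{1/2} K^{-1/2}`. -/
def verticalFamily (K μ : ℝ) (𝒞 : Finset Cap) (ℓ : ℕ) : Finset Cap :=
  let strip : ℕ → Set (ℝ × ℝ) := fun k =>
    Icc (k * (√μ * K ^ (-(1 / 2) : ℝ))) ((k + 1) * (√μ * K ^ (-(1 / 2) : ℝ))) ×ˢ Icc 0 1
  𝒞.filter fun τ => (interior τ.carrier ∩ strip ℓ).Nonempty ∧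
    ∀ k < ℓ, ¬ (interior τ.carrier ∩ strip k).Nonempty

open Classical in
/-- The cap families of all ragged strips: long horizontal ones, and, if `|γ| K^{1/2} ≤ 1`,
also long vertical ones and the intersections of both (short vertical ones). -/
def raggedFamilies (γ K μ : ℝ) (𝒞 : Finset Cap) : Set (Finset Cap) :=
  {S | (∃ ℓ, S = horizontalFamily K μ 𝒞 ℓ) ∨
    (|γ| * √K ≤ 1 ∧ ((∃ m, S = verticalFamily K μ 𝒞 m) ∨
      ∃ ℓ m, S = horizontalFamily K μ 𝒞 ℓ ∩ verticalFamily K μ 𝒞 m))}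

/-- `ξ` is `α`-broad for `E_γ g`, `g = ∑_τ g_τ`, and the given family of caps. -/
def IsBroad (γ K μ : ℝ) (𝒞 : Finset Cap) (α : ℝ) (g : Cap → PlaneFun) (ξ : E3) : Prop :=
  ∀ S ∈ raggedFamilies γ K μ 𝒞,
    ‖ext γ (∑ τ ∈ S, g τ) ξ‖ ≤ α * ‖ext γ (∑ τ ∈ 𝒞, g τ) ξ‖

open Classical in
/-- `Br_α E_γ g(ξ)`, `g = ∑_τ g_τ`. -/
def Br (γ K μ : ℝ) (𝒞 : Finset Cap) (α : ℝ) (g : Cap → PlaneFun) (ξ : E3) : ℝ :=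
  if IsBroad γ K μ 𝒞 α g ξ then ‖ext γ (∑ τ ∈ 𝒞, g τ) ξ‖ else 0

/-- `t^γ_z(z₁,z₂) = x₂ - x₁ + γ (y₁ + y₂ - y)(y₂ - y₁)`. -/
def tQuantity (γ : ℝ) (z z₁ z₂ : ℝ × ℝ) : ℝ :=
  z₂.1 - z₁.1 + γ * (z₁.2 + z₂.2 - z.2) * (z₂.2 - z₁.2)

/-- Strongly separated caps. -/
def StronglySeparated (γ K μ : ℝ) (τ₁ τ₂ : Cap) : Prop :=
  10 * √μ * K⁻¹ ≤ min |τ₂.center.2 - τ₁.center.2|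
    (max |tQuantity γ τ₁.center τ₁.center τ₂.center|
      |tQuantity γ τ₂.center τ₁.center τ₂.center|)

/-- `Bil(E_γ h)(ξ)`: the supremum of `|E_γ h_{τ₁}(ξ)|^{1/2} |E_γ h_{τ₂}(ξ)|^{1/2}` over strongly
separated pairs of caps of the family (a finite set of values; the value is `0` if there are no
such pairs). -/
def Bil (γ K μ : ℝ) (𝒞 : Finset Cap) (h : Cap → PlaneFun) (ξ : E3) : ℝ :=
  ⨆ p : {p : Cap × Cap // p.1 ∈ 𝒞 ∧ p.2 ∈ 𝒞 ∧ StronglySeparated γ K μ p.1 p.2},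
    √‖ext γ (h p.1.1) ξ‖ * √‖ext γ (h p.1.2) ξ‖

/-! ### Small caps `θ`, tubes and wave packets -/

/-- The indices `(i,j)` of the grid squares of side `R^{-1/2}` whose interior meets `Σ`. -/
def IsThetaIndex (R : ℝ) (θ : ℕ × ℕ) : Prop := (θ.1 : ℝ) < √R ∧ (θ.2 : ℝ) < √R

/-- The center `ω_θ` of `θ = R^{-1/2} ([i,i+1] × [j,j+1])`. -/
def thetaCenter (R : ℝ) (θ : ℕ × ℕ) : ℝ × ℝ :=
  (((θ.1 : ℝ) + 1 / 2) / √R, ((θ.2 : ℝ) + 1 / 2) / √R)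

/-- The square `3θ`. -/
def threeTheta (R : ℝ) (θ : ℕ × ℕ) : Set (ℝ × ℝ) := square (thetaCenter R θ) (3 / √R)

/-- The normal vector `(∇φ_γ(x,y), -1) = (y, x + γ y², -1)` of the graph of `φ_γ`. -/
def normalVec (γ : ℝ) (z : ℝ × ℝ) : E3 := !₂[z.2, z.1 + γ * z.2 ^ 2, -1]

/-- The unit normal `ν(θ)`. -/
def nu (γ R : ℝ) (θ : ℕ × ℕ) : E3 :=
  ‖normalVec γ (thetaCenter R θ)‖⁻¹ • normalVec γ (thetaCenter R θ)

/-- A tube, given by the small cap `θ` that it belongs to and its center. -/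
structure Tube where
  theta : ℕ × ℕ
  base : E3

/-- The cylinder with center `T.base ⊥ ν(θ)`, axis parallel to `ν(θ)`, radius `ρ` and
length `len`. -/
def Tube.cylinder (γ R ρ len : ℝ) (T : Tube) : Set E3 :=
  let ν := nu γ R T.theta
  {ξ | |inner ℝ ξ ν| ≤ len / 2 ∧ ‖ξ - (inner ℝ ξ ν) • ν - T.base‖ ≤ ρ}

/-- The tube itself, of radius `R^{1/2+δ}` and length `4R`
(so long that it crosses the cube `B_R`). -/
def Tube.carrier (γ R δ : ℝ) (T : Tube) : Set E3 :=
  T.cylinder γ R (R ^ (1 / 2 + δ)) (4 * R)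

/-- The tube `10 T`, dilated about its center. -/
def Tube.ten (γ R δ : ℝ) (T : Tube) : Set E3 :=
  T.cylinder γ R (10 * R ^ (1 / 2 + δ)) (10 * (4 * R))

/-- Admissible families `𝕋 = ⋃_θ 𝕋(θ)` of tubes. -/
structure IsTubeFamily (γ R δ : ℝ) (𝕋 : Finset Tube) : Prop where
  index : ∀ T ∈ 𝕋, IsThetaIndex R T.theta
  base_perp : ∀ T ∈ 𝕋, inner ℝ T.base (nu γ R T.theta) = 0
  meets : ∀ T ∈ 𝕋, (T.carrier γ R δ ∩ cube R).Nonempty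
  separated : ∀ T ∈ 𝕋, ∀ T' ∈ 𝕋, T.theta = T'.theta → T ≠ T' → √R ≤ dist T.base T'.base
  thin_cover : ∀ θ, IsThetaIndex R θ → ∀ ξ ∈ cube R,
    ∃ T ∈ 𝕋, T.theta = θ ∧ ξ ∈ T.cylinder γ R (√R) (4 * R)

open Classical in
/-- `(F_T)_{T ∈ 𝕋}` is a wave packet decomposition of `g` at scale `R`, with constant `C` in the
`L²` bound: support, localization, reconstruction, essential orthogonality, `L²` bound. -/
structure IsWavePacketDecomposition (γ R δ C : ℝ) (𝕋 : Finset Tube) (g : PlaneFun)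
    (F : Tube → PlaneFun) : Prop where
  memLp : ∀ T ∈ 𝕋, MemLp (F T) 2 volume
  support : ∀ T ∈ 𝕋, Function.support (F T) ⊆ threeTheta R T.theta
  localized : ∀ T ∈ 𝕋, ∀ ξ ∈ cube R \ T.carrier γ R δ,
    ‖ext γ (F T) ξ‖ ≤ R ^ (-1000 : ℝ) * l2norm g
  reconstruct : ∀ ξ ∈ cube R,
    ‖ext γ g ξ - ∑ T ∈ 𝕋, ext γ (F T) ξ‖ ≤ R ^ (-1000 : ℝ) * l2norm g
  orthogonal : ∀ T₁ ∈ 𝕋, ∀ T₂ ∈ 𝕋, T₁.theta = T₂.theta →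
    Disjoint (T₁.carrier γ R δ) (T₂.carrier γ R δ) →
      ‖∫ z, F T₁ z * (starRingEnd ℂ) (F T₂ z)‖ ≤
        R ^ (-1000 : ℝ) * ∫ z in threeTheta R T₁.theta, ‖g z‖ ^ 2
  l2_bound : ∀ θ, IsThetaIndex R θ →
    ∑ T ∈ 𝕋.filter (fun T => T.theta = θ), ∫ z, ‖F T z‖ ^ 2 ≤
      C * ∫ z in threeTheta R θ, ‖g z‖ ^ 2

/-! ### Tangential and transversal tubes -/

/-- The zero set `Z(P)`. -/
def zeroSet (P : MvPolynomial (Fin 3) ℝ) : Set E3 := {ξ | MvPolynomial.eval (fun i => ξ i) P = 0}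

/-- The gradient `∇P(ξ)`. -/
def grad (P : MvPolynomial (Fin 3) ℝ) (ξ : E3) : E3 :=
  WithLp.toLp 2 fun i => MvPolynomial.eval (fun k => ξ k) (MvPolynomial.pderiv i P)

/-- The wall `W`: the (open) `R^{1/2+δ}`-neighbourhood of `Z(P)`. -/
def wall (R δ : ℝ) (P : MvPolynomial (Fin 3) ℝ) : Set E3 :=
  Metric.thickening (R ^ (1 / 2 + δ)) (zeroSet P)

/-- The angle between a nonzero vector `v` and the plane orthogonal to a nonzero vector `n`. -/
def anglePlane (v n : E3) : ℝ := |Real.pi / 2 - InnerProductGeometry.angle v n|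

/-- All nonsingular points of `Z(P)` in `2B ∩ 10T`, `B = B(c, R^{1-δ})`, have tangent planes at
angle at most `R^{-1/2+2δ}` to `ν(T)`. -/
def AlmostTangent (γ R δ : ℝ) (P : MvPolynomial (Fin 3) ℝ) (c : E3) (T : Tube) : Prop :=
  ∀ ζ ∈ zeroSet P ∩ (Metric.closedBall c (2 * R ^ (1 - δ)) ∩ T.ten γ R δ), grad P ζ ≠ 0 →
    anglePlane (nu γ R T.theta) (grad P ζ) ≤ R ^ (-(1 / 2) + 2 * δ)

open Classical in
/-- `𝕋_{j,tang}` for the ball `B_j = B(c, R^{1-δ})`. -/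
def tangTubes (γ R δ : ℝ) (P : MvPolynomial (Fin 3) ℝ) (c : E3) (𝕋 : Finset Tube) :
    Finset Tube :=
  𝕋.filter fun T =>
    (T.carrier γ R δ ∩ wall R δ P ∩ Metric.closedBall c (R ^ (1 - δ))).Nonempty ∧
      AlmostTangent γ R δ P c T

open Classical in
/-- `𝕋_{j,trans}` for the ball `B_j = B(c, R^{1-δ})`. -/
def transTubes (γ R δ : ℝ) (P : MvPolynomial (Fin 3) ℝ) (c : E3) (𝕋 : Finset Tube) :
    Finset Tube :=
  𝕋.filter fun T =>
    (T.carrier γ R δ ∩ wall R δ P ∩ Metric.closedBall c (R ^ (1 - δ))).Nonempty ∧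
      ∃ ζ ∈ zeroSet P ∩ (Metric.closedBall c (2 * R ^ (1 - δ)) ∩ T.ten γ R δ), grad P ζ ≠ 0 ∧
        R ^ (-(1 / 2) + 2 * δ) < anglePlane (nu γ R T.theta) (grad P ζ)

/-- `f_{τ,j,tang} = ∑_{T ∈ 𝕋_{j,tang}} f_{τ,T}`. -/
def tangPart (γ R δ : ℝ) (P : MvPolynomial (Fin 3) ℝ) (c : E3) (𝕋 : Finset Tube)
    (F : Cap → Tube → PlaneFun) (τ : Cap) : PlaneFun :=
  ∑ T ∈ tangTubes γ R δ P c 𝕋, F τ T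

/-- `f_{τ,j,trans} = ∑_{T ∈ 𝕋_{j,trans}} f_{τ,T}`. -/
def transPart (γ R δ : ℝ) (P : MvPolynomial (Fin 3) ℝ) (c : E3) (𝕋 : Finset Tube)
    (F : Cap → Tube → PlaneFun) (τ : Cap) : PlaneFun :=
  ∑ T ∈ transTubes γ R δ P c 𝕋, F τ T

open Classical in
/-- The restriction of a family of functions to a set `I` of caps, so that
`f_{I,j,trans} = ∑_τ (restrictCaps I f_{·,j,trans}) τ`. -/
def restrictCaps (I : Finset Cap) (g : Cap → PlaneFun) (τ : Cap) : PlaneFun :=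
  if τ ∈ I then g τ else 0

/-- `K(ε) = e^{ε^{-10}}`. -/
def bigK (ε : ℝ) : ℝ := Real.exp (ε ^ (-10 : ℤ))

end HypRestriction

end

namespace HypRestriction

/-! The broad estimate is an argument at a single point. Let ξ be α-broad and A = |Ef(ξ)|; if A ≤
2R^{-900} Σ‖f_τ‖ nothing remains to be shown. Otherwise let J be the set of caps with
|Ef_{τ,j,tang}(ξ)| > K^{-100} A. A strongly separated pair in J gives A ≤ K^{100} Bil. If there is
no such pair, J lies in at most 20 long ragged strips of one kind
(`exists_strips_of_not_separated`). Let B be the union of their families. A strip meets a ragged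
family in a ragged family or in nothing, so broadness shows that removing B changes the whole sum,
and the sum over each ragged family, by at most 20αA. Off B the tangential parts are at most
K^{-100} A each, and there are at most K^3 caps. Every tube through ξ ∈ W ∩ B_j is tangential or
transversal, so Ef_τ(ξ) is the sum of both parts up to a negligible error. Hence for I = 𝒞 \ B the
transversal sum keeps half of A but is at most 23αA on ragged families, which makes it 60α-broad
(`trans_broad`). The sum over all I removes the dependence of I on ξ.

The geometry behind the strips: the two quantities t of a pair of caps differ by γ(y₂-y₁)². If a
pair that is not strongly separated has |y₂-y₁| > 6μ^{1/2}K^{-1/4}, both are small, and this forces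
|γ| ≤ (5/9)K^{-1/2}. The shear is then harmless and all caps of J have nearly the same x-coordinate,
so vertical strips suffice. If no pair is that far apart in y, horizontal strips do.

For the wave packets, each piece g·1_θ is rescaled to unit size, expanded in a Fourier series of
period 3, and multiplied by a smooth cutoff that is 1 on the rescaled θ. Each frequency within R^δ/2
of the rescaled position of some tube over θ is given to exactly one such tube, and the others are
dropped. For ξ ∈ B_R the nonlinear part of the rescaled phase has bounded coefficients. The
extension of a single mode is therefore a Fourier integral of a smooth function from a compact
family, and it decays rapidly in the distance of the frequency from the position of ξ
(`IsCutoff.exists_decay`). This gives localization and reconstruction. Bessel's inequality gives the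
L² bound with constant 1, and Schur's test gives the almost orthogonality of disjoint tubes. -/

/-! ### Integrability and linearity of the extension operator -/

lemma norm_exp_I_mul (t : ℝ) : ‖Complex.exp (Complex.I * (t : ℂ))‖ = 1 := by
  rw [mul_comm]; exact Complex.norm_exp_ofReal_mul_I t

lemma integrable_ext {f : PlaneFun} (hf : Integrable f) (γ : ℝ) (ξ : E3) :
    Integrable fun z : ℝ × ℝ =>
      f z * Complex.exp (Complex.I * ((ξ 0 * z.1 + ξ 1 * z.2 + ξ 2 * phase γ z : ℝ) : ℂ)) := by
  refine hf.mul_bdd (c := 1) ?_ (Filter.Eventually.of_forall fun z => (norm_exp_I_mul _).le)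
  refine Continuous.aestronglyMeasurable ?_
  unfold phase
  fun_prop

lemma ext_sum {ι : Type*} (S : Finset ι) {f : ι → PlaneFun} (hf : ∀ i ∈ S, Integrable (f i))
    (γ : ℝ) (ξ : E3) : ext γ (∑ i ∈ S, f i) ξ = ∑ i ∈ S, ext γ (f i) ξ := by
  unfold ext
  rw [← integral_finsetSum S fun i hi => integrable_ext (hf i hi) γ ξ]
  simp only [Finset.sum_apply, Finset.sum_mul]

lemma integrable_of_memLp_of_support {f : PlaneFun} (hf : MemLp f 2 volume) {S : Set (ℝ × ℝ)}
    (hS : IsCompact S) (hs : Function.support f ⊆ S) : Integrable f := by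
  rw [← integrableOn_iff_integrable_of_support_subset hs]
  have : IsFiniteMeasure (volume.restrict S) := ⟨by simpa using hS.measure_lt_top⟩
  exact (hf.restrict S).integrable (by norm_num)

lemma isCompact_square (c : ℝ × ℝ) (s : ℝ) : IsCompact (square c s) := by
  have : square c s = Metric.closedBall c.1 (s / 2) ×ˢ Metric.closedBall c.2 (s / 2) := by
    ext z; simp [square, Real.dist_eq]
  rw [this]
  exact (isCompact_closedBall _ _).prod (isCompact_closedBall _ _)

lemma integrable_cap {f : PlaneFun} (hf : MemLp f 2 volume) {τ : Cap}
    (hs : Function.support f ⊆ τ.carrier) : Integrable f :=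
  integrable_of_memLp_of_support hf (isCompact_square _ _) (hs.trans inter_subset_left)

/-! ### Families of strips -/

open Classical in
/-- The members of `𝒞` whose interior meets the strip with index `ℓ` and no earlier one. -/
noncomputable def stripFamily (𝒞 : Finset Cap) (strip : ℕ → Set (ℝ × ℝ)) (ℓ : ℕ) : Finset Cap :=
  𝒞.filter fun τ => (interior τ.carrier ∩ strip ℓ).Nonempty ∧
    ∀ k < ℓ, ¬ (interior τ.carrier ∩ strip k).Nonempty

/-- With these strips `stripFamily` unfolds to `horizontalFamily`, and with the vertical ones to
`verticalFamily`, so disjointness and covering need to be proved only once. -/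
noncomputable def horizontalStrip (K μ : ℝ) (k : ℕ) : Set (ℝ × ℝ) :=
  Icc 0 1 ×ˢ Icc (k * (√μ * K ^ (-(1 / 4) : ℝ))) ((k + 1) * (√μ * K ^ (-(1 / 4) : ℝ)))

noncomputable def verticalStrip (K μ : ℝ) (k : ℕ) : Set (ℝ × ℝ) :=
  Icc (k * (√μ * K ^ (-(1 / 2) : ℝ))) ((k + 1) * (√μ * K ^ (-(1 / 2) : ℝ))) ×ˢ Icc 0 1

lemma disjoint_stripFamily (𝒞 : Finset Cap) (strip : ℕ → Set (ℝ × ℝ)) {k ℓ : ℕ} (h : k ≠ ℓ) :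
    Disjoint (stripFamily 𝒞 strip k) (stripFamily 𝒞 strip ℓ) := by
  classical
  rw [Finset.disjoint_left]
  intro τ h1 h2
  simp only [stripFamily, Finset.mem_filter] at h1 h2
  rcases lt_or_gt_of_ne h with h | h
  · exact h2.2.2 k h h1.2.1
  · exact h1.2.2 ℓ h h2.2.1

lemma exists_mem_stripFamily {𝒞 : Finset Cap} {strip : ℕ → Set (ℝ × ℝ)} {τ : Cap} (hτ : τ ∈ 𝒞)
    (h : ∃ ℓ, (interior τ.carrier ∩ strip ℓ).Nonempty) : ∃ ℓ, τ ∈ stripFamily 𝒞 strip ℓ := by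
  classical
  refine ⟨Nat.find h, ?_⟩
  simp only [stripFamily, Finset.mem_filter]
  exact ⟨hτ, Nat.find_spec h, fun k hk => Nat.find_min h hk⟩

lemma mem_strip_index {w t : ℝ} (hw : 0 < w) (ht : 0 ≤ t) :
    t ∈ Icc ((⌊t / w⌋₊ : ℝ) * w) ((⌊t / w⌋₊ + 1 : ℝ) * w) := by
  constructor
  · exact (le_div_iff₀ hw).1 (Nat.floor_le (by positivity))
  · exact ((div_lt_iff₀ hw).1 (Nat.lt_floor_add_one _)).le

lemma exists_mem_horizontalFamily {K μ : ℝ} (hK : 0 < K) (hμ : 0 < μ) {𝒞 : Finset Cap} {τ : Cap}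
    (hτ : τ ∈ 𝒞) (hne : (interior τ.carrier).Nonempty) : ∃ ℓ, τ ∈ horizontalFamily K μ 𝒞 ℓ := by
  obtain ⟨z, hz⟩ := hne
  have hu : z ∈ unitSquare := (interior_subset hz).2
  have hw : 0 < √μ * K ^ (-(1 / 4) : ℝ) := by positivity
  exact exists_mem_stripFamily (strip := horizontalStrip K μ) hτ
    ⟨_, z, hz, hu.1, mem_strip_index hw hu.2.1⟩

lemma exists_mem_verticalFamily {K μ : ℝ} (hK : 0 < K) (hμ : 0 < μ) {𝒞 : Finset Cap} {τ : Cap}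
    (hτ : τ ∈ 𝒞) (hne : (interior τ.carrier).Nonempty) : ∃ ℓ, τ ∈ verticalFamily K μ 𝒞 ℓ := by
  obtain ⟨z, hz⟩ := hne
  have hu : z ∈ unitSquare := (interior_subset hz).2
  have hw : 0 < √μ * K ^ (-(1 / 2) : ℝ) := by positivity
  exact exists_mem_stripFamily (strip := verticalStrip K μ) hτ
    ⟨_, z, hz, mem_strip_index hw hu.1.1, hu.2⟩

lemma horizontalFamily_subset (K μ : ℝ) (𝒞 : Finset Cap) (ℓ : ℕ) :
    horizontalFamily K μ 𝒞 ℓ ⊆ 𝒞 := fun τ h => by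
  simp only [horizontalFamily, Finset.mem_filter] at h; exact h.1

lemma verticalFamily_subset (K μ : ℝ) (𝒞 : Finset Cap) (ℓ : ℕ) :
    verticalFamily K μ 𝒞 ℓ ⊆ 𝒞 := fun τ h => by
  simp only [verticalFamily, Finset.mem_filter] at h; exact h.1

open Classical in
lemma subset_of_mem_raggedFamilies {γ K μ : ℝ} {𝒞 S : Finset Cap}
    (hS : S ∈ raggedFamilies γ K μ 𝒞) : S ⊆ 𝒞 := by
  rcases hS with ⟨ℓ, rfl⟩ | ⟨-, ⟨m, rfl⟩ | ⟨ℓ, m, rfl⟩⟩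
  · exact horizontalFamily_subset _ _ _ _
  · exact verticalFamily_subset _ _ _ _
  · exact Finset.inter_subset_left.trans (horizontalFamily_subset _ _ _ _)

open Classical in
-- Different horizontal families are disjoint, and a vertical family is cut down to a short vertical
-- one. The intersections belong to the ragged families for the sake of this closure property.
lemma inter_horizontalFamily {γ K μ : ℝ} {𝒞 S : Finset Cap} (hS : S ∈ raggedFamilies γ K μ 𝒞)
    (k : ℕ) : S ∩ horizontalFamily K μ 𝒞 k = ∅ ∨
      S ∩ horizontalFamily K μ 𝒞 k ∈ raggedFamilies γ K μ 𝒞 := by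
  rcases hS with ⟨ℓ, rfl⟩ | ⟨hγ, ⟨m, rfl⟩ | ⟨ℓ, m, rfl⟩⟩
  · by_cases h : ℓ = k
    · subst h; right; rw [Finset.inter_self]; exact Or.inl ⟨ℓ, rfl⟩
    · left
      exact Finset.disjoint_iff_inter_eq_empty.1 (disjoint_stripFamily 𝒞 (horizontalStrip K μ) h)
  · right; right; refine ⟨hγ, Or.inr ⟨k, m, Finset.inter_comm _ _⟩⟩
  · by_cases h : ℓ = k
    · subst h; right; right; refine ⟨hγ, Or.inr ⟨ℓ, m, ?_⟩⟩
      ext τ; simp; tauto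
    · left
      have := disjoint_stripFamily 𝒞 (horizontalStrip K μ) h
      rw [← Finset.disjoint_iff_inter_eq_empty]
      exact this.mono_left (fun τ hτ => (Finset.mem_inter.1 hτ).1)

open Classical in
-- Unlike in the horizontal case the condition on γ is a hypothesis: if `S` is horizontal, the
-- intersection is ragged only when vertical strips are admitted.
lemma inter_verticalFamily {γ K μ : ℝ} {𝒞 S : Finset Cap} (hγ : |γ| * √K ≤ 1)
    (hS : S ∈ raggedFamilies γ K μ 𝒞)
    (k : ℕ) : S ∩ verticalFamily K μ 𝒞 k = ∅ ∨
      S ∩ verticalFamily K μ 𝒞 k ∈ raggedFamilies γ K μ 𝒞 := by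
  rcases hS with ⟨ℓ, rfl⟩ | ⟨-, ⟨m, rfl⟩ | ⟨ℓ, m, rfl⟩⟩
  · right; right; refine ⟨hγ, Or.inr ⟨ℓ, k, rfl⟩⟩
  · by_cases h : m = k
    · subst h; right; rw [Finset.inter_self]; exact Or.inr ⟨hγ, Or.inl ⟨m, rfl⟩⟩
    · left
      exact Finset.disjoint_iff_inter_eq_empty.1 (disjoint_stripFamily 𝒞 (verticalStrip K μ) h)
  · by_cases h : m = k
    · subst h; right; right; refine ⟨hγ, Or.inr ⟨ℓ, m, ?_⟩⟩
      ext τ; simp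
    · left
      have := disjoint_stripFamily 𝒞 (verticalStrip K μ) h
      rw [← Finset.disjoint_iff_inter_eq_empty]
      exact this.mono_left (fun τ hτ => (Finset.mem_inter.1 hτ).2)

open Classical in
/-- If a set of caps is a union of at most `n` members of a disjoint sequence of families which
is compatible with `S`, a bound for single families gives one for the part of `S` in that set. -/
lemma norm_sum_inter_biUnion_le {𝓕 : Set (Finset Cap)} {H : ℕ → Finset Cap} {S : Finset Cap}
    (hH : ∀ k ℓ, k ≠ ℓ → Disjoint (H k) (H ℓ)) (hS : ∀ k, S ∩ H k = ∅ ∨ S ∩ H k ∈ 𝓕)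
    {a : Cap → ℂ} {β : ℝ} (hβ : 0 ≤ β) (ha : ∀ S ∈ 𝓕, ‖∑ τ ∈ S, a τ‖ ≤ β) (L : Finset ℕ) :
    ‖∑ τ ∈ S ∩ L.biUnion H, a τ‖ ≤ L.card * β := by
  rw [Finset.inter_biUnion, Finset.sum_biUnion]
  · refine (norm_sum_le _ _).trans ?_
    rw [← nsmul_eq_mul]
    refine Finset.sum_le_card_nsmul _ _ _ fun k _ => ?_
    rcases hS k with h | h
    · rw [h]; simpa using hβ
    · exact ha _ h
  · intro k _ ℓ _ hkl
    exact (hH k ℓ hkl).mono Finset.inter_subset_right Finset.inter_subset_right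

/-! ### Geometry of strongly separated caps -/

/-- A common point of cap and strip is within half a strip width of the midline and within half a
side of the center, and sides are no longer than the strip width. -/
lemma center_horizontal {K μ : ℝ} (hK : 1 ≤ K) (hμ : 1 ≤ μ) {𝒞 : Finset Cap}
    (h𝒞 : IsCapFamily K μ 𝒞) {τ : Cap} {ℓ : ℕ} (h : τ ∈ horizontalFamily K μ 𝒞 ℓ) :
    |τ.center.2 - (ℓ + 1 / 2) * (√μ * K ^ (-(1 / 4) : ℝ))| ≤ √μ * K ^ (-(1 / 4) : ℝ) := by
  simp only [horizontalFamily, Finset.mem_filter] at h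
  obtain ⟨hτ, ⟨z, hz, -, hz2⟩, -⟩ := h
  have h1 : |z.2 - τ.center.2| ≤ τ.side / 2 := (interior_subset hz).1.2
  have h2 := h𝒞.side_le τ hτ
  have h3 : K⁻¹ ≤ K ^ (-(1 / 4) : ℝ) := by
    rw [← Real.rpow_neg_one]; exact Real.rpow_le_rpow_of_exponent_le hK (by norm_num)
  have h4 : √μ * K⁻¹ ≤ √μ * K ^ (-(1 / 4) : ℝ) := by gcongr
  rw [abs_le] at h1 ⊢
  obtain ⟨h5, h6⟩ := hz2
  constructor <;> linarith

lemma center_vertical {K μ : ℝ} (hK : 1 ≤ K) (hμ : 1 ≤ μ) {𝒞 : Finset Cap}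
    (h𝒞 : IsCapFamily K μ 𝒞) {τ : Cap} {ℓ : ℕ} (h : τ ∈ verticalFamily K μ 𝒞 ℓ) :
    |τ.center.1 - (ℓ + 1 / 2) * (√μ * K ^ (-(1 / 2) : ℝ))| ≤ √μ * K ^ (-(1 / 2) : ℝ) := by
  simp only [verticalFamily, Finset.mem_filter] at h
  obtain ⟨hτ, ⟨z, hz, hz2, -⟩, -⟩ := h
  have h1 : |z.1 - τ.center.1| ≤ τ.side / 2 := (interior_subset hz).1.1
  have h2 := h𝒞.side_le τ hτ
  have h3 : K⁻¹ ≤ K ^ (-(1 / 2) : ℝ) := by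
    rw [← Real.rpow_neg_one]; exact Real.rpow_le_rpow_of_exponent_le hK (by norm_num)
  have h4 : √μ * K⁻¹ ≤ √μ * K ^ (-(1 / 2) : ℝ) := by gcongr
  rw [abs_le] at h1 ⊢
  obtain ⟨h5, h6⟩ := hz2
  constructor <;> linarith

/-- The offsets w + 6w + w add up to 8 widths. Truncation of `k - 8` at zero only cuts off indices
that do not exist. -/
lemma index_near {w c c' : ℝ} (hw : 0 < w) {k ℓ : ℕ} (h : |c - (k + 1 / 2) * w| ≤ w)
    (h' : |c' - (ℓ + 1 / 2) * w| ≤ w) (hc : |c - c'| ≤ 6 * w) :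
    ℓ ∈ Finset.Icc (k - 8) (k + 8) := by
  rw [abs_le] at *
  have h1 : ((ℓ : ℝ) - k) * w ≤ 8 * w := by linarith
  have h2 : ((k : ℝ) - ℓ) * w ≤ 8 * w := by linarith
  have h3 := le_of_mul_le_mul_right h1 hw
  have h4 := le_of_mul_le_mul_right h2 hw
  have h5 : (ℓ : ℝ) ≤ k + 8 := by linarith
  have h6 : (k : ℝ) ≤ ℓ + 8 := by linarith
  have h5' : ℓ ≤ k + 8 := by exact_mod_cast h5
  have h6' : k ≤ ℓ + 8 := by exact_mod_cast h6
  rw [Finset.mem_Icc]; omega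

lemma card_Icc_window (k : ℕ) : (Finset.Icc (k - 8) (k + 8)).card ≤ 20 := by
  rw [Nat.card_Icc]; omega

/-- For μ ≤ K the sides are at most 1, so a center lies at most 1/2 outside of Σ. -/
lemma center_mem {K μ : ℝ} (hK : 1 ≤ K) (hμK : μ ≤ K) {𝒞 : Finset Cap}
    (h𝒞 : IsCapFamily K μ 𝒞) {τ : Cap} (hτ : τ ∈ 𝒞) :
    (|τ.center.1 - 1 / 2| ≤ 1 ∧ |τ.center.2 - 1 / 2| ≤ 1) := by
  obtain ⟨z, hz⟩ := h𝒞.nondegenerate τ hτ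
  obtain ⟨⟨h1, h2⟩, ⟨h3, h3'⟩, ⟨h4, h4'⟩⟩ := interior_subset hz
  have h5 := h𝒞.side_le τ hτ
  have h6 : √μ ≤ K := by
    rw [Real.sqrt_le_left (by linarith)]; nlinarith
  have h7 : √μ * K⁻¹ ≤ 1 := by
    rw [← div_eq_mul_inv, div_le_one (by linarith)]; exact h6
  simp only [abs_le] at *
  refine ⟨⟨?_, ?_⟩, ⟨?_, ?_⟩⟩ <;> linarith

set_option maxHeartbeats 1000000 in
open Classical in
/-- A set of caps without strongly separated pairs lies in boundedly many long ragged strips of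
the same kind. -/
lemma exists_strips_of_not_separated {γ K μ : ℝ} (hK : 10000 ≤ K) (hμ : 1 ≤ μ) (hμK : μ ≤ K)
    {𝒞 : Finset Cap} (h𝒞 : IsCapFamily K μ 𝒞) {J : Finset Cap}
    (hJ : J ⊆ 𝒞) (hsep : ∀ τ₁ ∈ J, ∀ τ₂ ∈ J, ¬ StronglySeparated γ K μ τ₁ τ₂) :
    ∃ L : Finset ℕ, L.card ≤ 20 ∧ (J ⊆ L.biUnion (horizontalFamily K μ 𝒞) ∨
      (|γ| * √K ≤ 1 ∧ J ⊆ L.biUnion (verticalFamily K μ 𝒞))) := by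
  have hK0 : 0 < K := by linarith
  have hK1 : 1 ≤ K := by linarith
  have hμ0 : 0 < μ := by linarith
  have hm1 : 1 ≤ √μ := Real.one_le_sqrt.2 hμ
  -- If all heights agree up to 6 widths, a window of horizontal strips around any one cap contains
  -- J.
  by_cases hsmall : ∀ τ₁ ∈ J, ∀ τ₂ ∈ J,
      |τ₁.center.2 - τ₂.center.2| ≤ 6 * (√μ * K ^ (-(1 / 4) : ℝ))
  · rcases J.eq_empty_or_nonempty with rfl | ⟨τ₀, h₀⟩
    · exact ⟨∅, by simp, by simp⟩
    obtain ⟨k, hk⟩ := exists_mem_horizontalFamily hK0 hμ0 (hJ h₀) (h𝒞.nondegenerate τ₀ (hJ h₀))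
    refine ⟨_, card_Icc_window k, Or.inl fun τ hτ => ?_⟩
    obtain ⟨ℓ, hℓ⟩ := exists_mem_horizontalFamily hK0 hμ0 (hJ hτ) (h𝒞.nondegenerate τ (hJ hτ))
    exact Finset.mem_biUnion.2 ⟨ℓ, index_near (by positivity) (center_horizontal hK1 hμ h𝒞 hk)
      (center_horizontal hK1 hμ h𝒞 hℓ) (hsmall _ h₀ _ hτ), hℓ⟩
  push Not at hsmall
  obtain ⟨τ₁, h₁, τ₂, h₂, h12⟩ := hsmall
  -- In terms of q = K^{-1/4} and m = μ^{1/2}, the strip widths are mq and mq², and the separation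
  -- threshold is D = 10mq⁴.
  set q := K ^ (-(1 / 4) : ℝ) with hq
  have hq0 : 0 < q := by positivity
  have hq2 : K ^ (-(1 / 2) : ℝ) = q ^ 2 := by
    rw [hq, ← Real.rpow_natCast, ← Real.rpow_mul hK0.le]; norm_num
  have hq4 : K⁻¹ = q ^ 4 := by
    rw [hq, ← Real.rpow_natCast, ← Real.rpow_mul hK0.le, ← Real.rpow_neg_one]; norm_num
  have hsq : √K * q ^ 2 = 1 := by
    rw [← hq2, Real.sqrt_eq_rpow, ← Real.rpow_add hK0]; norm_num
  have hq2le : q ^ 2 ≤ 1 / 100 := by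
    have : 100 ≤ √K := by
      rw [show (100 : ℝ) = √(100 ^ 2) by simp]; exact Real.sqrt_le_sqrt (by linarith)
    nlinarith [sq_nonneg q]
  have hnot : ∀ a ∈ J, ∀ b ∈ J, 10 * √μ * K⁻¹ ≤ |b.center.2 - a.center.2| →
      |b.center.1 - a.center.1 + γ * b.center.2 * (b.center.2 - a.center.2)| < 10 * √μ * K⁻¹ ∧
      |b.center.1 - a.center.1 + γ * a.center.2 * (b.center.2 - a.center.2)| <
        10 * √μ * K⁻¹ := by
    intro a ha b hb hab
    have := hsep a ha b hb
    simp only [StronglySeparated, tQuantity, le_min_iff, not_and] at this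
    have := this hab
    rw [not_le, max_lt_iff] at this
    rwa [show a.center.2 + b.center.2 - a.center.2 = b.center.2 by ring,
      show a.center.2 + b.center.2 - b.center.2 = a.center.2 by ring] at this
  rw [hq4] at hnot
  set m := √μ
  set D := 10 * m * q ^ 4 with hD
  have hD' : D ≤ m * q ^ 2 / 10 := by
    have : m * q ^ 2 * q ^ 2 ≤ m * q ^ 2 * (1 / 100) := by gcongr
    rw [hD]; nlinarith
  have hqq : q ≤ 1 := by nlinarith
  have hq21 : q ^ 2 ≤ q := by nlinarith
  have hDq : 2 * D ≤ 6 * (m * q) := by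
    have : m * q ^ 2 ≤ m * q := by gcongr
    nlinarith [mul_pos (by linarith : 0 < m) hq0]
  have hD0 : 0 < D := by positivity
  obtain ⟨hA, hB⟩ := hnot τ₁ h₁ τ₂ h₂ (by rw [abs_sub_comm]; linarith)
  -- The two quantities t of this pair differ by γ(y₂-y₁)² and each is below D. With |y₂-y₁| > 6mq
  -- this gives 36m²q²|γ| ≤ 20mq⁴, and 20/36 = 5/9.
  have hγ : |γ| * (m * q ^ 2) ≤ (5 / 9) * q ^ 4 := by
    have h3 : |γ| * |τ₂.center.2 - τ₁.center.2| ^ 2 ≤ 2 * D := by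
      have : γ * (τ₂.center.2 - τ₁.center.2) ^ 2 =
        (τ₂.center.1 - τ₁.center.1 + γ * τ₂.center.2 * (τ₂.center.2 - τ₁.center.2)) -
        (τ₂.center.1 - τ₁.center.1 + γ * τ₁.center.2 * (τ₂.center.2 - τ₁.center.2)) := by ring
      rw [← abs_pow, ← abs_mul, this]
      exact (abs_sub _ _).trans (by linarith)
    have h4 : (6 * (m * q)) ^ 2 ≤ |τ₂.center.2 - τ₁.center.2| ^ 2 := by
      rw [abs_sub_comm] at h12
      exact pow_le_pow_left₀ (by positivity) h12.le 2
    have h5 : |γ| * (6 * (m * q)) ^ 2 ≤ 2 * D :=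
      (mul_le_mul_of_nonneg_left h4 (abs_nonneg γ)).trans h3
    have h6 : (|γ| * (m * q ^ 2)) * (36 * m) ≤ ((5 / 9) * q ^ 4) * (36 * m) := by
      rw [hD] at h5; nlinarith
    exact le_of_mul_le_mul_right h6 (by linarith)
  have hγ' : |γ| ≤ q ^ 2 * (5 / 9) := by
    have h1 : |γ| * q ^ 2 ≤ |γ| * (m * q ^ 2) := by
      have : q ^ 2 ≤ m * q ^ 2 := by nlinarith [sq_nonneg q]
      gcongr
    have h2 : |γ| * q ^ 2 ≤ (q ^ 2 * (5 / 9)) * q ^ 2 := by nlinarith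
    exact le_of_mul_le_mul_right h2 (by positivity)
  -- The shear γ·y·(difference of heights) is now at most (5/9)(3/2)·2·q² = (5/3)q², and D ≤ mq²/10.
  have hclose : ∀ a ∈ J, ∀ b ∈ J, D ≤ |b.center.2 - a.center.2| →
      |b.center.1 - a.center.1| ≤ 3 * (m * q ^ 2) := by
    intro a ha b hb hab
    obtain ⟨h1, -⟩ := hnot a ha b hb hab
    obtain ⟨-, hb2⟩ := center_mem hK1 hμK h𝒞 (hJ hb)
    obtain ⟨-, ha2⟩ := center_mem hK1 hμK h𝒞 (hJ ha)
    have h2 : |γ * b.center.2 * (b.center.2 - a.center.2)| ≤ q ^ 2 * (5 / 9) * (3 / 2) * 2 := by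
      rw [abs_mul, abs_mul]
      have : |b.center.2| ≤ 3 / 2 := by rw [abs_le] at *; constructor <;> linarith
      have : |b.center.2 - a.center.2| ≤ 2 := by rw [abs_le] at *; constructor <;> linarith
      gcongr
    have h3 : q ^ 2 ≤ m * q ^ 2 := by nlinarith [sq_nonneg q]
    rw [abs_le] at h2 ⊢
    rw [abs_lt] at h1
    constructor <;> linarith
  refine (exists_mem_verticalFamily hK0 hμ0 (hJ h₁) (h𝒞.nondegenerate τ₁ (hJ h₁))).elim
    fun k hk => ⟨_, card_Icc_window k, Or.inr ⟨?_, fun τ hτ => ?_⟩⟩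
  · have := mul_le_mul_of_nonneg_right hγ' (Real.sqrt_nonneg K)
    nlinarith
  obtain ⟨ℓ, hℓ⟩ := exists_mem_verticalFamily hK0 hμ0 (hJ hτ) (h𝒞.nondegenerate τ (hJ hτ))
  refine Finset.mem_biUnion.2 ⟨ℓ, index_near (by positivity) (center_vertical hK1 hμ h𝒞 hk)
      (center_vertical hK1 hμ h𝒞 hℓ) ?_, hℓ⟩
  rw [hq2]
  -- A cap too close in height to τ₁ for a direct comparison is at height distance at least D from
  -- τ₂. Passing through τ₂ costs 3 + 3 = 6 widths, which is what `index_near` allows.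
  by_cases hc : D ≤ |τ₁.center.2 - τ.center.2|
  · have := hclose τ hτ τ₁ h₁ hc
    have h3 : 0 < m * q ^ 2 := by positivity
    linarith
  · have h5 : D ≤ |τ₂.center.2 - τ.center.2| := by
      push Not at hc
      have := abs_sub_le τ₁.center.2 τ.center.2 τ₂.center.2
      rw [abs_sub_comm τ.center.2] at this
      linarith
    have h6 := hclose τ hτ τ₂ h₂ h5
    have h7 := hclose τ₂ h₂ τ₁ h₁ (by linarith)
    have := abs_sub_le τ₁.center.1 τ₂.center.1 τ.center.1
    linarith

/-! ### Counting caps and tubes -/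

lemma card_Icc_floor_le {a b : ℝ} (hab : a ≤ b) :
    ((Finset.Icc ⌊a⌋ ⌊b⌋).card : ℝ) ≤ b - a + 2 := by
  have h0 : ⌊a⌋ ≤ ⌊b⌋ := Int.floor_le_floor hab
  have h := Int.card_Icc_of_le ⌊a⌋ ⌊b⌋ (by omega)
  have h' : ((Finset.Icc ⌊a⌋ ⌊b⌋).card : ℝ) = ⌊b⌋ + 1 - ⌊a⌋ := by exact_mod_cast h
  rw [h']
  linarith [Int.floor_le b, Int.lt_floor_add_one a]

/-- On a grid of mesh 1/(2K) two centers in the same cell would be closer than K^{-1}. The centers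
lie in a square of side 2, and 25K² ≤ K³. -/
lemma card_capFamily_le {K μ : ℝ} (hK : 10000 ≤ K) (hμK : μ ≤ K) {𝒞 : Finset Cap}
    (h𝒞 : IsCapFamily K μ 𝒞) : (𝒞.card : ℝ) ≤ K ^ 3 := by
  classical
  have hK0 : 0 < K := by linarith
  set I := Finset.Icc ⌊-K⌋ ⌊3 * K⌋
  have hI : (I.card : ℝ) ≤ 5 * K := (card_Icc_floor_le (by linarith)).trans (by linarith)
  have hle : 𝒞.card ≤ (I ×ˢ I).card := by
    refine Finset.card_le_card_of_injOn
      (fun τ => (⌊2 * K * τ.center.1⌋, ⌊2 * K * τ.center.2⌋)) ?_ ?_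
    · intro τ hτ
      obtain ⟨h1, h2⟩ := center_mem (by linarith) hμK h𝒞 hτ
      simp only [abs_le] at h1 h2
      simp only [Finset.coe_product, mem_prod, Finset.mem_coe, I, Finset.mem_Icc]
      refine ⟨⟨?_, ?_⟩, ⟨?_, ?_⟩⟩ <;> refine Int.floor_le_floor ?_ <;> nlinarith
    · intro τ hτ τ' hτ' h
      by_contra hne
      have hs := h𝒞.separated τ hτ τ' hτ' hne
      simp only [Prod.mk.injEq] at h
      have h1 := Int.abs_sub_lt_one_of_floor_eq_floor h.1
      have h2 := Int.abs_sub_lt_one_of_floor_eq_floor h.2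
      rw [← mul_sub, ← sq_lt_one_iff_abs_lt_one, mul_pow] at h1 h2
      have h3 : K⁻¹ ^ 2 ≤ (τ.center.1 - τ'.center.1) ^ 2 + (τ.center.2 - τ'.center.2) ^ 2 :=
        (Real.le_sqrt' (by positivity)).1 hs
      have h4 : (2 * K) ^ 2 * K⁻¹ ^ 2 = 4 := by field_simp; norm_num
      have h5 := mul_le_mul_of_nonneg_left h3 (sq_nonneg (2 * K))
      rw [h4, mul_add] at h5
      linarith
  calc (𝒞.card : ℝ) ≤ ((I ×ˢ I).card : ℝ) := by exact_mod_cast hle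
    _ = (I.card : ℝ) * I.card := by rw [Finset.card_product]; push_cast; rfl
    _ ≤ (5 * K) * (5 * K) := by gcongr
    _ ≤ K ^ 3 := by nlinarith [mul_pos hK0 hK0]

lemma normalVec_ne_zero (γ : ℝ) (z : ℝ × ℝ) : normalVec γ z ≠ 0 := by
  intro h
  have := congrArg (fun v : E3 => v 2) h
  simp [normalVec] at this

lemma norm_nu (γ R : ℝ) (θ : ℕ × ℕ) : ‖nu γ R θ‖ = 1 := by
  rw [nu, norm_smul, norm_inv, norm_norm]
  exact inv_mul_cancel₀ (norm_ne_zero_iff.2 (normalVec_ne_zero _ _))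

lemma norm_le_of_mem_cube {R : ℝ} (hR : 0 ≤ R) {ξ : E3} (h : ξ ∈ cube R) : ‖ξ‖ ≤ 2 * R := by
  rw [EuclideanSpace.norm_eq, Real.sqrt_le_left (by linarith), Fin.sum_univ_three]
  simp only [Real.norm_eq_abs]
  have h0 := pow_le_pow_left₀ (abs_nonneg _) (h 0) 2
  have h1 := pow_le_pow_left₀ (abs_nonneg _) (h 1) 2
  have h2 := pow_le_pow_left₀ (abs_nonneg _) (h 2) 2
  nlinarith [sq_nonneg R]

/-- For a point of the tube in the cube, the norm, the axial part and the distance to the axis are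
at most 2R, 2R and R. -/
lemma norm_base_le {γ R δ : ℝ} (hR : 1 ≤ R) (hδ : δ ≤ 1 / 2) {𝕋 : Finset Tube}
    (h𝕋 : IsTubeFamily γ R δ 𝕋) {T : Tube} (hT : T ∈ 𝕋) : ‖T.base‖ ≤ 5 * R := by
  obtain ⟨ξ, ⟨-, h1⟩, h2⟩ := h𝕋.meets T hT
  have h3 := norm_le_of_mem_cube (by linarith) h2
  have h4 : R ^ (1 / 2 + δ) ≤ R := by
    conv_rhs => rw [← Real.rpow_one R]
    exact Real.rpow_le_rpow_of_exponent_le hR (by linarith)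
  have h5 : ‖(inner ℝ ξ (nu γ R T.theta)) • nu γ R T.theta‖ ≤ 2 * R := by
    rw [norm_smul, norm_nu, mul_one]
    refine (norm_inner_le_norm _ _).trans ?_
    rw [norm_nu, mul_one]; exact h3
  have h6 : T.base = ξ - (inner ℝ ξ (nu γ R T.theta)) • nu γ R T.theta -
      (ξ - (inner ℝ ξ (nu γ R T.theta)) • nu γ R T.theta - T.base) := by abel
  rw [h6]
  refine (norm_sub_le _ _).trans ?_
  have := norm_sub_le ξ ((inner ℝ ξ (nu γ R T.theta)) • nu γ R T.theta)
  linarith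

lemma abs_apply_le_norm (v : E3) (i : Fin 3) : |v i| ≤ ‖v‖ := by
  simpa using PiLp.norm_apply_le v i

/-- For fixed θ, two bases in one cell of a grid of mesh R^{1/2}/2 would have squared distance below
3R/4, against the separation R^{1/2}. The crude exponent 10 is harmless next to R^{-1000}. -/
lemma card_tubeFamily_le {γ R δ : ℝ} (hR : 100 ≤ R) (hδ : δ ≤ 1 / 2) {𝕋 : Finset Tube}
    (h𝕋 : IsTubeFamily γ R δ 𝕋) : (𝕋.card : ℝ) ≤ R ^ 10 := by
  classical
  set r := √R with hr
  have hr2 : r ^ 2 = R := Real.sq_sqrt (by linarith)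
  have hr10 : 10 ≤ r := by
    rw [hr, show (10 : ℝ) = √(10 ^ 2) by simp]; exact Real.sqrt_le_sqrt (by linarith)
  have hr0 : 0 < r := by linarith
  set I := Finset.Icc ⌊-(10 * r)⌋ ⌊10 * r⌋
  set N := Finset.range ⌈r⌉₊
  have hI : (I.card : ℝ) ≤ 22 * r := (card_Icc_floor_le (by linarith)).trans (by linarith)
  have hN : (N.card : ℝ) ≤ 2 * r := by
    rw [Finset.card_range]
    have := Nat.ceil_lt_add_one hr0.le
    linarith
  have hle : 𝕋.card ≤ ((N ×ˢ N) ×ˢ (I ×ˢ (I ×ˢ I))).card := by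
    refine Finset.card_le_card_of_injOn
      (fun T => (T.theta, (⌊2 * T.base 0 / r⌋, (⌊2 * T.base 1 / r⌋, ⌊2 * T.base 2 / r⌋)))) ?_ ?_
    · intro T hT
      have hθ := h𝕋.index T hT
      have hb := norm_base_le (by linarith) hδ h𝕋 hT
      have hi : ∀ i, ⌊2 * T.base i / r⌋ ∈ I := by
        intro i
        have h1 := (abs_apply_le_norm T.base i).trans hb
        rw [abs_le] at h1
        rw [Finset.mem_Icc]
        constructor <;> refine Int.floor_le_floor ?_
        · rw [le_div_iff₀ hr0]; nlinarith
        · rw [div_le_iff₀ hr0]; nlinarith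
      simp only [Finset.coe_product, mem_prod, Finset.mem_coe]
      exact ⟨⟨Finset.mem_range.2 (Nat.lt_ceil.2 hθ.1), Finset.mem_range.2 (Nat.lt_ceil.2 hθ.2)⟩,
        hi 0, hi 1, hi 2⟩
    · intro T hT T' hT' h
      by_contra hne
      simp only [Prod.mk.injEq] at h
      obtain ⟨hθ, h0, h1, h2⟩ := h
      have hs := h𝕋.separated T hT T' hT' hθ hne
      have key : ∀ i, ⌊2 * T.base i / r⌋ = ⌊2 * T'.base i / r⌋ →
          4 * (T.base i - T'.base i) ^ 2 < R := by
        intro i h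
        have := Int.abs_sub_lt_one_of_floor_eq_floor h
        rw [← sub_div, ← mul_sub, ← sq_lt_one_iff_abs_lt_one, div_pow, div_lt_one (by positivity),
          hr2] at this
        linarith
      rw [EuclideanSpace.dist_eq, Fin.sum_univ_three, Real.sqrt_le_sqrt_iff (by positivity)] at hs
      simp only [Real.dist_eq, sq_abs] at hs
      linarith [key 0 h0, key 1 h1, key 2 h2]
  calc (𝕋.card : ℝ) ≤ (((N ×ˢ N) ×ˢ (I ×ˢ (I ×ˢ I))).card : ℝ) := by exact_mod_cast hle
    _ = ((N.card : ℝ) * N.card) * (I.card * (I.card * I.card)) := by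
      simp only [Finset.card_product]; push_cast; rfl
    _ ≤ ((2 * r) * (2 * r)) * ((22 * r) * ((22 * r) * (22 * r))) := by gcongr
    _ = 42592 * r ^ 5 := by ring
    _ ≤ r ^ 15 * r ^ 5 := by
      gcongr
      calc (42592 : ℝ) ≤ 10 ^ 15 := by norm_num
        _ ≤ r ^ 15 := by gcongr
    _ = R ^ 10 := by rw [← hr2]; ring

/-! ### Decomposition into tangential and transversal parts -/

lemma integrable_packet {γ R δ C : ℝ} {𝕋 : Finset Tube} {g : PlaneFun} {F : Tube → PlaneFun}
    (h : IsWavePacketDecomposition γ R δ C 𝕋 g F) {T : Tube} (hT : T ∈ 𝕋) : Integrable (F T) :=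
  integrable_of_memLp_of_support (h.memLp T hT) (isCompact_square _ _) (h.support T hT)

lemma mem_tangTubes {γ R δ : ℝ} {P : MvPolynomial (Fin 3) ℝ} {c : E3} {𝕋 : Finset Tube}
    {T : Tube} : T ∈ tangTubes γ R δ P c 𝕋 ↔ T ∈ 𝕋 ∧
      (T.carrier γ R δ ∩ wall R δ P ∩ Metric.closedBall c (R ^ (1 - δ))).Nonempty ∧
        AlmostTangent γ R δ P c T := by
  simp only [tangTubes, Finset.mem_filter]

lemma mem_transTubes {γ R δ : ℝ} {P : MvPolynomial (Fin 3) ℝ} {c : E3} {𝕋 : Finset Tube}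
    {T : Tube} : T ∈ transTubes γ R δ P c 𝕋 ↔ T ∈ 𝕋 ∧
      (T.carrier γ R δ ∩ wall R δ P ∩ Metric.closedBall c (R ^ (1 - δ))).Nonempty ∧
        ¬ AlmostTangent γ R δ P c T := by
  simp only [transTubes, Finset.mem_filter, AlmostTangent, not_forall, not_le, exists_prop]

/-- If ξ lies in T, then ξ itself witnesses that T meets W ∩ B_j, so T is tangential or transversal.
The remaining tubes miss ξ and are negligible by localization. -/
lemma norm_ext_sub_tang_sub_trans_le {γ R δ C : ℝ} (hR : 0 < R) {𝕋 : Finset Tube}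
    {g : PlaneFun} {F : Tube → PlaneFun} (h : IsWavePacketDecomposition γ R δ C 𝕋 g F)
    (P : MvPolynomial (Fin 3) ℝ) {c ξ : E3} (hξ : ξ ∈ cube R)
    (hξ' : ξ ∈ Metric.closedBall c (R ^ (1 - δ)) ∩ wall R δ P) :
    ‖ext γ g ξ - ext γ (∑ T ∈ tangTubes γ R δ P c 𝕋, F T) ξ -
      ext γ (∑ T ∈ transTubes γ R δ P c 𝕋, F T) ξ‖ ≤
        (1 + 𝕋.card) * (R ^ (-1000 : ℝ) * l2norm g) := by
  classical
  set A := tangTubes γ R δ P c 𝕋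
  set B := transTubes γ R δ P c 𝕋
  have hA : A ⊆ 𝕋 := fun T hT => (mem_tangTubes.1 hT).1
  have hB : B ⊆ 𝕋 := fun T hT => (mem_transTubes.1 hT).1
  have hdis : Disjoint A B := Finset.disjoint_left.2 fun T h1 h2 =>
    (mem_transTubes.1 h2).2.2 (mem_tangTubes.1 h1).2.2
  have hsum : ∑ T ∈ 𝕋, ext γ (F T) ξ = ∑ T ∈ 𝕋 \ (A ∪ B), ext γ (F T) ξ +
      (∑ T ∈ A, ext γ (F T) ξ + ∑ T ∈ B, ext γ (F T) ξ) := by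
    rw [← Finset.sum_union hdis, Finset.sum_sdiff (Finset.union_subset hA hB)]
  rw [ext_sum A (fun T hT => integrable_packet h (hA hT)),
    ext_sum B (fun T hT => integrable_packet h (hB hT))]
  have hout : ‖∑ T ∈ 𝕋 \ (A ∪ B), ext γ (F T) ξ‖ ≤
      𝕋.card * (R ^ (-1000 : ℝ) * l2norm g) := by
    have h0 : 0 ≤ R ^ (-1000 : ℝ) * l2norm g :=
      mul_nonneg (Real.rpow_nonneg hR.le _) ENNReal.toReal_nonneg
    calc ‖∑ T ∈ 𝕋 \ (A ∪ B), ext γ (F T) ξ‖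
        ≤ ∑ T ∈ 𝕋 \ (A ∪ B), R ^ (-1000 : ℝ) * l2norm g := by
          refine norm_sum_le_of_le _ fun T hT => ?_
          obtain ⟨hT1, hT2⟩ := Finset.mem_sdiff.1 hT
          refine h.localized T hT1 ξ ⟨hξ, fun hmem => hT2 ?_⟩
          have hne : (T.carrier γ R δ ∩ wall R δ P ∩
            Metric.closedBall c (R ^ (1 - δ))).Nonempty := ⟨ξ, ⟨hmem, hξ'.2⟩, hξ'.1⟩
          by_cases ht : AlmostTangent γ R δ P c T
          · exact Finset.mem_union_left _ (mem_tangTubes.2 ⟨hT1, hne, ht⟩)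
          · exact Finset.mem_union_right _ (mem_transTubes.2 ⟨hT1, hne, ht⟩)
      _ ≤ 𝕋.card * (R ^ (-1000 : ℝ) * l2norm g) := by
          rw [Finset.sum_const, nsmul_eq_mul]
          gcongr
          exact Finset.sdiff_subset
  have hrec := h.reconstruct ξ hξ
  rw [hsum] at hrec
  calc _ = ‖(ext γ g ξ - (∑ T ∈ 𝕋 \ (A ∪ B), ext γ (F T) ξ +
      (∑ T ∈ A, ext γ (F T) ξ + ∑ T ∈ B, ext γ (F T) ξ))) +
      ∑ T ∈ 𝕋 \ (A ∪ B), ext γ (F T) ξ‖ := by congr 1; ring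
    _ ≤ _ := (norm_add_le _ _).trans (by linarith)

/-! ### The broad part -/

lemma Br_nonneg (γ K μ : ℝ) (𝒞 : Finset Cap) (α : ℝ) (g : Cap → PlaneFun) (ξ : E3) :
    0 ≤ Br γ K μ 𝒞 α g ξ := by
  unfold Br; split_ifs <;> positivity

lemma Bil_nonneg (γ K μ : ℝ) (𝒞 : Finset Cap) (h : Cap → PlaneFun) (ξ : E3) :
    0 ≤ Bil γ K μ 𝒞 h ξ := Real.iSup_nonneg fun _ => by positivity

/-- A real supremum dominates its members only when they are bounded above, which here follows from
the finiteness of the set of pairs. -/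
lemma le_Bil {γ K μ : ℝ} {𝒞 : Finset Cap} (h : Cap → PlaneFun) (ξ : E3) {τ₁ τ₂ : Cap}
    (h₁ : τ₁ ∈ 𝒞) (h₂ : τ₂ ∈ 𝒞) (hs : StronglySeparated γ K μ τ₁ τ₂) :
    √‖ext γ (h τ₁) ξ‖ * √‖ext γ (h τ₂) ξ‖ ≤ Bil γ K μ 𝒞 h ξ := by
  have : Finite {p : Cap × Cap // p.1 ∈ 𝒞 ∧ p.2 ∈ 𝒞 ∧ StronglySeparated γ K μ p.1 p.2} :=
    Set.Finite.to_subtype (((𝒞 ×ˢ 𝒞).finite_toSet).subset fun p hp => by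
      simpa using ⟨hp.1, hp.2.1⟩)
  exact le_ciSup (f := fun p : {p : Cap × Cap // p.1 ∈ 𝒞 ∧ p.2 ∈ 𝒞 ∧
    StronglySeparated γ K μ p.1 p.2} => √‖ext γ (h p.1.1) ξ‖ * √‖ext γ (h p.1.2) ξ‖)
    (Set.finite_range _).bddAbove ⟨(τ₁, τ₂), h₁, h₂, hs⟩

open Classical in
lemma sum_restrictCaps (S I : Finset Cap) (g : Cap → PlaneFun) :
    ∑ τ ∈ S, restrictCaps I g τ = ∑ τ ∈ S ∩ I, g τ := by
  simp only [restrictCaps]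
  rw [← Finset.sum_filter, Finset.filter_mem_eq_inter]

open Classical in
/-- If the exceptional set `B` of caps meets every ragged family in a set with a small sum, and
the tangential parts are small off `B`, then the transversal part over the complement of `B` is
broad and comparable to the whole. -/
lemma trans_broad {γ K μ α κ : ℝ} {𝒞 B : Finset Cap} {f h : Cap → PlaneFun} {t : Cap → ℂ}
    {ξ : E3} (hf : ∀ τ ∈ 𝒞, Integrable (f τ)) (hh : ∀ τ ∈ 𝒞, Integrable (h τ))
    (hα0 : 0 ≤ α) (hα : α ≤ 10 ^ (-5 : ℤ)) (hbr : IsBroad γ K μ 𝒞 α f ξ)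
    (hB : ∀ S, S = 𝒞 ∨ S ∈ raggedFamilies γ K μ 𝒞 →
      ‖∑ τ ∈ S ∩ B, ext γ (f τ) ξ‖ ≤ 20 * (α * ‖ext γ (∑ τ ∈ 𝒞, f τ) ξ‖))
    (ht : ∀ τ ∈ 𝒞, τ ∉ B → ‖t τ‖ ≤ κ * ‖ext γ (∑ τ ∈ 𝒞, f τ) ξ‖) (hκ : 𝒞.card * κ ≤ α)
    (hκ0 : 0 ≤ κ)
    (herr : ∑ τ ∈ 𝒞, ‖ext γ (f τ) ξ - t τ - ext γ (h τ) ξ‖ ≤ α * ‖ext γ (∑ τ ∈ 𝒞, f τ) ξ‖) :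
    ‖ext γ (∑ τ ∈ 𝒞, f τ) ξ‖ ≤ 2 * Br γ K μ 𝒞 (60 * α) (restrictCaps (𝒞 \ B) h) ξ := by
  set A := ‖ext γ (∑ τ ∈ 𝒞, f τ) ξ‖ with hA
  have hA0 : 0 ≤ A := norm_nonneg _
  -- Off B the functions f and h differ by the decomposition error and by the tangential parts; each
  -- contributes at most αA.
  have hdiff : ∀ S ⊆ 𝒞, ‖∑ τ ∈ S \ B, ext γ (f τ) ξ - ∑ τ ∈ S \ B, ext γ (h τ) ξ‖ ≤
      2 * (α * A) := by
    intro S hS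
    have hS' : S \ B ⊆ 𝒞 := Finset.sdiff_subset.trans hS
    have e : ∑ τ ∈ S \ B, ext γ (f τ) ξ - ∑ τ ∈ S \ B, ext γ (h τ) ξ =
        ∑ τ ∈ S \ B, (ext γ (f τ) ξ - t τ - ext γ (h τ) ξ) + ∑ τ ∈ S \ B, t τ := by
      simp only [Finset.sum_sub_distrib]; ring
    rw [e]
    have h1 : ‖∑ τ ∈ S \ B, (ext γ (f τ) ξ - t τ - ext γ (h τ) ξ)‖ ≤ α * A :=
      (norm_sum_le _ _).trans ((Finset.sum_le_sum_of_subset_of_nonneg hS'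
        fun _ _ _ => norm_nonneg _).trans herr)
    have h2 : ‖∑ τ ∈ S \ B, t τ‖ ≤ α * A := by
      calc ‖∑ τ ∈ S \ B, t τ‖ ≤ ∑ τ ∈ S \ B, κ * A := norm_sum_le_of_le _ fun τ hτ =>
            ht τ (hS' hτ) (Finset.mem_sdiff.1 hτ).2
        _ = (S \ B).card * κ * A := by rw [Finset.sum_const, nsmul_eq_mul, mul_assoc]
        _ ≤ 𝒞.card * κ * A := by gcongr
        _ ≤ α * A := by gcongr
    exact (norm_add_le _ _).trans (by linarith)
  have hsplit : ∀ S : Finset Cap, ∑ τ ∈ S \ B, ext γ (f τ) ξ =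
      ∑ τ ∈ S, ext γ (f τ) ξ - ∑ τ ∈ S ∩ B, ext γ (f τ) ξ := by
    intro S
    rw [← Finset.sum_sdiff (Finset.inter_subset_left : S ∩ B ⊆ S), Finset.sdiff_inter_self_left]
    ring
  have hext : ∀ S ⊆ 𝒞, ext γ (∑ τ ∈ S, restrictCaps (𝒞 \ B) h τ) ξ =
      ∑ τ ∈ S \ B, ext γ (h τ) ξ := by
    intro S hS
    have : S ∩ (𝒞 \ B) = S \ B := by
      ext τ; simp only [Finset.mem_inter, Finset.mem_sdiff]
      exact ⟨fun h => ⟨h.1, h.2.2⟩, fun h => ⟨h.1, hS h.1, h.2⟩⟩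
    rw [sum_restrictCaps, this, ext_sum]
    exact fun τ hτ => hh τ (hS (Finset.mem_sdiff.1 hτ).1)
  have hAs : A = ‖∑ τ ∈ 𝒞, ext γ (f τ) ξ‖ := by rw [hA, ext_sum 𝒞 hf]
  have hαA : α * A ≤ 10 ^ (-5 : ℤ) * A := by gcongr
  -- The total loss is 2αA + 20αA, far below A/2 since α ≤ 10^{-5}.
  have hlow : A ≤ 2 * ‖ext γ (∑ τ ∈ 𝒞, restrictCaps (𝒞 \ B) h τ) ξ‖ := by
    rw [hext 𝒞 subset_rfl]
    have h1 := hdiff 𝒞 subset_rfl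
    have h2 := hB 𝒞 (Or.inl rfl)
    have h3 : ‖∑ τ ∈ 𝒞, ext γ (f τ) ξ‖ ≤ ‖∑ τ ∈ 𝒞 \ B, ext γ (h τ) ξ‖ + 2 * (α * A) +
        20 * (α * A) := by
      calc _ = ‖∑ τ ∈ 𝒞 \ B, ext γ (h τ) ξ + (∑ τ ∈ 𝒞 \ B, ext γ (f τ) ξ -
            ∑ τ ∈ 𝒞 \ B, ext γ (h τ) ξ) + ∑ τ ∈ 𝒞 ∩ B, ext γ (f τ) ξ‖ := by
            congr 1; rw [hsplit 𝒞]; ring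
        _ ≤ _ := norm_add₃_le.trans (by gcongr)
    rw [← hAs] at h3
    norm_num at hαA
    linarith
  -- On a ragged family the sum is at most (1 + 20 + 2)αA, and A is at most twice the new total, so
  -- 46α would suffice.
  have hbroad : IsBroad γ K μ 𝒞 (60 * α) (restrictCaps (𝒞 \ B) h) ξ := by
    intro S hS
    have hS𝒞 := subset_of_mem_raggedFamilies hS
    rw [hext S hS𝒞]
    have h1 := hdiff S hS𝒞
    have h2 := hB S (Or.inr hS)
    have h0 := hbr S hS
    rw [ext_sum S fun τ hτ => hf τ (hS𝒞 hτ)] at h0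
    have h3 : ‖∑ τ ∈ S \ B, ext γ (h τ) ξ‖ ≤ 23 * (α * A) := by
      calc _ = ‖∑ τ ∈ S, ext γ (f τ) ξ - ∑ τ ∈ S ∩ B, ext γ (f τ) ξ -
            (∑ τ ∈ S \ B, ext γ (f τ) ξ - ∑ τ ∈ S \ B, ext γ (h τ) ξ)‖ := by
            congr 1; rw [hsplit S]; ring
        _ ≤ α * A + 20 * (α * A) + 2 * (α * A) :=
            (norm_sub_le _ _).trans (add_le_add ((norm_sub_le _ _).trans (add_le_add h0 h2)) h1)
        _ = _ := by ring
    have := mul_le_mul_of_nonneg_left hlow hα0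
    have h4 : 0 ≤ α * A := by positivity
    linarith
  rw [Br, if_pos hbroad]
  exact hlow

lemma bigK_large {ε : ℝ} (h0 : 0 < ε) (h1 : ε < 10 ^ (-10 : ℤ)) : 10000 ≤ bigK ε := by
  have h2 : (10 : ℝ) ^ 5 ≤ ε ^ (-10 : ℤ) := by
    rw [zpow_neg, le_inv_comm₀ (by positivity) (by positivity)]
    have h3 : ε ≤ 1 / 10 := h1.le.trans (by norm_num)
    calc ε ^ (10 : ℤ) = ε ^ 10 := by norm_cast
      _ ≤ (1 / 10) ^ 10 := by gcongr
      _ ≤ _ := by norm_num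
  have h4 := Real.add_one_le_exp (ε ^ (-10 : ℤ))
  unfold bigK
  norm_num at h2 h4 ⊢
  linarith

open Classical in
theorem broad_le {ε : ℝ} (hε0 : 0 < ε) (hε : ε < 10 ^ (-10 : ℤ)) {R : ℝ} (hR : bigK ε ≤ R)
    {γ : ℝ} {𝕋 : Finset Tube} (h𝕋 : IsTubeFamily γ R (ε ^ 2) 𝕋) {α μ : ℝ}
    (hα : bigK ε ^ (-ε) ≤ α) (hμ : 1 ≤ μ) (hαμ : α * μ ≤ 10 ^ (-5 : ℤ))
    {𝒞 : Finset Cap} (h𝒞 : IsCapFamily (bigK ε) μ 𝒞) {f : Cap → PlaneFun}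
    (hf : ∀ τ ∈ 𝒞, MemLp (f τ) 2 volume ∧ Function.support (f τ) ⊆ τ.carrier)
    {C : ℝ} {F : Cap → Tube → PlaneFun}
    (hF : ∀ τ ∈ 𝒞, IsWavePacketDecomposition γ R (ε ^ 2) C 𝕋 (f τ) (F τ))
    (P : MvPolynomial (Fin 3) ℝ) {c ξ : E3} (hξ : ξ ∈ cube R)
    (hξ' : ξ ∈ Metric.closedBall c (R ^ (1 - ε ^ 2)) ∩ wall R (ε ^ 2) P) :
    Br γ (bigK ε) μ 𝒞 α f ξ ≤
      2 * (∑ I ∈ 𝒞.powerset, Br γ (bigK ε) μ 𝒞 (60 * α)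
          (restrictCaps I (transPart γ R (ε ^ 2) P c 𝕋 F)) ξ
        + bigK ε ^ 100 * Bil γ (bigK ε) μ 𝒞 (tangPart γ R (ε ^ 2) P c 𝕋 F) ξ
        + R ^ (-900 : ℝ) * ∑ τ ∈ 𝒞, l2norm (f τ)) := by
  have hK := bigK_large hε0 hε
  have hε1 : ε ≤ 1 / 10 := hε.le.trans (by norm_num)
  set K := bigK ε
  set δ := ε ^ 2
  have hK0 : 0 < K := by linarith
  have hK1 : 1 ≤ K := by linarith
  have hR0 : 0 < R := by linarith
  have hδ : δ ≤ 1 / 2 := by simp only [δ]; nlinarith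
  set t := tangPart γ R δ P c 𝕋 F
  set r := transPart γ R δ P c 𝕋 F
  set nf := ∑ τ ∈ 𝒞, l2norm (f τ)
  have hnf : 0 ≤ nf := Finset.sum_nonneg fun _ _ => ENNReal.toReal_nonneg
  have hBr : ∀ I, 0 ≤ Br γ K μ 𝒞 (60 * α) (restrictCaps I r) ξ := fun I => Br_nonneg _ _ _ _ _ _ _
  have hBrs := Finset.sum_nonneg fun I (_ : I ∈ 𝒞.powerset) => hBr I
  have hBil : 0 ≤ K ^ 100 * Bil γ K μ 𝒞 t ξ := mul_nonneg (by positivity) (Bil_nonneg _ _ _ _ _ _)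
  have hlast : 0 ≤ R ^ (-900 : ℝ) * nf := by positivity
  by_cases hbr : IsBroad γ K μ 𝒞 α f ξ
  swap
  · rw [Br, if_neg hbr]; linarith
  rw [Br, if_pos hbr]
  set A := ‖ext γ (∑ τ ∈ 𝒞, f τ) ξ‖ with hA
  have hA0 : 0 ≤ A := norm_nonneg _
  by_cases hbig : A ≤ 2 * (R ^ (-900 : ℝ) * nf)
  · linarith
  push Not at hbig
  -- Only α ≥ K^{-1} is needed. With αμ ≤ 10^{-5} it also yields μ ≤ K, on which the geometry of the
  -- caps relies.
  have hαK : K⁻¹ ≤ α := by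
    refine le_trans ?_ hα
    rw [← Real.rpow_neg_one]
    exact Real.rpow_le_rpow_of_exponent_le hK1 (by linarith)
  have hα0 : 0 < α := lt_of_lt_of_le (by positivity) hαK
  have hα5 : α ≤ 10 ^ (-5 : ℤ) := le_trans (by nlinarith) hαμ
  have hμK : μ ≤ K := by
    have h1 : K⁻¹ * μ ≤ 1 :=
      (mul_le_mul_of_nonneg_right hαK (by linarith)).trans (hαμ.trans (by norm_num))
    rwa [inv_mul_le_iff₀ hK0, mul_one] at h1
  have hfi : ∀ τ ∈ 𝒞, Integrable (f τ) := fun τ hτ => integrable_cap (hf τ hτ).1 (hf τ hτ).2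
  have hri : ∀ τ ∈ 𝒞, Integrable (r τ) := fun τ hτ =>
    integrable_finsetSum' _ fun T hT => integrable_packet (hF τ hτ) (mem_transTubes.1 hT).1
  have hRK : R ^ (-90 : ℝ) ≤ α := by
    refine le_trans ?_ hαK
    calc R ^ (-90 : ℝ) ≤ R ^ (-1 : ℝ) :=
          Real.rpow_le_rpow_of_exponent_le (by linarith) (by norm_num)
      _ = R⁻¹ := Real.rpow_neg_one R
      _ ≤ K⁻¹ := inv_anti₀ hK0 hR
  -- R^{10} tubes with error R^{-1000} leave R^{-90}·R^{-900}. The second factor is absorbed by the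
  -- lower bound for A, the first by α ≥ K^{-1} ≥ R^{-1}.
  have herr : ∑ τ ∈ 𝒞, ‖ext γ (f τ) ξ - ext γ (t τ) ξ - ext γ (r τ) ξ‖ ≤ α * A := by
    have hcard : (1 + (𝕋.card : ℝ)) * R ^ (-1000 : ℝ) ≤ 2 * (R ^ (-90 : ℝ) * R ^ (-900 : ℝ)) := by
      have h1 := card_tubeFamily_le (by linarith) hδ h𝕋
      have h2 : (1 : ℝ) ≤ R ^ 10 := one_le_pow₀ (by linarith)
      calc (1 + (𝕋.card : ℝ)) * R ^ (-1000 : ℝ) ≤ (2 * R ^ 10) * R ^ (-1000 : ℝ) := by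
            gcongr; linarith
        _ = 2 * (R ^ (-90 : ℝ) * R ^ (-900 : ℝ)) := by
            rw [mul_assoc, ← Real.rpow_natCast R 10, ← Real.rpow_add hR0, ← Real.rpow_add hR0]
            norm_num
    calc _ ≤ ∑ τ ∈ 𝒞, (1 + (𝕋.card : ℝ)) * (R ^ (-1000 : ℝ) * l2norm (f τ)) :=
          Finset.sum_le_sum fun τ hτ =>
            norm_ext_sub_tang_sub_trans_le hR0 (hF τ hτ) P hξ hξ'
      _ = ((1 + (𝕋.card : ℝ)) * R ^ (-1000 : ℝ)) * nf := by
          rw [← Finset.mul_sum, ← Finset.mul_sum, mul_assoc]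
      _ ≤ (2 * (R ^ (-90 : ℝ) * R ^ (-900 : ℝ))) * nf := by gcongr
      _ = R ^ (-90 : ℝ) * (2 * (R ^ (-900 : ℝ) * nf)) := by ring
      _ ≤ α * A := by gcongr
  -- The threshold has to beat the number K^3 of caps with K^{-1} ≤ α to spare, and its inverse is
  -- the factor in front of Bil.
  set κ := (K ^ 100)⁻¹ with hκ
  have hκ0 : 0 ≤ κ := by positivity
  have hcκ : 𝒞.card * κ ≤ α := by
    refine le_trans ?_ hαK
    calc 𝒞.card * κ ≤ K ^ 3 * κ := by gcongr; exact card_capFamily_le hK hμK h𝒞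
      _ = (K ^ 96)⁻¹ * K⁻¹ := by rw [hκ]; field_simp
      _ ≤ 1 * K⁻¹ := by gcongr; exact inv_le_one_of_one_le₀ (one_le_pow₀ hK1)
      _ = K⁻¹ := one_mul _
  set J := 𝒞.filter fun τ => κ * A < ‖ext γ (t τ) ξ‖
  have hJ : J ⊆ 𝒞 := Finset.filter_subset _ _
  by_cases hsep : ∀ τ₁ ∈ J, ∀ τ₂ ∈ J, ¬ StronglySeparated γ K μ τ₁ τ₂
  swap
  · push Not at hsep
    obtain ⟨τ₁, h₁, τ₂, h₂, hs⟩ := hsep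
    have hle := le_Bil t ξ (hJ h₁) (hJ h₂) hs
    have hk : κ * A ≤ √‖ext γ (t τ₁) ξ‖ * √‖ext γ (t τ₂) ξ‖ := by
      have h1 := Real.sqrt_le_sqrt (Finset.mem_filter.1 h₁).2.le
      have h2 := Real.sqrt_le_sqrt (Finset.mem_filter.1 h₂).2.le
      rw [← Real.mul_self_sqrt (show 0 ≤ κ * A by positivity)]
      gcongr
    have h3 : A ≤ K ^ 100 * Bil γ K μ 𝒞 t ξ := by
      have := hk.trans hle
      rwa [hκ, inv_mul_le_iff₀ (by positivity)] at this
    linarith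
  obtain ⟨L, hL, hJL⟩ := exists_strips_of_not_separated hK hμ hμK h𝒞 hJ hsep
  have hαA : 0 ≤ α * A := by positivity
  have hfam : ∀ S ∈ raggedFamilies γ K μ 𝒞, ‖∑ τ ∈ S, ext γ (f τ) ξ‖ ≤ α * A := by
    intro S hS
    rw [← ext_sum S fun τ hτ => hfi τ (subset_of_mem_raggedFamilies hS hτ)]
    exact hbr S hS
  have hL' : (L.card : ℝ) * (α * A) ≤ 20 * (α * A) := by
    gcongr; exact_mod_cast hL
  -- J itself cannot be removed, because broadness controls whole families only. Hence B is the
  -- union of all families of strips in L.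
  obtain ⟨B, hJB, hB⟩ : ∃ B : Finset Cap, J ⊆ B ∧ ∀ S, S = 𝒞 ∨ S ∈ raggedFamilies γ K μ 𝒞 →
      ‖∑ τ ∈ S ∩ B, ext γ (f τ) ξ‖ ≤ 20 * (α * A) := by
    rcases hJL with hJL | ⟨hγ, hJL⟩
    · refine ⟨_, hJL, fun S hS => (norm_sum_inter_biUnion_le (𝓕 := raggedFamilies γ K μ 𝒞)
        (fun k ℓ h => disjoint_stripFamily 𝒞 (horizontalStrip K μ) h) ?_ hαA hfam L).trans hL'⟩
      rcases hS with rfl | hS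
      · exact fun k => Or.inr (Or.inl ⟨k, Finset.inter_eq_right.2
          (horizontalFamily_subset _ _ _ _)⟩)
      · exact inter_horizontalFamily hS
    · refine ⟨_, hJL, fun S hS => (norm_sum_inter_biUnion_le (𝓕 := raggedFamilies γ K μ 𝒞)
        (fun k ℓ h => disjoint_stripFamily 𝒞 (verticalStrip K μ) h) ?_ hαA hfam L).trans hL'⟩
      rcases hS with rfl | hS
      · exact fun k => Or.inr (Or.inr ⟨hγ, Or.inl ⟨k, Finset.inter_eq_right.2
          (verticalFamily_subset _ _ _ _)⟩⟩)
      · exact inter_verticalFamily hγ hS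
  have hmain := trans_broad (t := fun τ => ext γ (t τ) ξ) hfi hri hα0.le hα5 hbr hB
    (fun τ hτ hτB => not_lt.1 fun hlt => hτB (hJB (Finset.mem_filter.2 ⟨hτ, hlt⟩))) hcκ hκ0 herr
  have hone := Finset.single_le_sum (fun I (_ : I ∈ 𝒞.powerset) => hBr I)
    (Finset.mem_powerset.2 (Finset.sdiff_subset : 𝒞 \ B ⊆ 𝒞))
  linarith

/-! ### Decay of oscillatory integrals -/

section Decay

variable {V : Type*} [NormedAddCommGroup V] [NormedSpace ℝ V]

lemma hasCompactSupport_of_abs {E : Type*} [Zero E] {f : ℝ → E} {B : ℝ}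
    (h : ∀ u, B < |u| → f u = 0) : HasCompactSupport f := by
  refine HasCompactSupport.intro (isCompact_closedBall (0 : ℝ) B) fun u hu => h u ?_
  simpa [Real.dist_eq] using hu

/-- Fourier transforms in one variable of a smooth function with parameters decay rapidly,
uniformly for parameters in a compact set. -/
lemma exists_decay_of_contDiff {𝒦 : Set V} (h𝒦 : IsCompact 𝒦) (B : ℝ) (N : ℕ) :
    ∀ H : V × ℝ → ℂ, ContDiff ℝ (⊤ : ℕ∞) H → (∀ p u, B < |u| → H (p, u) = 0) →
      ∃ C, 0 ≤ C ∧ ∀ p ∈ 𝒦, ∀ t : ℝ,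
        |t| ^ N * ‖∫ u, H (p, u) * Complex.exp (Complex.I * ((t * u : ℝ) : ℂ))‖ ≤ C := by
  -- H is quantified after N, because integration by parts replaces H by its derivative in the last
  -- variable. Uniformity in p comes from compactness in the case N = 0.
  induction N with
  | zero =>
    intro H hH hB
    obtain ⟨M, hM⟩ := (h𝒦.prod (isCompact_Icc (a := -B) (b := B))).exists_bound_of_continuousOn
      hH.continuous.continuousOn
    refine ⟨max M 0 * volume.real (Icc (-B) B), by positivity, fun p hp t => ?_⟩
    rw [pow_zero, one_mul, ← setIntegral_eq_integral_of_forall_compl_eq_zero (s := Icc (-B) B)]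
    · refine norm_setIntegral_le_of_norm_le_const (by simp) fun u hu => ?_
      rw [norm_mul, norm_exp_I_mul, mul_one]
      exact (hM (p, u) ⟨hp, hu⟩).trans (le_max_left _ _)
    · intro u hu
      rw [hB p u, zero_mul]
      rw [mem_Icc, ← abs_le] at hu
      exact not_le.1 hu
  | succ N ih =>
    intro H hH hB
    set D : V × ℝ → ℂ := fun q => fderiv ℝ H q (0, 1) with hD
    have hDs : ContDiff ℝ (⊤ : ℕ∞) D :=
      (hH.fderiv_right (m := (⊤ : ℕ∞)) (by simp)).clm_apply contDiff_const
    have hDB : ∀ p u, B < |u| → D (p, u) = 0 := by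
      intro p u hu
      have : H =ᶠ[nhds (p, u)] fun _ => (0 : ℂ) := by
        have ho : IsOpen {q : V × ℝ | B < |q.2|} :=
          isOpen_lt continuous_const (continuous_abs.comp continuous_snd)
        filter_upwards [ho.mem_nhds (show (p, u) ∈ {q : V × ℝ | B < |q.2|} from hu)] with q hq
        exact hB q.1 q.2 hq
      rw [hD]
      simp only
      rw [this.fderiv_eq]
      simp
    obtain ⟨C, hC0, hC⟩ := ih D hDs hDB
    refine ⟨C, hC0, fun p hp t => ?_⟩
    have hderiv : ∀ u, HasDerivAt (fun u => H (p, u)) (D (p, u)) u := by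
      intro u
      have h1 : HasFDerivAt H (fderiv ℝ H (p, u)) (p, u) :=
        (hH.differentiable (by simp) _).hasFDerivAt
      have h2 : HasDerivAt (fun u : ℝ => (p, u)) ((0 : V), (1 : ℝ)) u :=
        (hasDerivAt_const u p).prodMk (hasDerivAt_id u)
      exact h1.comp_hasDerivAt u h2
    have hexp : ∀ u : ℝ, HasDerivAt (fun u : ℝ => Complex.exp (Complex.I * ((t * u : ℝ) : ℂ)))
        (Complex.I * t * Complex.exp (Complex.I * ((t * u : ℝ) : ℂ))) u := by
      intro u
      have h1 : HasDerivAt (fun u : ℝ => Complex.I * ((t * u : ℝ) : ℂ)) (Complex.I * t) u := by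
        have := ((hasDerivAt_id u).const_mul t).ofReal_comp.const_mul Complex.I
        simpa using this
      simpa [mul_comm] using h1.cexp
    have hHc : Continuous fun u => H (p, u) := hH.continuous.comp (by fun_prop)
    have hDc : Continuous fun u => D (p, u) := hDs.continuous.comp (by fun_prop)
    have hec : Continuous fun u : ℝ => Complex.exp (Complex.I * ((t * u : ℝ) : ℂ)) := by fun_prop
    have hHs : HasCompactSupport fun u => H (p, u) := hasCompactSupport_of_abs (hB p)
    have hDs' : HasCompactSupport fun u => D (p, u) := hasCompactSupport_of_abs (hDB p)
    have hibp := integral_mul_deriv_eq_deriv_mul_of_integrable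
      (u := fun u => H (p, u)) (u' := fun u => D (p, u)) (fun u _ => hderiv u) (fun u _ => hexp u)
      ((hHc.mul (by fun_prop)).integrable_of_hasCompactSupport hHs.mul_right)
      ((hDc.mul hec).integrable_of_hasCompactSupport hDs'.mul_right)
      ((hHc.mul hec).integrable_of_hasCompactSupport hHs.mul_right)
    have hkey : Complex.I * t * ∫ u, H (p, u) * Complex.exp (Complex.I * ((t * u : ℝ) : ℂ)) =
        -∫ u, D (p, u) * Complex.exp (Complex.I * ((t * u : ℝ) : ℂ)) := by
      rw [← hibp, ← integral_const_mul]
      congr 1; funext u; ring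
    have hnorm := congrArg norm hkey
    rw [norm_neg, norm_mul, norm_mul, Complex.norm_I, one_mul, Complex.norm_real,
      Real.norm_eq_abs] at hnorm
    rw [pow_succ, mul_assoc, hnorm]
    exact hC p hp t

end Decay

/-! ### Oscillatory integrals with smooth cutoffs -/

/-- Smooth real cutoffs on the line supported in `[-1,1]`. -/
structure IsCutoff (χ : ℝ → ℝ) : Prop where
  smooth : ContDiff ℝ (⊤ : ℕ∞) χ
  zero : ∀ u, 1 < |u| → χ u = 0

/-- A product cutoff times an exponential of a cubic phase without linear part. -/
noncomputable def osc (χ : ℝ → ℝ) (a b c : ℝ) (u : ℝ × ℝ) : ℂ :=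
  ((χ u.1 * χ u.2 : ℝ) : ℂ) *
    Complex.exp (Complex.I * ((a * (u.1 * u.2) + b * u.2 ^ 2 + c * u.2 ^ 3 : ℝ) : ℂ))

/-- The character of the plane with frequency `l`. -/
noncomputable def chr (l : ℂ) (u : ℝ × ℝ) : ℂ :=
  Complex.exp (Complex.I * ((l.re * u.1 + l.im * u.2 : ℝ) : ℂ))

noncomputable def oscInt (χ : ℝ → ℝ) (a b c : ℝ) (l : ℂ) : ℂ :=
  ∫ u, osc χ a b c u * chr l u

lemma norm_chr (l : ℂ) (u : ℝ × ℝ) : ‖chr l u‖ = 1 := norm_exp_I_mul _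

lemma continuous_chr (l : ℂ) : Continuous (chr l) := by unfold chr; fun_prop

lemma chr_add (l m : ℂ) (u : ℝ × ℝ) : chr (l + m) u = chr l u * chr m u := by
  simp only [chr, ← Complex.exp_add]
  congr 1
  simp only [Complex.add_re, Complex.add_im]
  push_cast; ring

lemma chr_neg (l : ℂ) (u : ℝ × ℝ) : chr (-l) u = (starRingEnd ℂ) (chr l u) := by
  simp only [chr, ← Complex.exp_conj, map_mul, Complex.conj_I, Complex.conj_ofReal]
  congr 1
  simp only [Complex.neg_re, Complex.neg_im]
  push_cast; ring

lemma chr_eq_mul (l : ℂ) (u : ℝ × ℝ) : chr l u =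
    Complex.exp (Complex.I * ((l.re * u.1 : ℝ) : ℂ)) *
      Complex.exp (Complex.I * ((l.im * u.2 : ℝ) : ℂ)) := by
  rw [chr, ← Complex.exp_add]; congr 1; push_cast; ring

lemma IsCutoff.continuous {χ : ℝ → ℝ} (hχ : IsCutoff χ) : Continuous χ := hχ.smooth.continuous

lemma IsCutoff.continuous_osc {χ : ℝ → ℝ} (hχ : IsCutoff χ) (a b c : ℝ) :
    Continuous (osc χ a b c) := by
  have := hχ.continuous
  unfold osc; fun_prop

lemma IsCutoff.osc_eq_zero_fst {χ : ℝ → ℝ} (hχ : IsCutoff χ) (a b c : ℝ) {u : ℝ × ℝ}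
    (hu : 1 < |u.1|) : osc χ a b c u = 0 := by simp [osc, hχ.zero _ hu]

lemma IsCutoff.osc_eq_zero_snd {χ : ℝ → ℝ} (hχ : IsCutoff χ) (a b c : ℝ) {u : ℝ × ℝ}
    (hu : 1 < |u.2|) : osc χ a b c u = 0 := by simp [osc, hχ.zero _ hu]

lemma hasCompactSupport_of_abs₂ {E : Type*} [Zero E] {f : ℝ × ℝ → E} {B : ℝ}
    (h₁ : ∀ u : ℝ × ℝ, B < |u.1| → f u = 0) (h₂ : ∀ u : ℝ × ℝ, B < |u.2| → f u = 0) :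
    HasCompactSupport f := by
  refine HasCompactSupport.intro (isCompact_closedBall (0 : ℝ × ℝ) B) fun u hu => ?_
  by_contra hne
  have h1 := not_lt.1 fun h => hne (h₁ u h)
  have h2 := not_lt.1 fun h => hne (h₂ u h)
  exact hu (by simpa [Prod.norm_def] using ⟨h1, h2⟩)

lemma IsCutoff.hasCompactSupport_osc {χ : ℝ → ℝ} (hχ : IsCutoff χ) (a b c : ℝ) :
    HasCompactSupport (osc χ a b c) :=
  hasCompactSupport_of_abs₂ (fun _ => hχ.osc_eq_zero_fst a b c) (fun _ => hχ.osc_eq_zero_snd a b c)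

lemma IsCutoff.integrable_osc_mul {χ : ℝ → ℝ} (hχ : IsCutoff χ) (a b c : ℝ) {h : ℝ × ℝ → ℂ}
    (hh : Continuous h) : Integrable fun u => osc χ a b c u * h u :=
  ((hχ.continuous_osc a b c).mul hh).integrable_of_hasCompactSupport
    (hχ.hasCompactSupport_osc a b c).mul_right

lemma IsCutoff.contDiff_osc {χ : ℝ → ℝ} (hχ : IsCutoff χ) {W : Type*} [NormedAddCommGroup W]
    [NormedSpace ℝ W] {a b c s t : W → ℝ} (ha : ContDiff ℝ (⊤ : ℕ∞) a)
    (hb : ContDiff ℝ (⊤ : ℕ∞) b) (hc : ContDiff ℝ (⊤ : ℕ∞) c) (hs : ContDiff ℝ (⊤ : ℕ∞) s)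
    (ht : ContDiff ℝ (⊤ : ℕ∞) t) :
    ContDiff ℝ (⊤ : ℕ∞) fun w => osc χ (a w) (b w) (c w) (s w, t w) := by
  unfold osc
  refine ContDiff.mul ?_ (ContDiff.cexp (contDiff_const.mul ?_))
  · exact Complex.ofRealCLM.contDiff.comp ((hχ.smooth.comp hs).mul (hχ.smooth.comp ht))
  · exact Complex.ofRealCLM.contDiff.comp
      (((ha.mul (hs.mul ht)).add (hb.mul (ht.pow 2))).add (hc.mul (ht.pow 3)))

/-- The decay comes from the inner integral, in which the second variable is one more parameter in
the compact interval [-1,1]. Integrating over that interval costs the factor 2. -/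
lemma IsCutoff.exists_decay_re {χ : ℝ → ℝ} (hχ : IsCutoff χ) (N : ℕ) :
    ∃ C, 0 ≤ C ∧ ∀ a b c : ℝ, |a| ≤ 2 → |b| ≤ 2 → |c| ≤ 2 → ∀ l : ℂ,
      |l.re| ^ N * ‖oscInt χ a b c l‖ ≤ C := by
  obtain ⟨C, hC0, hC⟩ := exists_decay_of_contDiff (V := ℝ × ℝ × ℝ × ℝ)
    (𝒦 := Icc (-2) 2 ×ˢ Icc (-2) 2 ×ˢ Icc (-2) 2 ×ˢ Icc (-1) 1)
    (isCompact_Icc.prod (isCompact_Icc.prod (isCompact_Icc.prod isCompact_Icc))) 1 N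
    (fun q => osc χ q.1.1 q.1.2.1 q.1.2.2.1 (q.2, q.1.2.2.2))
    (hχ.contDiff_osc (by fun_prop) (by fun_prop) (by fun_prop) (by fun_prop) (by fun_prop))
    (fun p u hu => hχ.osc_eq_zero_fst _ _ _ hu)
  refine ⟨C * 2, by positivity, fun a b c ha hb hc l => ?_⟩
  have hint : oscInt χ a b c l = ∫ v, (∫ u, osc χ a b c (u, v) *
      Complex.exp (Complex.I * ((l.re * u : ℝ) : ℂ))) *
        Complex.exp (Complex.I * ((l.im * v : ℝ) : ℂ)) := by
    rw [oscInt, Measure.volume_eq_prod,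
      integral_prod_symm _ (hχ.integrable_osc_mul a b c (continuous_chr l))]
    refine integral_congr_ae (Filter.Eventually.of_forall fun v => ?_)
    simp only
    rw [← integral_mul_const]
    simp only [chr_eq_mul, mul_assoc]
  rw [hint, ← setIntegral_eq_integral_of_forall_compl_eq_zero (s := Icc (-1) 1)]
  · have h1 : ∀ v ∈ Icc (-1 : ℝ) 1, ‖((|l.re| ^ N : ℝ) : ℂ) * ((∫ u, osc χ a b c (u, v) *
        Complex.exp (Complex.I * ((l.re * u : ℝ) : ℂ))) *
        Complex.exp (Complex.I * ((l.im * v : ℝ) : ℂ)))‖ ≤ C := by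
      intro v hv
      rw [norm_mul, norm_mul, norm_exp_I_mul, mul_one, Complex.norm_real, Real.norm_eq_abs,
        abs_of_nonneg (by positivity)]
      exact hC (a, b, c, v) ⟨abs_le.1 ha, abs_le.1 hb, abs_le.1 hc, hv⟩ l.re
    have h2 := norm_setIntegral_le_of_norm_le_const (μ := volume) (by simp) h1
    rw [integral_const_mul, norm_mul, Complex.norm_real, Real.norm_eq_abs,
        abs_of_nonneg (by positivity)] at h2
    refine h2.trans (le_of_eq ?_)
    rw [Real.volume_real_Icc_of_le (by norm_num)]; norm_num
  · intro v hv
    rw [mem_Icc, ← abs_le, not_le] at hv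
    have : ∀ u, osc χ a b c (u, v) = 0 := fun u => hχ.osc_eq_zero_snd _ _ _ hv
    simp [this]

lemma IsCutoff.exists_decay_im {χ : ℝ → ℝ} (hχ : IsCutoff χ) (N : ℕ) :
    ∃ C, 0 ≤ C ∧ ∀ a b c : ℝ, |a| ≤ 2 → |b| ≤ 2 → |c| ≤ 2 → ∀ l : ℂ,
      |l.im| ^ N * ‖oscInt χ a b c l‖ ≤ C := by
  obtain ⟨C, hC0, hC⟩ := exists_decay_of_contDiff (V := ℝ × ℝ × ℝ × ℝ)
    (𝒦 := Icc (-2) 2 ×ˢ Icc (-2) 2 ×ˢ Icc (-2) 2 ×ˢ Icc (-1) 1)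
    (isCompact_Icc.prod (isCompact_Icc.prod (isCompact_Icc.prod isCompact_Icc))) 1 N
    (fun q => osc χ q.1.1 q.1.2.1 q.1.2.2.1 (q.1.2.2.2, q.2))
    (hχ.contDiff_osc (by fun_prop) (by fun_prop) (by fun_prop) (by fun_prop) (by fun_prop))
    (fun p u hu => hχ.osc_eq_zero_snd _ _ _ hu)
  refine ⟨C * 2, by positivity, fun a b c ha hb hc l => ?_⟩
  have hint : oscInt χ a b c l = ∫ u, Complex.exp (Complex.I * ((l.re * u : ℝ) : ℂ)) *
      ∫ v, osc χ a b c (u, v) * Complex.exp (Complex.I * ((l.im * v : ℝ) : ℂ)) := by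
    rw [oscInt, Measure.volume_eq_prod,
      integral_prod _ (hχ.integrable_osc_mul a b c (continuous_chr l))]
    refine integral_congr_ae (Filter.Eventually.of_forall fun v => ?_)
    simp only
    rw [← integral_const_mul]
    congr 1; funext w
    rw [chr_eq_mul]; ring
  rw [hint, ← setIntegral_eq_integral_of_forall_compl_eq_zero (s := Icc (-1) 1)]
  · have h1 : ∀ u ∈ Icc (-1 : ℝ) 1, ‖((|l.im| ^ N : ℝ) : ℂ) *
        (Complex.exp (Complex.I * ((l.re * u : ℝ) : ℂ)) *
        ∫ v, osc χ a b c (u, v) * Complex.exp (Complex.I * ((l.im * v : ℝ) : ℂ)))‖ ≤ C := by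
      intro v hv
      rw [norm_mul, norm_mul, norm_exp_I_mul, one_mul, Complex.norm_real, Real.norm_eq_abs,
        abs_of_nonneg (by positivity)]
      exact hC (a, b, c, v) ⟨abs_le.1 ha, abs_le.1 hb, abs_le.1 hc, hv⟩ l.im
    have h2 := norm_setIntegral_le_of_norm_le_const (μ := volume) (by simp) h1
    rw [integral_const_mul, norm_mul, Complex.norm_real, Real.norm_eq_abs,
        abs_of_nonneg (by positivity)] at h2
    refine h2.trans (le_of_eq ?_)
    rw [Real.volume_real_Icc_of_le (by norm_num)]; norm_num
  · intro v hv
    rw [mem_Icc, ← abs_le, not_le] at hv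
    have : ∀ u, osc χ a b c (v, u) = 0 := fun u => hχ.osc_eq_zero_fst _ _ _ hv
    simp [this]

/-- The weight `1 + |l₁| + |l₂|`. -/
noncomputable def wt (l : ℂ) : ℝ := 1 + |l.re| + |l.im|

lemma one_le_wt (l : ℂ) : 1 ≤ wt l := by unfold wt; linarith [abs_nonneg l.re, abs_nonneg l.im]

lemma wt_pos (l : ℂ) : 0 < wt l := zero_lt_one.trans_le (one_le_wt l)

lemma norm_le_wt (l : ℂ) : ‖l‖ ≤ wt l := by
  unfold wt; linarith [Complex.norm_le_abs_re_add_abs_im l]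

lemma wt_le (l : ℂ) : wt l ≤ 1 + 2 * ‖l‖ := by
  unfold wt; linarith [Complex.abs_re_le_norm l, Complex.abs_im_le_norm l]

/-- Submultiplicativity of the weight: a shift of the frequency is paid for by the weight of the
shift. -/
lemma wt_sub_le (l m : ℂ) : wt (l - m) ≤ wt l * wt m := by
  unfold wt
  have h1 := abs_sub l.re m.re
  have h2 := abs_sub l.im m.im
  rw [Complex.sub_re, Complex.sub_im]
  nlinarith [abs_nonneg l.re, abs_nonneg l.im, abs_nonneg m.re, abs_nonneg m.im,
    mul_nonneg (abs_nonneg l.re) (abs_nonneg m.re), mul_nonneg (abs_nonneg l.re) (abs_nonneg m.im),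
    mul_nonneg (abs_nonneg l.im) (abs_nonneg m.re), mul_nonneg (abs_nonneg l.im) (abs_nonneg m.im)]

/-- The weight is at most three times the maximum of 1, |l₁| and |l₂|, so decay in each coordinate
separately is enough. -/
lemma IsCutoff.exists_decay {χ : ℝ → ℝ} (hχ : IsCutoff χ) (N : ℕ) :
    ∃ C, 0 ≤ C ∧ ∀ a b c : ℝ, |a| ≤ 2 → |b| ≤ 2 → |c| ≤ 2 → ∀ l : ℂ,
      ‖oscInt χ a b c l‖ ≤ C / wt l ^ N := by
  obtain ⟨C₀, h₀, hC₀⟩ := hχ.exists_decay_re 0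
  obtain ⟨C₁, h₁, hC₁⟩ := hχ.exists_decay_re N
  obtain ⟨C₂, h₂, hC₂⟩ := hχ.exists_decay_im N
  refine ⟨3 ^ N * (C₀ + C₁ + C₂), by positivity, fun a b c ha hb hc l => ?_⟩
  rw [le_div_iff₀ (pow_pos (wt_pos l) N)]
  have hw : wt l ^ N ≤ 3 ^ N * (1 + |l.re| ^ N + |l.im| ^ N) := by
    set M := max 1 (max |l.re| |l.im|)
    have hM : wt l ≤ 3 * M := by
      unfold wt
      have h1 : 1 ≤ M := le_max_left _ _
      have h2 : |l.re| ≤ M := (le_max_left _ _).trans (le_max_right _ _)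
      have h3 : |l.im| ≤ M := (le_max_right _ _).trans (le_max_right _ _)
      linarith
    have hM2 : M ^ N ≤ 1 + |l.re| ^ N + |l.im| ^ N := by
      have h1 : (0 : ℝ) ≤ |l.re| ^ N := by positivity
      have h2 : (0 : ℝ) ≤ |l.im| ^ N := by positivity
      rcases max_choice 1 (max |l.re| |l.im|) with h | h
      · simp only [M, h, one_pow]; linarith
      · rcases max_choice |l.re| |l.im| with h' | h' <;> simp only [M, h, h'] <;> linarith
    calc wt l ^ N ≤ (3 * M) ^ N := pow_le_pow_left₀ (wt_pos l).le hM N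
      _ = 3 ^ N * M ^ N := mul_pow _ _ _
      _ ≤ _ := by gcongr
  have e0 := hC₀ a b c ha hb hc l
  rw [pow_zero, one_mul] at e0
  calc ‖oscInt χ a b c l‖ * wt l ^ N
      ≤ ‖oscInt χ a b c l‖ * (3 ^ N * (1 + |l.re| ^ N + |l.im| ^ N)) := by gcongr
    _ = 3 ^ N * (‖oscInt χ a b c l‖ + |l.re| ^ N * ‖oscInt χ a b c l‖ +
          |l.im| ^ N * ‖oscInt χ a b c l‖) := by ring
    _ ≤ _ := by gcongr <;> [exact hC₁ a b c ha hb hc l; exact hC₂ a b c ha hb hc l]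

lemma hasSum_congr_term {ι : Type*} {f g : ι → ℂ} {a : ℂ} (hf : HasSum f a)
    (h : ∀ i, g i = f i) : HasSum g a := by
  rwa [funext h]

/-! ### Fourier series on the square of side `3` -/

/-- The lattice of frequencies dual to `3 ℤ²`. -/
noncomputable def fr (n : ℤ × ℤ) : ℂ := ⟨2 * Real.pi / 3 * n.1, 2 * Real.pi / 3 * n.2⟩

lemma fr_sub (n m : ℤ × ℤ) : fr (n - m) = fr n - fr m := by
  apply Complex.ext <;> simp [fr] <;> ring

lemma one_le_two_pi_div_three : 1 ≤ 2 * Real.pi / 3 := by linarith [Real.pi_gt_three]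

lemma le_abs_two_pi_div_three_mul (k : ℤ) : |(k : ℝ)| ≤ |2 * Real.pi / 3 * k| := by
  rw [abs_mul, abs_of_pos (by linarith [one_le_two_pi_div_three] : 0 < 2 * Real.pi / 3)]
  exact le_mul_of_one_le_left (abs_nonneg _) one_le_two_pi_div_three

lemma summable_inv_one_add_abs_sq : Summable fun k : ℤ => ((1 + |(k : ℝ)|) ^ 2)⁻¹ := by
  -- The shift by 1/2 keeps the denominator away from zero at all integers.
  have h := (Real.summable_one_div_int_add_rpow (1 / 2) 2).2 (by norm_num)
  refine h.of_nonneg_of_le (fun k => by positivity) fun k => ?_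
  have h0 : (k : ℝ) + 1 / 2 ≠ 0 := by
    intro h
    have h1 : (2 * k + 1 : ℝ) = 0 := by linarith
    have h2 : (2 * k + 1 : ℤ) = 0 := by exact_mod_cast h1
    omega
  have h1 : |(k : ℝ) + 1 / 2| ≤ 1 + |(k : ℝ)| :=
    (abs_add_le _ _).trans (by rw [abs_of_pos (by norm_num : (0 : ℝ) < 1 / 2)]; linarith)
  rw [one_div, Real.rpow_two]
  exact inv_anti₀ (by positivity) (pow_le_pow_left₀ (abs_nonneg _) h1 2)

/-- The fourth power provides a square for each of the two coordinates. -/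
lemma summable_inv_wt_fr : Summable fun n : ℤ × ℤ => (wt (fr n) ^ 4)⁻¹ := by
  refine (summable_inv_one_add_abs_sq.mul_of_nonneg summable_inv_one_add_abs_sq
    (fun k => by positivity) (fun k => by positivity)).of_nonneg_of_le
    (fun n => inv_nonneg.2 (pow_nonneg (wt_pos _).le 4)) fun n => ?_
  rw [← mul_inv]
  refine inv_anti₀ (by positivity) ?_
  have h1 : 1 + |(n.1 : ℝ)| ≤ wt (fr n) := by
    have := le_abs_two_pi_div_three_mul n.1
    unfold wt fr; linarith [abs_nonneg (2 * Real.pi / 3 * n.2)]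
  have h2 : 1 + |(n.2 : ℝ)| ≤ wt (fr n) := by
    have := le_abs_two_pi_div_three_mul n.2
    unfold wt fr; linarith [abs_nonneg (2 * Real.pi / 3 * n.1)]
  calc (1 + |(n.1 : ℝ)|) ^ 2 * (1 + |(n.2 : ℝ)|) ^ 2 ≤ wt (fr n) ^ 2 * wt (fr n) ^ 2 := by gcongr
    _ = wt (fr n) ^ 4 := by ring

/-- As f vanishes outside [-1,1], it lifts from [-3/2,3/2) to a continuous function on the circle of
length 3, and summable coefficients make its Fourier series converge pointwise. The index is
reflected, because the coefficient integral here carries the positive exponential. -/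
lemma hasSum_fourier_line {f : ℝ → ℂ} (hf : Continuous f) (h0 : ∀ u, 1 < |u| → f u = 0)
    (hs : Summable fun k : ℤ =>
      ∫ s, f s * Complex.exp (Complex.I * ((2 * Real.pi / 3 * k * s : ℝ) : ℂ)))
    {u : ℝ} (hu : |u| ≤ 1) :
    HasSum (fun k : ℤ => 1 / 3 *
      (∫ s, f s * Complex.exp (Complex.I * ((2 * Real.pi / 3 * k * s : ℝ) : ℂ))) *
        Complex.exp (Complex.I * ((-(2 * Real.pi / 3 * k * u) : ℝ) : ℂ))) (f u) := by
  have : Fact ((0 : ℝ) < 3) := ⟨by norm_num⟩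
  have hend : f (-(3 / 2)) = f (-(3 / 2) + 3) := by
    rw [h0 _ (by rw [abs_neg, abs_of_pos] <;> norm_num),
      h0 _ (by rw [abs_of_pos] <;> norm_num)]
  let g : C(AddCircle (3 : ℝ), ℂ) :=
    ⟨AddCircle.liftIco 3 (-(3 / 2)) f, AddCircle.liftIco_continuous hend hf.continuousOn⟩
  have hcoef : ∀ k : ℤ, fourierCoeff g (-k) = 1 / 3 *
      ∫ s, f s * Complex.exp (Complex.I * ((2 * Real.pi / 3 * k * s : ℝ) : ℂ)) := by
    intro k
    have h1 : fourierCoeff g (-k) = _ := fourierCoeff_liftIco_eq (T := 3) (a := -(3 / 2)) f (-k)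
    rw [h1, fourierCoeffOn_eq_integral, intervalIntegral.integral_of_le (by norm_num),
      setIntegral_eq_integral_of_forall_compl_eq_zero, Complex.real_smul]
    · congr 1
      · norm_num
      · refine integral_congr_ae (Filter.Eventually.of_forall fun s => ?_)
        simp only [neg_neg, fourier_coe_apply, smul_eq_mul]
        rw [mul_comm]
        congr 2
        push_cast
        ring
    · intro s hs
      rw [h0, smul_zero]
      by_contra hle
      rw [not_lt, abs_le] at hle
      exact hs ⟨by linarith, by linarith⟩
  have hsum : Summable (fourierCoeff g) := by
    rw [← (Equiv.neg ℤ).summable_iff]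
    refine (hs.mul_left (1 / 3 : ℂ)).congr fun k => ?_
    exact (hcoef k).symm
  have hp := has_pointwise_sum_fourier_series_of_summable hsum (u : AddCircle (3 : ℝ))
  rw [← (Equiv.neg ℤ).hasSum_iff] at hp
  have hgu : g (u : AddCircle (3 : ℝ)) = f u := by
    refine AddCircle.liftIco_coe_apply ?_
    rw [abs_le] at hu
    constructor <;> linarith
  rw [hgu] at hp
  refine hasSum_congr_term hp fun k => ?_
  simp only [Function.comp_apply, Equiv.neg_apply, smul_eq_mul]
  rw [hcoef, fourier_coe_apply]
  congr 2
  push_cast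
  ring

/-- The two-dimensional Fourier series of a function supported in `[-1,1]²`. -/
lemma hasSum_fourier_plane {H : ℝ × ℝ → ℂ} (hH : Continuous H)
    (h1 : ∀ u : ℝ × ℝ, 1 < |u.1| → H u = 0) (h2 : ∀ u : ℝ × ℝ, 1 < |u.2| → H u = 0)
    (hs : Summable fun n : ℤ × ℤ => ∫ u, H u * chr (fr n) u)
    {u : ℝ × ℝ} (hu₁ : |u.1| ≤ 1) (hu₂ : |u.2| ≤ 1) :
    HasSum (fun n : ℤ × ℤ => 1 / 9 * (∫ v, H v * chr (fr n) v) * chr (-fr n) u) (H u) := by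
  have hcs : HasCompactSupport H := hasCompactSupport_of_abs₂ h1 h2
  -- The one-dimensional series is used twice: for the coefficients of the horizontal sections as
  -- functions of the height v, and then for the section at height `u.2`.
  set c : ℤ → ℝ → ℂ := fun k v =>
    ∫ s, H (s, v) * Complex.exp (Complex.I * ((2 * Real.pi / 3 * k * s : ℝ) : ℂ)) with hc
  have hcc : ∀ k, Continuous (c k) := by
    intro k
    have : c k = fun v => ∫ s in Icc (-1 : ℝ) 1,
        H (s, v) * Complex.exp (Complex.I * ((2 * Real.pi / 3 * k * s : ℝ) : ℂ)) := by
      funext v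
      rw [setIntegral_eq_integral_of_forall_compl_eq_zero]
      intro s hs
      rw [mem_Icc, ← abs_le, not_le] at hs
      rw [h1 _ hs, zero_mul]
    rw [this]
    refine continuous_parametric_integral_of_continuous ?_ isCompact_Icc
    fun_prop
  have hc0 : ∀ k v, 1 < |v| → c k v = 0 := by
    intro k v hv
    have : ∀ s, H (s, v) = 0 := fun s => h2 _ hv
    simp [hc, this]
  have hcint : ∀ k l : ℤ, ∫ v, c k v * Complex.exp (Complex.I * ((2 * Real.pi / 3 * l * v : ℝ) : ℂ))
      = ∫ u, H u * chr (fr (k, l)) u := by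
    intro k l
    rw [Measure.volume_eq_prod, integral_prod_symm]
    · refine integral_congr_ae (Filter.Eventually.of_forall fun v => ?_)
      simp only [hc]
      rw [← integral_mul_const]
      simp only [chr_eq_mul, mul_assoc, fr]
    · exact (hH.mul (continuous_chr _)).integrable_of_hasCompactSupport hcs.mul_right
  have hs' : Summable fun n : ℤ × ℤ => 1 / 9 * (∫ v, H v * chr (fr n) v) * chr (-fr n) u := by
    refine Summable.of_norm ?_
    simp only [norm_mul, norm_chr, mul_one]
    exact (hs.norm.mul_left _)
  have hfib : ∀ k, HasSum (fun l : ℤ => 1 / 9 * (∫ v, H v * chr (fr (k, l)) v) * chr (-fr (k, l)) u)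
      (1 / 3 * c k u.2 * Complex.exp (Complex.I * ((-(2 * Real.pi / 3 * k * u.1) : ℝ) : ℂ))) := by
    intro k
    have hsk : Summable fun l : ℤ =>
        ∫ v, c k v * Complex.exp (Complex.I * ((2 * Real.pi / 3 * l * v : ℝ) : ℂ)) := by
      simp only [hcint]
      exact hs.prod_factor k
    have := (hasSum_fourier_line (hcc k) (hc0 k) hsk hu₂).mul_left
      (1 / 3 * Complex.exp (Complex.I * ((-(2 * Real.pi / 3 * k * u.1) : ℝ) : ℂ)))
    rw [mul_right_comm (1 / 3 : ℂ)]
    refine hasSum_congr_term this fun l => ?_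
    rw [hcint, chr_eq_mul (-fr (k, l))]
    simp only [fr, Complex.neg_re, Complex.neg_im]
    rw [neg_mul, neg_mul]; ring
  -- Summing over the second index first leaves the series of the section through u. Its
  -- summability, a hypothesis of the one-dimensional result, is read off from the double series.
  have hg := hs'.hasSum.prod_fiberwise hfib
  have hsc : Summable fun k : ℤ => c k u.2 := by
    have := hg.summable.norm
    simp only [norm_mul, norm_exp_I_mul, mul_one] at this
    have h3 := this.mul_left ‖(1 / 3 : ℂ)‖⁻¹
    refine Summable.of_norm (h3.congr fun k => ?_)
    rw [inv_mul_cancel_left₀ (by norm_num)]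
  have hline := hasSum_fourier_line (f := fun s => H (s, u.2)) (by fun_prop)
    (fun s hs => h1 _ hs) hsc hu₁
  have := hg.unique hline
  rw [Prod.mk.eta] at this
  rw [← this]
  exact hs'.hasSum

/-! ### Orthogonality of characters and Bessel's inequality -/

/-- The period cell of the lattice `3 ℤ²`. -/
def cell : Set (ℝ × ℝ) := Icc (-(3 / 2)) (3 / 2) ×ˢ Icc (-(3 / 2)) (3 / 2)

lemma isCompact_cell : IsCompact cell := isCompact_Icc.prod isCompact_Icc

lemma integral_exp_line (k : ℤ) :
    ∫ s in Icc (-(3 / 2) : ℝ) (3 / 2), Complex.exp (Complex.I * ((2 * Real.pi / 3 * k * s : ℝ) : ℂ))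
      = if k = 0 then 3 else 0 := by
  rw [integral_Icc_eq_integral_Ioc, ← intervalIntegral.integral_of_le (by norm_num)]
  split_ifs with hk
  · subst hk; simp
  · have hc : Complex.I * (2 * Real.pi / 3 * k) ≠ 0 := by
      simp [hk, Real.pi_ne_zero]
    have : ∀ s : ℝ, Complex.exp (Complex.I * ((2 * Real.pi / 3 * k * s : ℝ) : ℂ)) =
        Complex.exp ((Complex.I * (2 * Real.pi / 3 * k)) * s) := by
      intro s; congr 1; push_cast; ring
    simp only [this]
    rw [integral_exp_mul_complex hc, div_eq_zero_iff]
    left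
    rw [sub_eq_zero, Complex.exp_eq_exp_iff_exists_int]
    refine ⟨k, ?_⟩
    push_cast; ring

lemma integral_chr_cell (n : ℤ × ℤ) :
    ∫ u in cell, chr (fr n) u = if n = 0 then 9 else 0 := by
  simp only [chr_eq_mul, cell, fr]
  rw [Measure.volume_eq_prod, setIntegral_prod_mul
    (fun s : ℝ => Complex.exp (Complex.I * ((2 * Real.pi / 3 * n.1 * s : ℝ) : ℂ)))
    (fun s : ℝ => Complex.exp (Complex.I * ((2 * Real.pi / 3 * n.2 * s : ℝ) : ℂ))),
    integral_exp_line, integral_exp_line]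
  rcases n with ⟨k, l⟩
  by_cases hk : k = 0 <;> by_cases hl : l = 0 <;> simp [hk, hl]
  norm_num

/-- A trigonometric polynomial. -/
noncomputable def trig (c : ℤ × ℤ → ℂ) (A : Finset (ℤ × ℤ)) (u : ℝ × ℝ) : ℂ :=
  ∑ n ∈ A, c n * chr (fr n) u

lemma continuous_trig (c : ℤ × ℤ → ℂ) (A : Finset (ℤ × ℤ)) : Continuous (trig c A) := by
  unfold trig
  exact continuous_finsetSum _ fun n _ => continuous_const.mul (continuous_chr _)

lemma norm_trig_le (c : ℤ × ℤ → ℂ) (A : Finset (ℤ × ℤ)) (u : ℝ × ℝ) :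
    ‖trig c A u‖ ≤ ∑ n ∈ A, ‖c n‖ :=
  norm_sum_le_of_le _ fun n _ => by rw [norm_mul, norm_chr, mul_one]

lemma trig_mul_conj (c : ℤ × ℤ → ℂ) (A B : Finset (ℤ × ℤ)) (u : ℝ × ℝ) :
    trig c A u * (starRingEnd ℂ) (trig c B u) =
      ∑ n ∈ A, ∑ m ∈ B, c n * (starRingEnd ℂ) (c m) * chr (fr (n - m)) u := by
  simp only [trig, map_sum, map_mul, Finset.sum_mul_sum]
  refine Finset.sum_congr rfl fun n _ => Finset.sum_congr rfl fun m _ => ?_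
  rw [fr_sub, sub_eq_add_neg, chr_add, chr_neg]
  ring

lemma integrableOn_cell {f : ℝ × ℝ → ℂ} (hf : Continuous f) : IntegrableOn f cell :=
  hf.continuousOn.integrableOn_compact isCompact_cell

lemma integral_norm_sq_trig (c : ℤ × ℤ → ℂ) (A : Finset (ℤ × ℤ)) :
    ∫ u in cell, ‖trig c A u‖ ^ 2 = 9 * ∑ n ∈ A, ‖c n‖ ^ 2 := by
  have h : ((∫ u in cell, ‖trig c A u‖ ^ 2 : ℝ) : ℂ) = ((9 * ∑ n ∈ A, ‖c n‖ ^ 2 : ℝ) : ℂ) := by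
    rw [← integral_complex_ofReal]
    have e : ∀ u, ((‖trig c A u‖ ^ 2 : ℝ) : ℂ) =
        ∑ n ∈ A, ∑ m ∈ A, c n * (starRingEnd ℂ) (c m) * chr (fr (n - m)) u := by
      intro u
      rw [← trig_mul_conj, Complex.mul_conj, Complex.normSq_eq_norm_sq]
    simp only [e]
    rw [integral_finsetSum _ fun n _ => integrable_finsetSum _ fun m _ =>
      (integrableOn_cell (continuous_chr _)).const_mul _]
    push_cast
    rw [Finset.mul_sum]
    refine Finset.sum_congr rfl fun n hn => ?_
    rw [integral_finsetSum _ fun m _ => (integrableOn_cell (continuous_chr _)).const_mul _,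
      Finset.sum_eq_single_of_mem n hn]
    · rw [integral_const_mul, integral_chr_cell, if_pos (sub_self n), Complex.mul_conj,
        Complex.normSq_eq_norm_sq]
      push_cast; ring
    · intro m _ hm
      rw [integral_const_mul, integral_chr_cell, if_neg (sub_ne_zero.2 hm.symm), mul_zero]
  exact_mod_cast h

/-- Fourier coefficients. -/
noncomputable def coef (G : ℝ × ℝ → ℂ) (n : ℤ × ℤ) : ℂ := 1 / 9 * ∫ u, G u * chr (-fr n) u

lemma norm_coef_le (G : ℝ × ℝ → ℂ) (n : ℤ × ℤ) : ‖coef G n‖ ≤ ∫ u, ‖G u‖ := by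
  rw [coef, norm_mul]
  have h1 : ‖∫ u, G u * chr (-fr n) u‖ ≤ ∫ u, ‖G u‖ := by
    refine (norm_integral_le_integral_norm _).trans (le_of_eq ?_)
    simp only [norm_mul, norm_chr, mul_one]
  have h2 : (0 : ℝ) ≤ ∫ u, ‖G u‖ := integral_nonneg fun _ => norm_nonneg _
  have h3 : ‖(1 / 9 : ℂ)‖ = 1 / 9 := by norm_num
  rw [h3]; linarith

lemma integrable_mul_chr {G : ℝ × ℝ → ℂ} (hG : Integrable G) (l : ℂ) :
    Integrable fun u => G u * chr l u :=
  hG.mul_bdd (c := 1) (continuous_chr l).aestronglyMeasurable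
    (Filter.Eventually.of_forall fun u => (norm_chr l u).le)

/-- Expand 0 ≤ ∫ |G - S|² over the cell, where S is the partial Fourier sum. The factor 9 is the
area of the cell. -/
lemma bessel {G : ℝ × ℝ → ℂ} (hG : MemLp G 2 volume) (hs : Function.support G ⊆ cell)
    (A : Finset (ℤ × ℤ)) : 9 * ∑ n ∈ A, ‖coef G n‖ ^ 2 ≤ ∫ u, ‖G u‖ ^ 2 := by
  have hGi : Integrable G := integrable_of_memLp_of_support hG isCompact_cell hs
  have hG2 : Integrable fun u => ‖G u‖ ^ 2 := (memLp_two_iff_integrable_sq_norm hG.1).1 hG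
  set c := coef G
  set S := trig c A
  have hGS : ∫ u, G u * (starRingEnd ℂ) (S u) = ((9 * ∑ n ∈ A, ‖c n‖ ^ 2 : ℝ) : ℂ) := by
    have e : ∀ u, G u * (starRingEnd ℂ) (S u) =
        ∑ n ∈ A, (starRingEnd ℂ) (c n) * (G u * chr (-fr n) u) := by
      intro u
      simp only [S, trig, map_sum, map_mul, Finset.mul_sum, chr_neg]
      exact Finset.sum_congr rfl fun n _ => by ring
    simp only [e]
    rw [integral_finsetSum _ fun n _ => (integrable_mul_chr hGi _).const_mul _]
    push_cast
    rw [Finset.mul_sum]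
    refine Finset.sum_congr rfl fun n _ => ?_
    rw [integral_const_mul]
    have h9 : ∫ u, G u * chr (-fr n) u = 9 * c n := by simp only [c, coef]; ring
    rw [h9, mul_left_comm, mul_comm ((starRingEnd ℂ) (c n)), Complex.mul_conj,
      Complex.normSq_eq_norm_sq]
    push_cast; rfl
  have hGSi : Integrable fun u => G u * (starRingEnd ℂ) (S u) := by
    refine hGi.mul_bdd (c := ∑ n ∈ A, ‖c n‖)
      (Complex.continuous_conj.comp (continuous_trig c A)).aestronglyMeasurable
      (Filter.Eventually.of_forall fun u => ?_)
    rw [RCLike.norm_conj]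
    exact norm_trig_le c A u
  have hre : ∫ u in cell, (G u * (starRingEnd ℂ) (S u)).re = 9 * ∑ n ∈ A, ‖c n‖ ^ 2 := by
    have h1 : ∫ u in cell, (G u * (starRingEnd ℂ) (S u)).re =
        (∫ u in cell, G u * (starRingEnd ℂ) (S u)).re :=
      integral_re (𝕜 := ℂ) hGSi.integrableOn
    rw [h1, setIntegral_eq_integral_of_forall_compl_eq_zero, hGS, Complex.ofReal_re]
    intro u hu
    rw [Function.notMem_support.1 fun h => hu (hs h), zero_mul]
  have hpos : 0 ≤ ∫ u in cell, ‖G u - S u‖ ^ 2 := integral_nonneg fun _ => by positivity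
  have e : ∀ u, ‖G u - S u‖ ^ 2 = ‖G u‖ ^ 2 - 2 * (G u * (starRingEnd ℂ) (S u)).re +
      ‖S u‖ ^ 2 := by
    intro u
    simp only [← Complex.normSq_eq_norm_sq]
    rw [Complex.normSq_sub]; ring
  have hGSr : IntegrableOn (fun u => 2 * (G u * (starRingEnd ℂ) (S u)).re) cell :=
    (hGSi.re.integrableOn).const_mul 2
  have hSi : IntegrableOn (fun u => ‖S u‖ ^ 2) cell :=
    (((continuous_trig c A).norm.pow 2).continuousOn).integrableOn_compact isCompact_cell
  simp only [e] at hpos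
  have hsub : IntegrableOn (fun u => ‖G u‖ ^ 2 - 2 * (G u * (starRingEnd ℂ) (S u)).re) cell :=
    hG2.integrableOn.sub hGSr
  rw [integral_add hsub hSi, integral_sub hG2.integrableOn hGSr,
    integral_const_mul, hre, integral_norm_sq_trig] at hpos
  have hle : ∫ u in cell, ‖G u‖ ^ 2 ≤ ∫ u, ‖G u‖ ^ 2 :=
    setIntegral_le_integral hG2 (Filter.Eventually.of_forall fun _ => by positivity)
  linarith

/-! ### Cut-off trigonometric polynomials and Parseval's identity -/

/-- A cut-off trigonometric polynomial. -/
noncomputable def packet (χ : ℝ → ℝ) (c : ℤ × ℤ → ℂ) (A : Finset (ℤ × ℤ)) (u : ℝ × ℝ) : ℂ :=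
  ((χ u.1 * χ u.2 : ℝ) : ℂ) * trig c A u

lemma IsCutoff.continuous_packet {χ : ℝ → ℝ} (hχ : IsCutoff χ) (c : ℤ × ℤ → ℂ)
    (A : Finset (ℤ × ℤ)) : Continuous (packet χ c A) := by
  have h1 := hχ.continuous
  have h2 := continuous_trig c A
  unfold packet; fun_prop

lemma IsCutoff.packet_eq_zero {χ : ℝ → ℝ} (hχ : IsCutoff χ) (c : ℤ × ℤ → ℂ)
    (A : Finset (ℤ × ℤ)) {u : ℝ × ℝ} (hu : 1 < |u.1| ∨ 1 < |u.2|) : packet χ c A u = 0 := by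
  rcases hu with hu | hu <;> simp [packet, hχ.zero _ hu]

lemma IsCutoff.integral_norm_sq_packet_le {χ : ℝ → ℝ} (hχ : IsCutoff χ) (h1 : ∀ t, |χ t| ≤ 1)
    (c : ℤ × ℤ → ℂ) (A : Finset (ℤ × ℤ)) :
    ∫ u, ‖packet χ c A u‖ ^ 2 ≤ 9 * ∑ n ∈ A, ‖c n‖ ^ 2 := by
  rw [← integral_norm_sq_trig, ← setIntegral_eq_integral_of_forall_compl_eq_zero (s := cell)]
  · refine setIntegral_mono
      (((hχ.continuous_packet c A).norm.pow 2).continuousOn.integrableOn_compact isCompact_cell)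
      (((continuous_trig c A).norm.pow 2).continuousOn.integrableOn_compact isCompact_cell)
      fun u => ?_
    have : ‖packet χ c A u‖ ≤ ‖trig c A u‖ := by
      rw [packet, norm_mul, Complex.norm_real, Real.norm_eq_abs, abs_mul]
      have := mul_le_one₀ (h1 u.1) (abs_nonneg _) (h1 u.2)
      exact mul_le_of_le_one_left (norm_nonneg _) this
    simp only
    gcongr
  · intro u hu
    rw [hχ.packet_eq_zero, norm_zero]
    · norm_num
    by_contra! hcon
    rw [abs_le, abs_le] at hcon
    exact hu ⟨⟨by linarith, by linarith⟩, ⟨by linarith, by linarith⟩⟩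

lemma IsCutoff.sq {χ : ℝ → ℝ} (hχ : IsCutoff χ) : IsCutoff fun t => χ t ^ 2 :=
  ⟨hχ.smooth.pow 2, fun u hu => by rw [hχ.zero u hu]; norm_num⟩

/-- The Gram matrix of the cut-off characters consists of Fourier integrals of the squared cutoff,
so it decays rapidly off the diagonal. -/
lemma IsCutoff.integral_packet_mul_conj {χ : ℝ → ℝ} (hχ : IsCutoff χ) (c : ℤ × ℤ → ℂ)
    (A B : Finset (ℤ × ℤ)) :
    ∫ u, packet χ c A u * (starRingEnd ℂ) (packet χ c B u) =
      ∑ n ∈ A, ∑ m ∈ B, c n * (starRingEnd ℂ) (c m) *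
        oscInt (fun t => χ t ^ 2) 0 0 0 (fr (n - m)) := by
  have e : ∀ u, packet χ c A u * (starRingEnd ℂ) (packet χ c B u) =
      ∑ n ∈ A, ∑ m ∈ B, c n * (starRingEnd ℂ) (c m) *
        (osc (fun t => χ t ^ 2) 0 0 0 u * chr (fr (n - m)) u) := by
    intro u
    have h := trig_mul_conj c A B u
    calc packet χ c A u * (starRingEnd ℂ) (packet χ c B u)
        = osc (fun t => χ t ^ 2) 0 0 0 u *
          (trig c A u * (starRingEnd ℂ) (trig c B u)) := by
          simp only [packet, osc, map_mul, Complex.conj_ofReal]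
          simp; ring
      _ = _ := by
          rw [h, Finset.mul_sum]
          refine Finset.sum_congr rfl fun n _ => ?_
          rw [Finset.mul_sum]
          exact Finset.sum_congr rfl fun m _ => by ring
  simp only [e]
  have hi : ∀ n m : ℤ × ℤ, Integrable fun u => c n * (starRingEnd ℂ) (c m) *
      (osc (fun t => χ t ^ 2) 0 0 0 u * chr (fr (n - m)) u) := fun n m =>
    (hχ.sq.integrable_osc_mul 0 0 0 (continuous_chr _)).const_mul _
  rw [integral_finsetSum _ fun n _ => integrable_finsetSum _ fun m _ => hi n m]
  refine Finset.sum_congr rfl fun n _ => ?_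
  rw [integral_finsetSum _ fun m _ => hi n m]
  refine Finset.sum_congr rfl fun m _ => ?_
  rw [integral_const_mul]; rfl

/-- The modulation with frequency `l` and quadratic and cubic coefficients `a`, `b`, `c`. -/
noncomputable def modul (a b c : ℝ) (l : ℂ) (u : ℝ × ℝ) : ℂ :=
  Complex.exp (Complex.I * ((a * (u.1 * u.2) + b * u.2 ^ 2 + c * u.2 ^ 3 : ℝ) : ℂ)) * chr l u

lemma osc_mul_chr (χ : ℝ → ℝ) (a b c : ℝ) (l : ℂ) (u : ℝ × ℝ) :
    osc χ a b c u * chr l u = ((χ u.1 * χ u.2 : ℝ) : ℂ) * modul a b c l u := by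
  rw [osc, modul, mul_assoc]

lemma IsCutoff.integral_packet_mul_modul {χ : ℝ → ℝ} (hχ : IsCutoff χ) (d : ℤ × ℤ → ℂ)
    (A : Finset (ℤ × ℤ)) (a b c : ℝ) (l : ℂ) :
    ∫ u, packet χ d A u * modul a b c l u =
      ∑ n ∈ A, d n * oscInt χ a b c (l + fr n) := by
  have e : ∀ u, packet χ d A u * modul a b c l u =
      ∑ n ∈ A, d n * (osc χ a b c u * chr (l + fr n) u) := by
    intro u
    simp only [packet, trig, Finset.mul_sum, Finset.sum_mul]
    refine Finset.sum_congr rfl fun n _ => ?_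
    rw [osc_mul_chr, modul, modul, chr_add]; ring
  simp only [e]
  rw [integral_finsetSum _ fun n _ =>
    (hχ.integrable_osc_mul a b c (continuous_chr _)).const_mul _]
  refine Finset.sum_congr rfl fun n _ => ?_
  rw [integral_const_mul]; rfl

lemma wt_fr_le (l : ℂ) (n : ℤ × ℤ) : wt (fr n) ≤ wt (l + fr n) * wt l := by
  have := wt_sub_le (l + fr n) l
  rwa [add_sub_cancel_left] at this

lemma inv_wt_add_fr_le (l : ℂ) (n : ℤ × ℤ) :
    (wt (l + fr n) ^ 4)⁻¹ ≤ wt l ^ 4 * (wt (fr n) ^ 4)⁻¹ := by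
  rw [← div_eq_mul_inv, le_div_iff₀ (pow_pos (wt_pos _) 4), inv_mul_le_iff₀ (pow_pos (wt_pos _) 4),
    ← mul_pow]
  exact pow_le_pow_left₀ (wt_pos _).le (wt_fr_le l n) 4

lemma IsCutoff.summable_oscInt {χ : ℝ → ℝ} (hχ : IsCutoff χ) {a b c : ℝ} (ha : |a| ≤ 2)
    (hb : |b| ≤ 2) (hc : |c| ≤ 2) (l : ℂ) : Summable fun n => oscInt χ a b c (l + fr n) := by
  obtain ⟨C, hC0, hC⟩ := hχ.exists_decay 4
  refine Summable.of_norm_bounded (summable_inv_wt_fr.mul_left (C * wt l ^ 4)) fun n => ?_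
  refine (hC a b c ha hb hc _).trans ?_
  rw [div_eq_mul_inv, mul_assoc]
  exact mul_le_mul_of_nonneg_left (inv_wt_add_fr_le l n) hC0

/-- Parseval's identity for a function living where the cutoff is `1`. -/
lemma IsCutoff.hasSum_integral_mul_modul {χ : ℝ → ℝ} (hχ : IsCutoff χ)
    (h1 : ∀ t, |t| ≤ 1 / 2 → χ t = 1) {G : ℝ × ℝ → ℂ} (hG : Integrable G)
    (hs : ∀ u, G u ≠ 0 → |u.1| ≤ 1 / 2 ∧ |u.2| ≤ 1 / 2) {a b c : ℝ} (ha : |a| ≤ 2)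
    (hb : |b| ≤ 2) (hc : |c| ≤ 2) (l : ℂ) :
    HasSum (fun n => coef G n * oscInt χ a b c (l + fr n)) (∫ u, G u * modul a b c l u) := by
  have hsum := hχ.summable_oscInt ha hb hc l
  have hcoef : ∀ n, ∫ v, (osc χ a b c v * chr l v) * chr (fr n) v = oscInt χ a b c (l + fr n) := by
    intro n
    rw [oscInt]; congr 1; funext v; rw [chr_add, mul_assoc]
  -- The series is applied to the smooth modulation and not to G. It then converges absolutely at
  -- each point and can be integrated term by term against a merely integrable G; on the support of
  -- G the cutoff is 1.
  have hpt : ∀ u, HasSum (fun n => G u * (1 / 9 * oscInt χ a b c (l + fr n) * chr (-fr n) u))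
      (G u * modul a b c l u) := by
    intro u
    by_cases hu : G u = 0
    · simp only [hu, zero_mul]; exact hasSum_zero
    obtain ⟨hu1, hu2⟩ := hs u hu
    have h := hasSum_fourier_plane (H := fun u => osc χ a b c u * chr l u)
      ((hχ.continuous_osc a b c).mul (continuous_chr l))
      (fun u hu => by rw [hχ.osc_eq_zero_fst a b c hu, zero_mul])
      (fun u hu => by rw [hχ.osc_eq_zero_snd a b c hu, zero_mul])
      (by simpa only [hcoef] using hsum) (u := u) (by linarith) (by linarith)
    simp only [hcoef] at h
    rw [osc_mul_chr, h1 _ hu1, h1 _ hu2] at h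
    simp only [mul_one, Complex.ofReal_one, one_mul] at h
    exact h.mul_left _
  have hint : ∀ n, Integrable fun u =>
      G u * (1 / 9 * oscInt χ a b c (l + fr n) * chr (-fr n) u) := by
    intro n
    refine ((integrable_mul_chr hG (-fr n)).mul_const (1 / 9 * oscInt χ a b c (l + fr n))).congr
      (Filter.Eventually.of_forall fun u => ?_)
    simp only; ring
  have hsn : Summable fun n => ∫ u, ‖G u * (1 / 9 * oscInt χ a b c (l + fr n) *
      chr (-fr n) u)‖ := by
    simp only [norm_mul, norm_chr, mul_one]
    simp only [integral_mul_const]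
    exact (hsum.norm.mul_left _).mul_left _
  have h := hasSum_integral_of_summable_integral_norm hint hsn
  simp only [(hpt _).tsum_eq] at h
  refine hasSum_congr_term h fun n => ?_
  rw [coef, mul_right_comm, ← integral_const_mul]
  refine integral_congr_ae (Filter.Eventually.of_forall fun u => ?_)
  simp only; ring

/-- A cutoff which is `1` on `[-1/2,1/2]`. -/
noncomputable def cutoff : ContDiffBump (0 : ℝ) := ⟨1 / 2, 1, by norm_num, by norm_num⟩

lemma isCutoff_cutoff : IsCutoff cutoff :=
  ⟨cutoff.contDiff, fun u hu => cutoff.zero_of_le_dist (by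
    simpa [Real.dist_eq, cutoff] using hu.le)⟩

lemma cutoff_eq_one {t : ℝ} (ht : |t| ≤ 1 / 2) : cutoff t = 1 :=
  cutoff.one_of_mem_closedBall (by simpa [Real.dist_eq, cutoff] using ht)

lemma abs_cutoff_le (t : ℝ) : |cutoff t| ≤ 1 := by
  rw [abs_of_nonneg cutoff.nonneg]; exact cutoff.le_one

/-! ### Tails of the Fourier coefficients -/

/-- Of M + 4 powers of decay, four are kept for summability. The other M give R^{N+1} since δM ≥ N +
1, and the extra factor R absorbs the constant. -/
lemma IsCutoff.exists_tail {χ : ℝ → ℝ} (hχ : IsCutoff χ) {δ : ℝ} (hδ : 0 < δ) (N : ℕ) :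
    ∃ R₁ : ℝ, 1 ≤ R₁ ∧ ∀ R : ℝ, R₁ ≤ R → ∀ a b c : ℝ, |a| ≤ 2 → |b| ≤ 2 → |c| ≤ 2 →
      ∀ l : ℂ, R ^ δ / 4 ≤ ‖l‖ → ‖oscInt χ a b c l‖ ≤ (R ^ N)⁻¹ * (wt l ^ 4)⁻¹ := by
  set M := ⌈((N : ℝ) + 1) / δ⌉₊
  have hM : (N : ℝ) + 1 ≤ δ * M := by
    have := Nat.le_ceil (((N : ℝ) + 1) / δ)
    rw [div_le_iff₀ hδ] at this
    linarith
  obtain ⟨C, hC0, hC⟩ := hχ.exists_decay (M + 4)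
  refine ⟨max 1 (C * 4 ^ M), le_max_left _ _, fun R hR a b c ha hb hc l hl => ?_⟩
  have hR1 : 1 ≤ R := (le_max_left _ _).trans hR
  have hRC : C * 4 ^ M ≤ R := (le_max_right _ _).trans hR
  have hR0 : 0 < R := by linarith
  refine (hC a b c ha hb hc l).trans ?_
  have hw : R ^ (N + 1) ≤ 4 ^ M * wt l ^ M := by
    calc R ^ (N + 1) = R ^ ((N : ℝ) + 1) := by rw [← Real.rpow_natCast]; push_cast; rfl
      _ ≤ R ^ (δ * M) := Real.rpow_le_rpow_of_exponent_le hR1 hM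
      _ = (R ^ δ) ^ M := by rw [Real.rpow_mul hR0.le, Real.rpow_natCast]
      _ ≤ (4 * wt l) ^ M := by
          refine pow_le_pow_left₀ (by positivity) ?_ M
          linarith [norm_le_wt l]
      _ = 4 ^ M * wt l ^ M := mul_pow _ _ _
  have hwp : 0 < wt l := wt_pos l
  rw [← mul_inv, ← one_div, div_le_div_iff₀ (by positivity) (by positivity)]
  have h1 : C * R ^ N ≤ wt l ^ M := by
    have h2 : (C * R ^ N) * 4 ^ M ≤ wt l ^ M * 4 ^ M := by
      calc (C * R ^ N) * 4 ^ M = (C * 4 ^ M) * R ^ N := by ring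
        _ ≤ R * R ^ N := by gcongr
        _ = R ^ (N + 1) := by ring
        _ ≤ _ := by linarith
    exact le_of_mul_le_mul_right h2 (by positivity)
  calc C * (R ^ N * wt l ^ 4) = (C * R ^ N) * wt l ^ 4 := by ring
    _ ≤ wt l ^ M * wt l ^ 4 := by gcongr
    _ = 1 * wt l ^ (M + 4) := by ring

/-- The sum of the fourth powers of the inverse weights over the frequency lattice. -/
noncomputable def wtSum : ℝ := ∑' n : ℤ × ℤ, (wt (fr n) ^ 4)⁻¹

lemma sum_inv_wt_le (A : Finset (ℤ × ℤ)) : ∑ n ∈ A, (wt (fr n) ^ 4)⁻¹ ≤ wtSum :=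
  summable_inv_wt_fr.sum_le_tsum A fun _ _ => inv_nonneg.2 (pow_nonneg (wt_pos _).le 4)

lemma sum_inv_wt_sub_le (A : Finset (ℤ × ℤ)) (n : ℤ × ℤ) :
    ∑ m ∈ A, (wt (fr (n - m)) ^ 4)⁻¹ ≤ wtSum := by
  classical
  have := sum_inv_wt_le (A.image fun m => n - m)
  rwa [Finset.sum_image fun x _ y _ h => sub_right_injective h] at this

lemma sum_inv_wt_sub_le' (A : Finset (ℤ × ℤ)) (m : ℤ × ℤ) :
    ∑ n ∈ A, (wt (fr (n - m)) ^ 4)⁻¹ ≤ wtSum := by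
  classical
  have := sum_inv_wt_le (A.image fun n => n - m)
  rwa [Finset.sum_image fun x _ y _ h => sub_left_injective h] at this

lemma wtSum_nonneg : 0 ≤ wtSum := by simpa using sum_inv_wt_le ∅

/-- Schur's test for the Gram matrix of two wave packets. -/
lemma norm_sum_sum_le {c : ℤ × ℤ → ℂ} {A B : Finset (ℤ × ℤ)} {J : ℤ × ℤ → ℂ} {β E : ℝ}
    (hβ : 0 ≤ β)
    (hJ : ∀ n ∈ A, ∀ m ∈ B, ‖J (n - m)‖ ≤ β * (wt (fr (n - m)) ^ 4)⁻¹)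
    (hA : ∑ n ∈ A, ‖c n‖ ^ 2 ≤ E) (hB : ∑ n ∈ B, ‖c n‖ ^ 2 ≤ E) :
    ‖∑ n ∈ A, ∑ m ∈ B, c n * (starRingEnd ℂ) (c m) * J (n - m)‖ ≤ β * wtSum * E := by
  have hterm : ∀ n ∈ A, ∀ m ∈ B, ‖c n * (starRingEnd ℂ) (c m) * J (n - m)‖ ≤
      β / 2 * (‖c n‖ ^ 2 * (wt (fr (n - m)) ^ 4)⁻¹) +
      β / 2 * (‖c m‖ ^ 2 * (wt (fr (n - m)) ^ 4)⁻¹) := by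
    intro n hn m hm
    rw [norm_mul, norm_mul, RCLike.norm_conj]
    have h1 : ‖c n‖ * ‖c m‖ ≤ (‖c n‖ ^ 2 + ‖c m‖ ^ 2) / 2 := by
      linarith [two_mul_le_add_sq ‖c n‖ ‖c m‖]
    calc ‖c n‖ * ‖c m‖ * ‖J (n - m)‖
        ≤ (‖c n‖ ^ 2 + ‖c m‖ ^ 2) / 2 * (β * (wt (fr (n - m)) ^ 4)⁻¹) := by
          gcongr; exact hJ n hn m hm
      _ = _ := by ring
  have hS := wtSum_nonneg
  calc _ ≤ ∑ n ∈ A, ∑ m ∈ B, (β / 2 * (‖c n‖ ^ 2 * (wt (fr (n - m)) ^ 4)⁻¹) +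
      β / 2 * (‖c m‖ ^ 2 * (wt (fr (n - m)) ^ 4)⁻¹)) :=
        norm_sum_le_of_le _ fun n hn => norm_sum_le_of_le _ fun m hm => hterm n hn m hm
    _ = β / 2 * ∑ n ∈ A, ‖c n‖ ^ 2 * ∑ m ∈ B, (wt (fr (n - m)) ^ 4)⁻¹ +
        β / 2 * ∑ m ∈ B, ‖c m‖ ^ 2 * ∑ n ∈ A, (wt (fr (n - m)) ^ 4)⁻¹ := by
        simp only [Finset.sum_add_distrib, Finset.mul_sum]
        congr 1
        rw [Finset.sum_comm]
    _ ≤ β / 2 * ∑ n ∈ A, ‖c n‖ ^ 2 * wtSum + β / 2 * ∑ m ∈ B, ‖c m‖ ^ 2 * wtSum := by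
        gcongr
        · exact sum_inv_wt_sub_le _ _
        · exact sum_inv_wt_sub_le' _ _
    _ = β / 2 * wtSum * (∑ n ∈ A, ‖c n‖ ^ 2) + β / 2 * wtSum * (∑ n ∈ B, ‖c n‖ ^ 2) := by
        rw [← Finset.sum_mul, ← Finset.sum_mul]; ring
    _ ≤ β / 2 * wtSum * E + β / 2 * wtSum * E := by gcongr
    _ = β * wtSum * E := by ring

/-! ### Rescaling -/

/-- The affine map that takes the unit cell to the square `3θ`. -/
noncomputable def unscale (R : ℝ) (w u : ℝ × ℝ) : ℝ × ℝ := w + (√R)⁻¹ • u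

lemma integral_unscale {E : Type*} [NormedAddCommGroup E] [NormedSpace ℝ E] {R : ℝ} (hR : 0 < R)
    (w : ℝ × ℝ) (f : ℝ × ℝ → E) : ∫ z, f z = R⁻¹ • ∫ u, f (unscale R w u) := by
  have h1 := Measure.integral_comp_smul (volume : Measure (ℝ × ℝ)) (fun z => f (w + z)) (√R)⁻¹
  have h2 : Module.finrank ℝ (ℝ × ℝ) = 2 := by simp
  rw [integral_add_left_eq_self f w, h2, inv_pow, Real.sq_sqrt hR.le, inv_inv, abs_of_pos hR] at h1
  unfold unscale
  rw [h1, smul_smul, inv_mul_cancel₀ hR.ne', one_smul]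

lemma integrable_unscale {E : Type*} [NormedAddCommGroup E] {R : ℝ} (hR : 0 < R)
    (w : ℝ × ℝ) {f : ℝ × ℝ → E} (hf : Integrable f) : Integrable fun u => f (unscale R w u) := by
  have h : (√R)⁻¹ ≠ 0 := by positivity
  exact (hf.comp_add_left w).comp_smul h

lemma memLp_unscale {R : ℝ} (hR : 0 < R) (w : ℝ × ℝ) {f : ℝ × ℝ → ℂ} (hf : Integrable f)
    (h2 : MemLp f 2 volume) : MemLp (fun u => f (unscale R w u)) 2 volume := by
  rw [memLp_two_iff_integrable_sq_norm (integrable_unscale hR w hf).1]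
  exact integrable_unscale hR w ((memLp_two_iff_integrable_sq_norm h2.1).1 h2)

/-- The projection of `ξ` to the horizontal plane along the normal direction at `w`. -/
noncomputable def proj (γ : ℝ) (w : ℝ × ℝ) (ξ : E3) : ℂ :=
  ⟨ξ 0 + ξ 2 * w.2, ξ 1 + ξ 2 * (w.1 + γ * w.2 ^ 2)⟩

/-- The frequency of the rescaled exponential. -/
noncomputable def freq (γ R : ℝ) (w : ℝ × ℝ) (ξ : E3) : ℂ := ((√R)⁻¹ : ℝ) * proj γ w ξ

noncomputable def baseFactor (γ : ℝ) (w : ℝ × ℝ) (ξ : E3) : ℂ :=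
  Complex.exp (Complex.I * ((ξ 0 * w.1 + ξ 1 * w.2 + ξ 2 * phase γ w : ℝ) : ℂ))

/-- The modulation obtained from the exponential of `ξ` by rescaling to the unit cell at `w`. -/
noncomputable def scaledModul (γ R : ℝ) (w : ℝ × ℝ) (ξ : E3) : ℝ × ℝ → ℂ :=
  modul (ξ 2 / R) (ξ 2 * (γ * w.2) / R) (γ / 3 * ξ 2 / (R * √R)) (freq γ R w ξ)

/-- The phase is a cubic polynomial, so its expansion at w is exact. The linear part becomes the
frequency, and after scaling by R^{-1/2} the quadratic and cubic parts carry R^{-1} and R^{-3/2}. -/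
lemma ext_eq_unscale {γ R : ℝ} (hR : 0 < R) (w : ℝ × ℝ) (f : PlaneFun) (ξ : E3) :
    ext γ f ξ = (R⁻¹ : ℝ) * (baseFactor γ w ξ *
      ∫ u, f (unscale R w u) * scaledModul γ R w ξ u) := by
  rw [ext, integral_unscale hR w, Complex.real_smul, ← integral_const_mul (baseFactor γ w ξ)]
  congr 2
  funext u
  have hr : √R ≠ 0 := by positivity
  have hrr : R = √R ^ 2 := (Real.sq_sqrt hR.le).symm
  rw [mul_left_comm]
  congr 1
  simp only [baseFactor, scaledModul, modul, chr, ← Complex.exp_add]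
  congr 1
  simp only [← mul_add, ← Complex.ofReal_add]
  congr 2
  simp only [freq, proj, unscale, phase, Complex.re_ofReal_mul, Complex.im_ofReal_mul, Prod.fst_add,
    Prod.snd_add, Prod.smul_fst, Prod.smul_snd, smul_eq_mul]
  generalize √R = r at *
  subst hrr
  field_simp
  ring

lemma norm_baseFactor (γ : ℝ) (w : ℝ × ℝ) (ξ : E3) : ‖baseFactor γ w ξ‖ = 1 := norm_exp_I_mul _

/-- The wave packet with frequencies `A` on the square `3θ` with center `w`. -/
noncomputable def waveFn (R : ℝ) (w : ℝ × ℝ) (c : ℤ × ℤ → ℂ) (A : Finset (ℤ × ℤ)) : PlaneFun :=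
  fun z => packet cutoff c A (√R • (z - w))

lemma waveFn_unscale {R : ℝ} (hR : 0 < R) (w : ℝ × ℝ) (c : ℤ × ℤ → ℂ) (A : Finset (ℤ × ℤ))
    (u : ℝ × ℝ) : waveFn R w c A (unscale R w u) = packet cutoff c A u := by
  have : √R ≠ 0 := by positivity
  rw [waveFn, unscale, add_sub_cancel_left, smul_inv_smul₀ this]

lemma continuous_waveFn (R : ℝ) (w : ℝ × ℝ) (c : ℤ × ℤ → ℂ) (A : Finset (ℤ × ℤ)) :
    Continuous (waveFn R w c A) :=
  (isCutoff_cutoff.continuous_packet c A).comp (by fun_prop)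

lemma support_waveFn {R : ℝ} (hR : 0 < R) (w : ℝ × ℝ) (c : ℤ × ℤ → ℂ) (A : Finset (ℤ × ℤ)) :
    Function.support (waveFn R w c A) ⊆ square w (3 / √R) := by
  intro z hz
  have hr : 0 < √R := by positivity
  by_contra hcon
  refine hz (isCutoff_cutoff.packet_eq_zero c A ?_)
  simp only [square, mem_ofPred_eq, not_and_or, not_le] at hcon
  have key : ∀ t, 3 / √R / 2 < |t| → 1 < |√R * t| := by
    intro t ht
    rw [abs_mul, abs_of_pos hr]
    rw [div_div, div_lt_iff₀ (by positivity)] at ht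
    linarith
  rcases hcon with h | h
  · exact Or.inl (key _ h)
  · exact Or.inr (key _ h)

lemma memLp_waveFn {R : ℝ} (hR : 0 < R) (w : ℝ × ℝ) (c : ℤ × ℤ → ℂ) (A : Finset (ℤ × ℤ)) :
    MemLp (waveFn R w c A) 2 volume := by
  refine (continuous_waveFn R w c A).memLp_of_hasCompactSupport ?_
  exact HasCompactSupport.intro (isCompact_square w (3 / √R)) fun z hz =>
    Function.notMem_support.1 fun h => hz (support_waveFn hR w c A h)

lemma integral_norm_sq_waveFn_le {R : ℝ} (hR : 0 < R) (w : ℝ × ℝ) (c : ℤ × ℤ → ℂ)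
    (A : Finset (ℤ × ℤ)) : ∫ z, ‖waveFn R w c A z‖ ^ 2 ≤ R⁻¹ * (9 * ∑ n ∈ A, ‖c n‖ ^ 2) := by
  rw [integral_unscale hR w]
  simp only [waveFn_unscale hR, smul_eq_mul]
  gcongr
  exact isCutoff_cutoff.integral_norm_sq_packet_le abs_cutoff_le c A

lemma integral_waveFn_mul_conj {R : ℝ} (hR : 0 < R) (w : ℝ × ℝ) (c : ℤ × ℤ → ℂ)
    (A B : Finset (ℤ × ℤ)) :
    ∫ z, waveFn R w c A z * (starRingEnd ℂ) (waveFn R w c B z) =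
      (R⁻¹ : ℝ) * ∑ n ∈ A, ∑ m ∈ B, c n * (starRingEnd ℂ) (c m) *
        oscInt (fun t => cutoff t ^ 2) 0 0 0 (fr (n - m)) := by
  rw [integral_unscale hR w]
  simp only [waveFn_unscale hR, Complex.real_smul]
  rw [isCutoff_cutoff.integral_packet_mul_conj]

/-- The coefficient of `e_n` in the extension at `ξ`. -/
noncomputable def scaledOsc (γ R : ℝ) (w : ℝ × ℝ) (ξ : E3) (n : ℤ × ℤ) : ℂ :=
  oscInt cutoff (ξ 2 / R) (ξ 2 * (γ * w.2) / R) (γ / 3 * ξ 2 / (R * √R)) (freq γ R w ξ + fr n)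

lemma ext_waveFn {γ R : ℝ} (hR : 0 < R) (w : ℝ × ℝ) (c : ℤ × ℤ → ℂ) (A : Finset (ℤ × ℤ))
    (ξ : E3) : ext γ (waveFn R w c A) ξ =
      (R⁻¹ : ℝ) * (baseFactor γ w ξ * ∑ n ∈ A, c n * scaledOsc γ R w ξ n) := by
  rw [ext_eq_unscale hR w]
  simp only [waveFn_unscale hR]
  rw [scaledModul, isCutoff_cutoff.integral_packet_mul_modul]
  rfl

/-- Admissible centers and frequencies, for which all coefficients are bounded. -/
lemma coeff_bounds {γ R : ℝ} (hR : 1 ≤ R) (hγ : |γ| ≤ 1) {w : ℝ × ℝ} (hw : |w.2| ≤ 2) {ξ : E3}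
    (hξ : ξ ∈ cube R) : |ξ 2 / R| ≤ 2 ∧ |ξ 2 * (γ * w.2) / R| ≤ 2 ∧
      |γ / 3 * ξ 2 / (R * √R)| ≤ 2 := by
  have h2 := hξ 2
  have hr : 1 ≤ √R := Real.one_le_sqrt.2 hR
  have hR0 : 0 < R := by linarith
  refine ⟨?_, ?_, ?_⟩
  · rw [abs_div, abs_of_pos hR0, div_le_iff₀ hR0]; linarith
  · rw [abs_div, abs_of_pos hR0, div_le_iff₀ hR0, abs_mul, abs_mul]
    calc |ξ 2| * (|γ| * |w.2|) ≤ R * (1 * 2) := by gcongr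
      _ = 2 * R := by ring
  · rw [abs_div, abs_of_pos (by positivity : 0 < R * √R), div_le_iff₀ (by positivity), abs_mul,
      abs_div]
    calc |γ| / |3| * |ξ 2| ≤ 1 / |3| * R := by gcongr
      _ ≤ 2 * (R * √R) := by
        rw [abs_of_pos (by norm_num : (0 : ℝ) < 3)]; nlinarith

lemma hasSum_ext {γ R : ℝ} (hR : 1 ≤ R) (hγ : |γ| ≤ 1) {w : ℝ × ℝ} (hw : |w.2| ≤ 2) {ξ : E3}
    (hξ : ξ ∈ cube R) {f : PlaneFun} (hf : Integrable f)
    (hs : ∀ u, f (unscale R w u) ≠ 0 → |u.1| ≤ 1 / 2 ∧ |u.2| ≤ 1 / 2) :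
    HasSum (fun n => (R⁻¹ : ℝ) * (baseFactor γ w ξ *
      (coef (fun u => f (unscale R w u)) n * scaledOsc γ R w ξ n))) (ext γ f ξ) := by
  have hR0 : 0 < R := by linarith
  obtain ⟨ha, hb, hc⟩ := coeff_bounds hR hγ hw hξ
  rw [ext_eq_unscale hR0 w]
  exact ((isCutoff_cutoff.hasSum_integral_mul_modul (fun t => cutoff_eq_one)
    (integrable_unscale hR0 w hf) hs ha hb hc _).mul_left _).mul_left _

lemma norm_proj_le {γ : ℝ} (hγ : |γ| ≤ 1) {w : ℝ × ℝ} (hw1 : |w.1| ≤ 2) (hw : |w.2| ≤ 2) (v : E3) :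
    ‖proj γ w v‖ ≤ 10 * ‖v‖ := by
  refine (Complex.norm_le_abs_re_add_abs_im _).trans ?_
  simp only [proj]
  have h0 := abs_apply_le_norm v 0
  have h1 := abs_apply_le_norm v 1
  have h2 := abs_apply_le_norm v 2
  have h3 : |v 0 + v 2 * w.2| ≤ ‖v‖ + ‖v‖ * 2 := by
    refine (abs_add_le _ _).trans ?_
    rw [abs_mul]; gcongr
  have h4 : |w.1 + γ * w.2 ^ 2| ≤ 6 := by
    refine (abs_add_le _ _).trans ?_
    rw [abs_mul, abs_pow]
    have : |γ| * |w.2| ^ 2 ≤ 1 * 2 ^ 2 := by gcongr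
    linarith
  have h5 : |v 1 + v 2 * (w.1 + γ * w.2 ^ 2)| ≤ ‖v‖ + ‖v‖ * 6 := by
    refine (abs_add_le _ _).trans ?_
    rw [abs_mul]; gcongr
  linarith

lemma wt_freq_le {γ R : ℝ} (hR : 1 ≤ R) (hγ : |γ| ≤ 1) {w : ℝ × ℝ} (hw1 : |w.1| ≤ 2)
    (hw : |w.2| ≤ 2) {ξ : E3} (hξ : ξ ∈ cube R) : wt (freq γ R w ξ) ≤ 41 * R := by
  have hr : 1 ≤ √R := Real.one_le_sqrt.2 hR
  have h1 : ‖freq γ R w ξ‖ ≤ 20 * R := by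
    rw [freq, norm_mul, Complex.norm_real, Real.norm_eq_abs, abs_of_nonneg (by positivity)]
    have h2 := norm_proj_le hγ hw1 hw ξ
    have h3 := norm_le_of_mem_cube (by linarith) hξ
    calc (√R)⁻¹ * ‖proj γ w ξ‖ ≤ 1 * ‖proj γ w ξ‖ := by
          gcongr; exact inv_le_one_of_one_le₀ hr
      _ ≤ 20 * R := by linarith
  have := wt_le (freq γ R w ξ)
  linarith

/-! ### Negligible tails at large scales -/

/-- The conditions on the scale that make all tails small. -/
structure IsLargeScale (δ R : ℝ) : Prop where
  hundred_le : 100 ≤ R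
  rpow_le : 40 ≤ R ^ δ
  wtSum_le : 41 ^ 4 * wtSum ≤ R
  tail : ∀ a b c : ℝ, |a| ≤ 2 → |b| ≤ 2 → |c| ≤ 2 → ∀ l : ℂ, R ^ δ / 4 ≤ ‖l‖ →
    ‖oscInt cutoff a b c l‖ ≤ (R ^ 1010)⁻¹ * (wt l ^ 4)⁻¹
  tail_sq : ∀ l : ℂ, R ^ δ / 4 ≤ ‖l‖ →
    ‖oscInt (fun t => cutoff t ^ 2) 0 0 0 l‖ ≤ (R ^ 1010)⁻¹ * (wt l ^ 4)⁻¹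

lemma exists_isLargeScale {δ : ℝ} (hδ : 0 < δ) :
    ∃ R₁ : ℝ, 1 ≤ R₁ ∧ ∀ R, R₁ ≤ R → IsLargeScale δ R := by
  obtain ⟨R₁, h₁, hR₁⟩ := isCutoff_cutoff.exists_tail hδ 1010
  obtain ⟨R₂, h₂, hR₂⟩ := isCutoff_cutoff.sq.exists_tail hδ 1010
  obtain ⟨R₃, hR₃⟩ := Filter.eventually_atTop.1
    ((tendsto_rpow_atTop hδ).eventually_ge_atTop 40)
  refine ⟨max (max R₁ R₂) (max R₃ (max 100 (41 ^ 4 * wtSum))),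
    h₁.trans ((le_max_left _ _).trans (le_max_left _ _)), fun R hR => ?_⟩
  simp only [max_le_iff] at hR
  obtain ⟨⟨h1, h2⟩, h3, h4, h5⟩ := hR
  exact ⟨h4, hR₃ R h3, h5, hR₁ R h1, hR₂ R h2 0 0 0 (by simp) (by simp) (by simp)⟩

lemma IsLargeScale.norm_scaledOsc_le {δ R γ : ℝ} (h : IsLargeScale δ R) (hγ : |γ| ≤ 1)
    {w : ℝ × ℝ} (hw1 : |w.1| ≤ 2) (hw : |w.2| ≤ 2) {ξ : E3} (hξ : ξ ∈ cube R) {n : ℤ × ℤ}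
    (hn : R ^ δ / 4 ≤ ‖freq γ R w ξ + fr n‖) :
    ‖scaledOsc γ R w ξ n‖ ≤ (R ^ 1010)⁻¹ * ((41 * R) ^ 4 * (wt (fr n) ^ 4)⁻¹) := by
  have hR : 1 ≤ R := by linarith [h.hundred_le]
  obtain ⟨ha, hb, hc⟩ := coeff_bounds hR hγ hw hξ
  refine (h.tail _ _ _ ha hb hc _ hn).trans ?_
  have h1 := inv_wt_add_fr_le (freq γ R w ξ) n
  have h2 : wt (freq γ R w ξ) ^ 4 ≤ (41 * R) ^ 4 :=
    pow_le_pow_left₀ (wt_pos _).le (wt_freq_le hR hγ hw1 hw hξ) 4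
  have h3 : 0 ≤ (wt (fr n) ^ 4)⁻¹ := inv_nonneg.2 (pow_nonneg (wt_pos _).le 4)
  gcongr
  exact h1.trans (by gcongr)

lemma IsLargeScale.wt_total_le {δ R : ℝ} (h : IsLargeScale δ R) :
    (R ^ 1010)⁻¹ * ((41 * R) ^ 4 * wtSum) ≤ (R ^ 1005)⁻¹ := by
  have hR : 0 < R := by linarith [h.hundred_le]
  calc (R ^ 1010)⁻¹ * ((41 * R) ^ 4 * wtSum) = (R ^ 1010)⁻¹ * (R ^ 4 * (41 ^ 4 * wtSum)) := by ring
    _ ≤ (R ^ 1010)⁻¹ * (R ^ 4 * R) := by gcongr; exact h.wtSum_le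
    _ = (R ^ 1005)⁻¹ := by field_simp

/-- The extension of a wave packet is negligible where all its frequencies are far away. -/
lemma IsLargeScale.norm_ext_waveFn_le {δ R γ : ℝ} (h : IsLargeScale δ R) (hγ : |γ| ≤ 1)
    {w : ℝ × ℝ} (hw1 : |w.1| ≤ 2) (hw : |w.2| ≤ 2) {ξ : E3} (hξ : ξ ∈ cube R)
    {c : ℤ × ℤ → ℂ} {X : ℝ} (hc : ∀ n, ‖c n‖ ≤ R * X) {A : Finset (ℤ × ℤ)}
    (hA : ∀ n ∈ A, R ^ δ / 4 ≤ ‖freq γ R w ξ + fr n‖) :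
    ‖ext γ (waveFn R w c A) ξ‖ ≤ (R ^ 1005)⁻¹ * X := by
  have hR : 0 < R := by linarith [h.hundred_le]
  have hX : 0 ≤ X := nonneg_of_mul_nonneg_right ((norm_nonneg _).trans (hc 0)) hR
  rw [ext_waveFn hR, norm_mul, norm_mul, norm_baseFactor, one_mul, Complex.norm_real,
    Real.norm_eq_abs, abs_of_pos (inv_pos.2 hR)]
  have h1 : ‖∑ n ∈ A, c n * scaledOsc γ R w ξ n‖ ≤ R * X * (R ^ 1005)⁻¹ := by
    calc _ ≤ ∑ n ∈ A, R * X * ((R ^ 1010)⁻¹ * ((41 * R) ^ 4 * (wt (fr n) ^ 4)⁻¹)) := by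
          refine norm_sum_le_of_le _ fun n hn => ?_
          rw [norm_mul]
          have := h.norm_scaledOsc_le hγ hw1 hw hξ (hA n hn)
          gcongr
          exact hc n
      _ = R * X * ((R ^ 1010)⁻¹ * ((41 * R) ^ 4 * ∑ n ∈ A, (wt (fr n) ^ 4)⁻¹)) := by
          simp only [← Finset.mul_sum]
      _ ≤ R * X * ((R ^ 1010)⁻¹ * ((41 * R) ^ 4 * wtSum)) := by
          gcongr; exact sum_inv_wt_le A
      _ ≤ R * X * (R ^ 1005)⁻¹ := by gcongr; exact h.wt_total_le
  calc R⁻¹ * ‖∑ n ∈ A, c n * scaledOsc γ R w ξ n‖ ≤ R⁻¹ * (R * X * (R ^ 1005)⁻¹) := by gcongr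
    _ = (R ^ 1005)⁻¹ * X := by field_simp

/-- The wave packet with frequencies `A` approximates `f` where all other frequencies are far
away. -/
lemma IsLargeScale.norm_ext_sub_waveFn_le {δ R γ : ℝ} (h : IsLargeScale δ R) (hγ : |γ| ≤ 1)
    {w : ℝ × ℝ} (hw1 : |w.1| ≤ 2) (hw : |w.2| ≤ 2) {ξ : E3} (hξ : ξ ∈ cube R)
    {f : PlaneFun} (hf : Integrable f)
    (hs : ∀ u, f (unscale R w u) ≠ 0 → |u.1| ≤ 1 / 2 ∧ |u.2| ≤ 1 / 2)
    {X : ℝ} (hc : ∀ n, ‖coef (fun u => f (unscale R w u)) n‖ ≤ R * X) {A : Finset (ℤ × ℤ)}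
    (hA : ∀ n, n ∉ A → R ^ δ / 4 ≤ ‖freq γ R w ξ + fr n‖) :
    ‖ext γ f ξ - ext γ (waveFn R w (coef fun u => f (unscale R w u)) A) ξ‖ ≤
      (R ^ 1005)⁻¹ * X := by
  classical
  have hR1 : 1 ≤ R := by linarith [h.hundred_le]
  have hR : 0 < R := by linarith
  set c := coef fun u => f (unscale R w u)
  have hX : 0 ≤ X := nonneg_of_mul_nonneg_right ((norm_nonneg _).trans (hc 0)) hR
  have hsum := hasSum_ext hR1 hγ hw hξ hf hs
  set T : ℤ × ℤ → ℂ := fun n => (R⁻¹ : ℝ) * (baseFactor γ w ξ * (c n * scaledOsc γ R w ξ n))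
  have hfin : ext γ (waveFn R w c A) ξ = ∑ n ∈ A, T n := by
    rw [ext_waveFn hR]; simp only [T, Finset.mul_sum]
  have hA' : HasSum (fun n => if n ∈ A then T n else 0) (∑ n ∈ A, T n) := by
    have : HasSum (fun n => if n ∈ A then T n else 0) (∑ n ∈ A, if n ∈ A then T n else 0) :=
      hasSum_sum_of_ne_finset_zero fun n hn => if_neg hn
    rwa [Finset.sum_congr rfl fun n hn => if_pos hn] at this
  rw [hfin]
  have hbd : HasSum (fun n => X * ((R ^ 1010)⁻¹ * (41 * R) ^ 4) * (wt (fr n) ^ 4)⁻¹)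
      (X * ((R ^ 1010)⁻¹ * (41 * R) ^ 4) * wtSum) := summable_inv_wt_fr.hasSum.mul_left _
  refine ((hsum.sub hA').norm_le_of_bounded hbd fun n => ?_).trans ?_
  · by_cases hn : n ∈ A
    · rw [if_pos hn, sub_self, norm_zero]
      have := wt_pos (fr n)
      positivity
    · rw [if_neg hn, sub_zero, norm_mul, norm_mul, norm_baseFactor, one_mul, Complex.norm_real,
        Real.norm_eq_abs, abs_of_pos (inv_pos.2 hR), norm_mul]
      have h1 := h.norm_scaledOsc_le hγ hw1 hw hξ (hA n hn)
      calc R⁻¹ * (‖c n‖ * ‖scaledOsc γ R w ξ n‖)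
          ≤ R⁻¹ * ((R * X) * ((R ^ 1010)⁻¹ * ((41 * R) ^ 4 * (wt (fr n) ^ 4)⁻¹))) := by
            gcongr; exact hc n
        _ = _ := by field_simp
  · calc X * ((R ^ 1010)⁻¹ * (41 * R) ^ 4) * wtSum
        = X * ((R ^ 1010)⁻¹ * ((41 * R) ^ 4 * wtSum)) := by ring
      _ ≤ X * (R ^ 1005)⁻¹ := by gcongr; exact h.wt_total_le
      _ = _ := mul_comm _ _

/-! ### Pieces of a function over the small caps -/

/-- The index of the grid interval of length `R^{-1/2}` containing `x ∈ [0,1]`; the right endpoint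
`1` belongs to the last interval. -/
noncomputable def gridIndex (R x : ℝ) : ℕ := min ⌊x * √R⌋₊ (⌈√R⌉₊ - 1)

lemma measurable_gridIndex (R : ℝ) : Measurable (gridIndex R) :=
  (Nat.measurable_floor.comp (measurable_id.mul_const _)).min measurable_const

lemma gridIndex_mem {R : ℝ} (hR : 0 < R) (x : ℝ) : gridIndex R x ∈ Finset.range ⌈√R⌉₊ := by
  have : 0 < ⌈√R⌉₊ := Nat.ceil_pos.2 (Real.sqrt_pos.2 hR)
  rw [Finset.mem_range, gridIndex]
  exact (min_le_right _ _).trans_lt (by omega)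

lemma gridIndex_bounds {R x : ℝ} (hR : 0 < R) (h0 : 0 ≤ x) (h1 : x ≤ 1) :
    |x * √R - (gridIndex R x + 1 / 2)| ≤ 1 / 2 := by
  have hr : 0 < √R := Real.sqrt_pos.2 hR
  have hc : 0 < ⌈√R⌉₊ := Nat.ceil_pos.2 hr
  have h2 : (gridIndex R x : ℝ) ≤ x * √R := by
    have : gridIndex R x ≤ ⌊x * √R⌋₊ := min_le_left _ _
    exact (Nat.cast_le.2 this).trans (Nat.floor_le (by positivity))
  have h3 : x * √R ≤ gridIndex R x + 1 := by
    rcases min_choice ⌊x * √R⌋₊ (⌈√R⌉₊ - 1) with h | h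
    · rw [gridIndex, h]; exact (Nat.lt_floor_add_one _).le
    · rw [gridIndex, h]
      have h4 : ((⌈√R⌉₊ - 1 : ℕ) : ℝ) + 1 = ⌈√R⌉₊ := by
        have : ⌈√R⌉₊ - 1 + 1 = ⌈√R⌉₊ := by omega
        exact_mod_cast this
      rw [h4]
      have := Nat.le_ceil √R
      nlinarith
  rw [abs_le]; constructor <;> linarith

/-- The part of `g` over the small cap `θ`. -/
noncomputable def piece (R : ℝ) (g : PlaneFun) (θ : ℕ × ℕ) : PlaneFun :=
  indicator {z | (gridIndex R z.1, gridIndex R z.2) = θ} g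

lemma measurableSet_piece (R : ℝ) (θ : ℕ × ℕ) :
    MeasurableSet {z : ℝ × ℝ | (gridIndex R z.1, gridIndex R z.2) = θ} :=
  (((measurable_gridIndex R).comp measurable_fst).prodMk
    ((measurable_gridIndex R).comp measurable_snd)) (measurableSet_singleton θ)

lemma sum_piece {R : ℝ} (hR : 0 < R) (g : PlaneFun) :
    ∑ θ ∈ Finset.range ⌈√R⌉₊ ×ˢ Finset.range ⌈√R⌉₊, piece R g θ = g := by
  funext z
  rw [Finset.sum_apply, Finset.sum_eq_single_of_mem (gridIndex R z.1, gridIndex R z.2)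
    (Finset.mem_product.2 ⟨gridIndex_mem hR z.1, gridIndex_mem hR z.2⟩)]
  · exact indicator_of_mem (s := {z | (gridIndex R z.1, gridIndex R z.2) = _}) rfl g
  · exact fun θ _ hθ => indicator_of_notMem (fun h => hθ h.symm) g

lemma piece_ne_zero {R : ℝ} (hR : 0 < R) {g : PlaneFun} (hs : Function.support g ⊆ unitSquare)
    {θ : ℕ × ℕ} {z : ℝ × ℝ} (hz : piece R g θ z ≠ 0) :
    |√R * (z.1 - (thetaCenter R θ).1)| ≤ 1 / 2 ∧ |√R * (z.2 - (thetaCenter R θ).2)| ≤ 1 / 2 := by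
  have hr : √R ≠ 0 := (Real.sqrt_pos.2 hR).ne'
  have hmem := mem_of_indicator_ne_zero hz
  simp only [mem_ofPred_eq] at hmem
  have hgz : g z ≠ 0 := by
    intro h; apply hz; simp [piece, indicator, h]
  obtain ⟨⟨h1, h2⟩, h3, h4⟩ := hs hgz
  subst hmem
  constructor
  · convert gridIndex_bounds hR h1 h2 using 2
    simp only [thetaCenter]; field_simp
  · convert gridIndex_bounds hR h3 h4 using 2
    simp only [thetaCenter]; field_simp

lemma piece_unscale {R : ℝ} (hR : 0 < R) {g : PlaneFun} (hs : Function.support g ⊆ unitSquare)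
    {θ : ℕ × ℕ} (u : ℝ × ℝ) (hu : piece R g θ (unscale R (thetaCenter R θ) u) ≠ 0) :
    |u.1| ≤ 1 / 2 ∧ |u.2| ≤ 1 / 2 := by
  have hr : √R ≠ 0 := (Real.sqrt_pos.2 hR).ne'
  have h := piece_ne_zero hR hs hu
  simp only [unscale, Prod.fst_add, Prod.snd_add, Prod.smul_fst, Prod.smul_snd, smul_eq_mul,
    add_sub_cancel_left, mul_inv_cancel_left₀ hr] at h
  exact h

lemma support_piece {R : ℝ} (hR : 0 < R) {g : PlaneFun} (hs : Function.support g ⊆ unitSquare)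
    (θ : ℕ × ℕ) : Function.support (piece R g θ) ⊆ threeTheta R θ := by
  intro z hz
  have hr : 0 < √R := Real.sqrt_pos.2 hR
  have h := piece_ne_zero hR hs hz
  rw [abs_mul, abs_mul, abs_of_pos hr] at h
  constructor <;> rw [div_div, le_div_iff₀ (by positivity)] <;> linarith

lemma memLp_piece {g : PlaneFun} (hg : MemLp g 2 volume) (R : ℝ) (θ : ℕ × ℕ) :
    MemLp (piece R g θ) 2 volume := hg.indicator (measurableSet_piece R θ)

lemma isCompact_unitSquare : IsCompact unitSquare := isCompact_Icc.prod isCompact_Icc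

lemma norm_piece_le (R : ℝ) (g : PlaneFun) (θ : ℕ × ℕ) (z : ℝ × ℝ) : ‖piece R g θ z‖ ≤ ‖g z‖ :=
  norm_indicator_le_norm_self _ _

lemma integral_norm_sq_piece_le {R : ℝ} (hR : 0 < R) {g : PlaneFun} (hg : MemLp g 2 volume)
    (hs : Function.support g ⊆ unitSquare) (θ : ℕ × ℕ) :
    ∫ z, ‖piece R g θ z‖ ^ 2 ≤ ∫ z in threeTheta R θ, ‖g z‖ ^ 2 := by
  have hp := memLp_piece hg R θ
  rw [← setIntegral_eq_integral_of_forall_compl_eq_zero (s := threeTheta R θ)]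
  · refine setIntegral_mono ((memLp_two_iff_integrable_sq_norm hp.1).1 hp).integrableOn
      ((memLp_two_iff_integrable_sq_norm hg.1).1 hg).integrableOn fun z => ?_
    have := norm_piece_le R g θ z
    simp only
    gcongr
  · intro z hz
    rw [Function.notMem_support.1 fun h => hz (support_piece hR hs θ h), norm_zero]
    norm_num

lemma integral_norm_le_l2norm {g : PlaneFun} (hg : MemLp g 2 volume)
    (hs : Function.support g ⊆ unitSquare) : ∫ z, ‖g z‖ ≤ l2norm g := by
  have hvol : volume unitSquare = 1 := by
    rw [unitSquare, Measure.volume_eq_prod, Measure.prod_prod, Real.volume_Icc]; simp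
  have : IsProbabilityMeasure (volume.restrict unitSquare) := ⟨by simpa using hvol⟩
  have h1 : eLpNorm g 1 volume ≤ eLpNorm g 2 volume := by
    rw [← eLpNorm_restrict_eq_of_support_subset (p := 1) hs,
      ← eLpNorm_restrict_eq_of_support_subset (p := 2) hs]
    exact eLpNorm_le_eLpNorm_of_exponent_le (by norm_num) hg.1.restrict
  rw [integral_norm_eq_lintegral_enorm hg.1, ← eLpNorm_one_eq_lintegral_enorm]
  exact ENNReal.toReal_mono hg.2.ne h1

/-- The Fourier coefficients of a piece after rescaling. -/
noncomputable def pieceCoef (R : ℝ) (g : PlaneFun) (θ : ℕ × ℕ) : ℤ × ℤ → ℂ :=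
  coef fun u => piece R g θ (unscale R (thetaCenter R θ) u)

lemma integrable_piece {g : PlaneFun} (hg : MemLp g 2 volume)
    (hs : Function.support g ⊆ unitSquare) (R : ℝ) (θ : ℕ × ℕ) : Integrable (piece R g θ) :=
  (integrable_of_memLp_of_support hg isCompact_unitSquare hs).indicator (measurableSet_piece R θ)

/-- The factor R is the Jacobian of the rescaling. The L¹ norm is at most the L² norm because Σ has
area 1. -/
lemma norm_pieceCoef_le {R : ℝ} (hR : 0 < R) {g : PlaneFun} (hg : MemLp g 2 volume)
    (hs : Function.support g ⊆ unitSquare) (θ : ℕ × ℕ) (n : ℤ × ℤ) :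
    ‖pieceCoef R g θ n‖ ≤ R * l2norm g := by
  refine (norm_coef_le _ _).trans ?_
  have h1 := integral_unscale hR (thetaCenter R θ) fun z => ‖piece R g θ z‖
  rw [smul_eq_mul, eq_inv_mul_iff_mul_eq₀ hR.ne'] at h1
  rw [← h1]
  have h2 : ∫ z, ‖piece R g θ z‖ ≤ ∫ z, ‖g z‖ :=
    integral_mono (integrable_piece hg hs R θ).norm
      (integrable_of_memLp_of_support hg isCompact_unitSquare hs).norm (norm_piece_le R g θ)
  have h3 := integral_norm_le_l2norm hg hs
  gcongr
  exact h2.trans h3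

lemma sum_norm_sq_pieceCoef_le {R : ℝ} (hR : 0 < R) {g : PlaneFun} (hg : MemLp g 2 volume)
    (hs : Function.support g ⊆ unitSquare) (θ : ℕ × ℕ) (A : Finset (ℤ × ℤ)) :
    R⁻¹ * (9 * ∑ n ∈ A, ‖pieceCoef R g θ n‖ ^ 2) ≤ ∫ z in threeTheta R θ, ‖g z‖ ^ 2 := by
  refine le_trans ?_ (integral_norm_sq_piece_le hR hg hs θ)
  rw [integral_unscale hR (thetaCenter R θ), smul_eq_mul]
  gcongr
  refine bessel (memLp_unscale hR _ (integrable_piece hg hs R θ) (memLp_piece hg R θ)) ?_ A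
  intro u hu
  obtain ⟨h1, h2⟩ := piece_unscale hR hs u hu
  rw [abs_le] at h1 h2
  exact ⟨⟨by linarith, by linarith⟩, ⟨by linarith, by linarith⟩⟩

/-! ### Frequencies and tubes -/

lemma proj_sub (γ : ℝ) (w : ℝ × ℝ) (v v' : E3) : proj γ w (v - v') = proj γ w v - proj γ w v' := by
  apply Complex.ext <;> simp [proj] <;> ring

/-- The axis direction is the kernel of the projection, so the frequency of ξ depends only on its
offset from the axis. -/
lemma proj_smul_nu (γ R : ℝ) (θ : ℕ × ℕ) (t : ℝ) :
    proj γ (thetaCenter R θ) (t • nu γ R θ) = 0 := by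
  apply Complex.ext <;> simp [proj, nu, normalVec] <;> ring

/-- The projection adds a multiple of the normal to v, and this cannot shorten a vector orthogonal
to the normal. -/
lemma norm_le_norm_proj {γ R : ℝ} {θ : ℕ × ℕ} {v : E3} (hv : inner ℝ v (nu γ R θ) = 0) :
    ‖v‖ ≤ ‖proj γ (thetaCenter R θ) v‖ := by
  set w := thetaCenter R θ
  have h1 : v 0 * w.2 + v 1 * (w.1 + γ * w.2 ^ 2) - v 2 = 0 := by
    rw [nu, inner_smul_right, mul_eq_zero] at hv
    rcases hv with hv | hv
    · exact absurd hv (inv_ne_zero (norm_ne_zero_iff.2 (normalVec_ne_zero _ _)))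
    · simp only [normalVec, PiLp.inner_apply, Fin.sum_univ_three] at hv
      simp at hv
      linarith
  refine le_of_sq_le_sq ?_ (norm_nonneg _)
  rw [EuclideanSpace.norm_sq_eq, Fin.sum_univ_three, ← Complex.normSq_eq_norm_sq,
    Complex.normSq_apply]
  simp only [proj, Real.norm_eq_abs, sq_abs]
  have h2 : v 2 = v 0 * w.2 + v 1 * (w.1 + γ * w.2 ^ 2) := by linarith
  generalize w.1 + γ * w.2 ^ 2 = b at *
  have h3 : (v 0 + v 2 * w.2) * (v 0 + v 2 * w.2) + (v 1 + v 2 * b) * (v 1 + v 2 * b) =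
      v 0 ^ 2 + v 1 ^ 2 + 2 * v 2 * (v 0 * w.2 + v 1 * b) + (v 2 * w.2) ^ 2 + (v 2 * b) ^ 2 := by
    ring
  rw [h3, ← h2]
  nlinarith [sq_nonneg (v 2), sq_nonneg (v 2 * w.2), sq_nonneg (v 2 * b)]

lemma norm_freq_sub (γ R : ℝ) (w : ℝ × ℝ) (v v' : E3) :
    ‖freq γ R w v - freq γ R w v'‖ = (√R)⁻¹ * ‖proj γ w (v - v')‖ := by
  rw [freq, freq, ← mul_sub, ← proj_sub, norm_mul, Complex.norm_real, Real.norm_eq_abs,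
    abs_of_nonneg (by positivity)]

lemma rpow_half_add {R : ℝ} (hR : 0 < R) (δ : ℝ) : R ^ (1 / 2 + δ) = √R * R ^ δ := by
  rw [Real.rpow_add hR, Real.sqrt_eq_rpow]

/-- The component of `ξ` orthogonal to the axis of `T`, relative to the axis. -/
noncomputable def axisOffset (γ R : ℝ) (T : Tube) (ξ : E3) : E3 :=
  ξ - (inner ℝ ξ (nu γ R T.theta)) • nu γ R T.theta - T.base

lemma inner_axisOffset {γ R : ℝ} {T : Tube} (hT : inner ℝ T.base (nu γ R T.theta) = 0) (ξ : E3) :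
    inner ℝ (axisOffset γ R T ξ) (nu γ R T.theta) = 0 := by
  rw [axisOffset, inner_sub_left, inner_sub_left, hT, inner_smul_left, real_inner_self_eq_norm_sq,
    norm_nu]
  simp

lemma norm_freq_sub_base (γ R : ℝ) (T : Tube) (ξ : E3) :
    ‖freq γ R (thetaCenter R T.theta) ξ - freq γ R (thetaCenter R T.theta) T.base‖ =
      (√R)⁻¹ * ‖proj γ (thetaCenter R T.theta) (axisOffset γ R T ξ)‖ := by
  rw [norm_freq_sub, axisOffset, proj_sub _ _ (_ - _), proj_sub, proj_sub _ _ ξ (_ • _),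
    proj_smul_nu, sub_zero]

/-- Points of the cube have norm at most 2R, half the length of the tube. A point of the cube can
therefore miss the tube only by its distance from the axis. -/
lemma norm_freq_sub_base_gt {γ R δ : ℝ} (hR : 0 < R) {T : Tube}
    (hT : inner ℝ T.base (nu γ R T.theta) = 0) {ξ : E3} (hξ : ξ ∈ cube R \ T.carrier γ R δ) :
    R ^ δ < ‖freq γ R (thetaCenter R T.theta) ξ - freq γ R (thetaCenter R T.theta) T.base‖ := by
  have hr : 0 < √R := Real.sqrt_pos.2 hR
  rw [norm_freq_sub_base, lt_inv_mul_iff₀ hr, ← rpow_half_add hR]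
  refine lt_of_lt_of_le ?_ (norm_le_norm_proj (inner_axisOffset hT ξ))
  by_contra hle
  refine hξ.2 ⟨?_, not_lt.1 hle⟩
  have h1 : |inner ℝ ξ (nu γ R T.theta)| ≤ ‖ξ‖ * ‖nu γ R T.theta‖ := abs_real_inner_le_norm _ _
  rw [norm_nu] at h1
  have h2 := norm_le_of_mem_cube hR.le hξ.1
  linarith

lemma norm_freq_sub_base_le {γ R len : ℝ} (hR : 0 < R) (hγ : |γ| ≤ 1) {T : Tube}
    (hw1 : |(thetaCenter R T.theta).1| ≤ 2) (hw : |(thetaCenter R T.theta).2| ≤ 2) {ξ : E3}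
    (hξ : ξ ∈ T.cylinder γ R (√R) len) :
    ‖freq γ R (thetaCenter R T.theta) ξ - freq γ R (thetaCenter R T.theta) T.base‖ ≤ 10 := by
  have hr : 0 < √R := Real.sqrt_pos.2 hR
  rw [norm_freq_sub_base, inv_mul_le_iff₀ hr]
  refine (norm_proj_le hγ hw1 hw _).trans ?_
  have : ‖axisOffset γ R T ξ‖ ≤ √R := hξ.2
  linarith

/-- If the bases were within twice the radius, their midpoint would belong to both tubes. -/
lemma norm_freq_base_sub_base {γ R δ : ℝ} (hR : 0 < R) {T T' : Tube}
    (hT : inner ℝ T.base (nu γ R T.theta) = 0) (hT' : inner ℝ T'.base (nu γ R T'.theta) = 0)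
    (hθ : T.theta = T'.theta) (hd : Disjoint (T.carrier γ R δ) (T'.carrier γ R δ)) :
    2 * R ^ δ < ‖freq γ R (thetaCenter R T.theta) T.base -
      freq γ R (thetaCenter R T.theta) T'.base‖ := by
  have hr : 0 < √R := Real.sqrt_pos.2 hR
  rw [← hθ] at hT'
  have hperp : inner ℝ (T.base - T'.base) (nu γ R T.theta) = 0 := by
    rw [inner_sub_left, hT, hT', sub_zero]
  rw [norm_freq_sub, lt_inv_mul_iff₀ hr]
  refine lt_of_lt_of_le ?_ (norm_le_norm_proj hperp)
  by_contra hle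
  rw [not_lt, mul_left_comm, ← rpow_half_add hR] at hle
  set m : E3 := (1 / 2 : ℝ) • (T.base + T'.base)
  have hm : inner ℝ m (nu γ R T.theta) = 0 := by
    rw [inner_smul_left, inner_add_left, hT, hT']; simp
  have hlen : (0 : ℝ) ≤ 4 * R / 2 := by positivity
  have hm₁ : m ∈ T.carrier γ R δ := by
    refine ⟨by rw [hm, abs_zero]; exact hlen, ?_⟩
    have : m - T.base = (-(1 / 2) : ℝ) • (T.base - T'.base) := by
      simp only [m]; module
    rw [hm, zero_smul, sub_zero, this, norm_smul, norm_neg, Real.norm_of_nonneg (by norm_num)]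
    linarith
  have hm₂ : m ∈ T'.carrier γ R δ := by
    refine ⟨by rw [← hθ, hm, abs_zero]; exact hlen, ?_⟩
    have : m - T'.base = (1 / 2 : ℝ) • (T.base - T'.base) := by
      simp only [m]; module
    rw [← hθ, hm, zero_smul, sub_zero, this, norm_smul, Real.norm_of_nonneg (by norm_num)]
    linarith
  exact Set.disjoint_left.1 hd hm₁ hm₂

lemma abs_thetaCenter_le {R : ℝ} (hR : 1 ≤ R) {θ : ℕ × ℕ} (hθ : IsThetaIndex R θ) :
    |(thetaCenter R θ).1| ≤ 2 ∧ |(thetaCenter R θ).2| ≤ 2 := by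
  have hr : 1 ≤ √R := Real.one_le_sqrt.2 hR
  have key : ∀ i : ℕ, (i : ℝ) < √R → |((i : ℝ) + 1 / 2) / √R| ≤ 2 := by
    intro i hi
    rw [abs_of_nonneg (by positivity), div_le_iff₀ (by linarith)]
    linarith
  exact ⟨key _ hθ.1, key _ hθ.2⟩

/-- The frequencies close to the axis of a tube. -/
def nearSet (γ R δ : ℝ) (T : Tube) : Set (ℤ × ℤ) :=
  {n | ‖freq γ R (thetaCenter R T.theta) T.base + fr n‖ ≤ R ^ δ / 2}

lemma finite_setOf_norm_add_fr_le (l : ℂ) (ρ : ℝ) : {n : ℤ × ℤ | ‖l + fr n‖ ≤ ρ}.Finite := by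
  set M := ⌈‖l‖ + ρ⌉
  refine ((Finset.Icc (-M) M ×ˢ Finset.Icc (-M) M).finite_toSet).subset fun n hn => ?_
  have h1 : ‖fr n‖ ≤ ‖l‖ + ρ := by
    have := norm_sub_le (l + fr n) l
    rw [add_sub_cancel_left] at this
    have hn' : ‖l + fr n‖ ≤ ρ := hn
    linarith
  have key : ∀ k : ℤ, |2 * Real.pi / 3 * k| ≤ ‖fr n‖ → k ∈ Finset.Icc (-M) M := by
    intro k hk
    have h2 := ((le_abs_two_pi_div_three_mul k).trans hk).trans (h1.trans (Int.le_ceil _))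
    rw [Finset.mem_Icc, ← abs_le]
    exact_mod_cast h2
  simp only [Finset.coe_product, mem_prod, Finset.mem_coe]
  exact ⟨key _ (Complex.abs_re_le_norm (fr n)), key _ (Complex.abs_im_le_norm (fr n))⟩

open Classical in
/-- A choice of a tube over `θ` close to the frequency `n`. -/
noncomputable def assignedTube (γ R δ : ℝ) (𝕋 : Finset Tube) (θ : ℕ × ℕ) (n : ℤ × ℤ) :
    Option Tube :=
  if h : ∃ T ∈ 𝕋, T.theta = θ ∧ n ∈ nearSet γ R δ T then some h.choose else none

open Classical in
/-- The frequencies assigned to a tube. -/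
noncomputable def tubeFreqs (γ R δ : ℝ) (𝕋 : Finset Tube) (T : Tube) : Finset (ℤ × ℤ) :=
  (finite_setOf_norm_add_fr_le (freq γ R (thetaCenter R T.theta) T.base) (R ^ δ / 2)).toFinset.filter
    fun n => assignedTube γ R δ 𝕋 T.theta n = some T

lemma mem_tubeFreqs {γ R δ : ℝ} {𝕋 : Finset Tube} {T : Tube} {n : ℤ × ℤ} :
    n ∈ tubeFreqs γ R δ 𝕋 T ↔
      n ∈ nearSet γ R δ T ∧ assignedTube γ R δ 𝕋 T.theta n = some T := by
  classical
  simp only [tubeFreqs, Finset.mem_filter, Finite.mem_toFinset]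
  rfl

/-- A frequency may be near several overlapping tubes over θ. Assigning it to only one of them is
what gives the L² bound the constant 1. -/
lemma disjoint_tubeFreqs {γ R δ : ℝ} {𝕋 : Finset Tube} {T T' : Tube} (hθ : T.theta = T'.theta)
    (hne : T ≠ T') : Disjoint (tubeFreqs γ R δ 𝕋 T) (tubeFreqs γ R δ 𝕋 T') := by
  rw [Finset.disjoint_left]
  intro n h1 h2
  have h3 := (mem_tubeFreqs.1 h1).2
  rw [hθ, (mem_tubeFreqs.1 h2).2] at h3
  exact hne (Option.some.inj h3).symm

lemma exists_mem_tubeFreqs {γ R δ : ℝ} {𝕋 : Finset Tube} {T : Tube} (hT : T ∈ 𝕋) {n : ℤ × ℤ}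
    (hn : n ∈ nearSet γ R δ T) :
    ∃ T' ∈ 𝕋, T'.theta = T.theta ∧ n ∈ tubeFreqs γ R δ 𝕋 T' := by
  have h : ∃ T' ∈ 𝕋, T'.theta = T.theta ∧ n ∈ nearSet γ R δ T' := ⟨T, hT, rfl, hn⟩
  obtain ⟨h1, h2, h3⟩ := h.choose_spec
  refine ⟨h.choose, h1, h2, mem_tubeFreqs.2 ⟨h3, ?_⟩⟩
  rw [h2, assignedTube, dif_pos h]

/-! ### Existence of wave packet decompositions -/

/-- The wave packet of `g` on the tube `T`. -/
noncomputable def wavePacket (γ R δ : ℝ) (𝕋 : Finset Tube) (g : PlaneFun) (T : Tube) : PlaneFun :=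
  waveFn R (thetaCenter R T.theta) (pieceCoef R g T.theta) (tubeFreqs γ R δ 𝕋 T)

lemma inv_pow_le_rpow {R : ℝ} (hR : 1 ≤ R) {n : ℕ} (hn : 1000 ≤ n) :
    (R ^ n)⁻¹ ≤ R ^ (-1000 : ℝ) := by
  rw [← Real.rpow_natCast, ← Real.rpow_neg (by linarith)]
  refine Real.rpow_le_rpow_of_exponent_le hR (neg_le_neg ?_)
  exact_mod_cast hn

/-- Off the tube the frequency of ξ is more than R^δ from that of the base, while the frequencies of
the packet are within R^δ/2 of it. -/
lemma wavePacket_localized {γ R δ : ℝ} (h : IsLargeScale δ R) (hγ : |γ| ≤ 1) {𝕋 : Finset Tube}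
    (h𝕋 : IsTubeFamily γ R δ 𝕋) {g : PlaneFun} (hg : MemLp g 2 volume)
    (hs : Function.support g ⊆ unitSquare) {T : Tube} (hT : T ∈ 𝕋) {ξ : E3}
    (hξ : ξ ∈ cube R \ T.carrier γ R δ) :
    ‖ext γ (wavePacket γ R δ 𝕋 g T) ξ‖ ≤ R ^ (-1000 : ℝ) * l2norm g := by
  have hR1 : 1 ≤ R := by linarith [h.hundred_le]
  have hR : 0 < R := by linarith
  obtain ⟨hw1, hw⟩ := abs_thetaCenter_le hR1 (h𝕋.index T hT)
  refine (h.norm_ext_waveFn_le hγ hw1 hw hξ.1 (norm_pieceCoef_le hR hg hs _) ?_).trans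
    (mul_le_mul_of_nonneg_right (inv_pow_le_rpow hR1 (by norm_num)) ENNReal.toReal_nonneg)
  intro n hn
  have h1 := norm_freq_sub_base_gt (δ := δ) hR (h𝕋.base_perp T hT) hξ
  have h2 : ‖freq γ R (thetaCenter R T.theta) T.base + fr n‖ ≤ R ^ δ / 2 := (mem_tubeFreqs.1 hn).1
  have h3 := norm_sub_le (freq γ R (thetaCenter R T.theta) ξ + fr n)
    (freq γ R (thetaCenter R T.theta) T.base + fr n)
  rw [add_sub_add_right_eq_sub] at h3
  have := h.rpow_le
  linarith

/-- The base frequencies are more than 2R^δ apart, so after subtracting R^δ/2 twice all pairs of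
modes are separated by R^δ. Schur's test then bounds the inner product. -/
lemma wavePacket_orthogonal {γ R δ : ℝ} (h : IsLargeScale δ R) {𝕋 : Finset Tube}
    (h𝕋 : IsTubeFamily γ R δ 𝕋) {g : PlaneFun} (hg : MemLp g 2 volume)
    (hs : Function.support g ⊆ unitSquare) {T₁ T₂ : Tube} (hT₁ : T₁ ∈ 𝕋) (hT₂ : T₂ ∈ 𝕋)
    (hθ : T₁.theta = T₂.theta) (hd : Disjoint (T₁.carrier γ R δ) (T₂.carrier γ R δ)) :
    ‖∫ z, wavePacket γ R δ 𝕋 g T₁ z * (starRingEnd ℂ) (wavePacket γ R δ 𝕋 g T₂ z)‖ ≤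
      R ^ (-1000 : ℝ) * ∫ z in threeTheta R T₁.theta, ‖g z‖ ^ 2 := by
  have hR1 : 1 ≤ R := by linarith [h.hundred_le]
  have hR : 0 < R := by linarith
  set E := ∫ z in threeTheta R T₁.theta, ‖g z‖ ^ 2
  have hE : 0 ≤ E := integral_nonneg fun _ => by positivity
  have hb := norm_freq_base_sub_base hR (h𝕋.base_perp _ hT₁) (h𝕋.base_perp _ hT₂) hθ hd
  have hc : ∀ A, ∑ n ∈ A, ‖pieceCoef R g T₁.theta n‖ ^ 2 ≤ R * E := by
    intro A
    have h1 := sum_norm_sq_pieceCoef_le hR hg hs T₁.theta A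
    rw [inv_mul_le_iff₀ hR] at h1
    have h2 : 0 ≤ ∑ n ∈ A, ‖pieceCoef R g T₁.theta n‖ ^ 2 := Finset.sum_nonneg fun _ _ => by positivity
    linarith
  simp only [wavePacket]
  rw [← hθ, integral_waveFn_mul_conj hR, norm_mul, Complex.norm_real, Real.norm_eq_abs,
    abs_of_pos (inv_pos.2 hR)]
  have hmain := norm_sum_sum_le (c := pieceCoef R g T₁.theta) (A := tubeFreqs γ R δ 𝕋 T₁)
    (B := tubeFreqs γ R δ 𝕋 T₂) (J := fun k => oscInt (fun t => cutoff t ^ 2) 0 0 0 (fr k))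
    (β := (R ^ 1010)⁻¹) (E := R * E) (by positivity) ?_ (hc _) (hc _)
  · have hS := h.wtSum_le
    have hS0 := wtSum_nonneg
    calc R⁻¹ * _ ≤ R⁻¹ * ((R ^ 1010)⁻¹ * wtSum * (R * E)) := by gcongr
      _ = (R ^ 1010)⁻¹ * wtSum * E := by field_simp
      _ ≤ (R ^ 1010)⁻¹ * R * E := by gcongr; linarith
      _ = (R ^ 1009)⁻¹ * E := by field_simp
      _ ≤ R ^ (-1000 : ℝ) * E := by gcongr; exact inv_pow_le_rpow hR1 (by norm_num)
  · intro n hn m hm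
    refine h.tail_sq _ ?_
    have h1 : ‖freq γ R (thetaCenter R T₁.theta) T₁.base + fr n‖ ≤ R ^ δ / 2 :=
      (mem_tubeFreqs.1 hn).1
    have h2 : ‖freq γ R (thetaCenter R T₂.theta) T₂.base + fr m‖ ≤ R ^ δ / 2 :=
      (mem_tubeFreqs.1 hm).1
    rw [← hθ] at h2
    set b₁ := freq γ R (thetaCenter R T₁.theta) T₁.base
    set b₂ := freq γ R (thetaCenter R T₁.theta) T₂.base
    have h3 : b₁ - b₂ = (b₁ + fr n) - (b₂ + fr m) - fr (n - m) := by rw [fr_sub]; ring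
    have h4 : ‖b₁ - b₂‖ ≤ ‖b₁ + fr n‖ + ‖b₂ + fr m‖ + ‖fr (n - m)‖ := by
      rw [h3]
      exact (norm_sub_le _ _).trans (by gcongr; exact norm_sub_le _ _)
    have := h.rpow_le
    linarith

lemma wavePacket_l2_bound {γ R δ : ℝ} (hR : 0 < R) {𝕋 : Finset Tube} {g : PlaneFun}
    (hg : MemLp g 2 volume) (hs : Function.support g ⊆ unitSquare) (θ : ℕ × ℕ) {𝕋' : Finset Tube}
    (hθ : ∀ T ∈ 𝕋', T.theta = θ) :
    ∑ T ∈ 𝕋', ∫ z, ‖wavePacket γ R δ 𝕋 g T z‖ ^ 2 ≤ ∫ z in threeTheta R θ, ‖g z‖ ^ 2 := by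
  classical
  calc ∑ T ∈ 𝕋', ∫ z, ‖wavePacket γ R δ 𝕋 g T z‖ ^ 2
      ≤ ∑ T ∈ 𝕋', R⁻¹ * (9 * ∑ n ∈ tubeFreqs γ R δ 𝕋 T, ‖pieceCoef R g θ n‖ ^ 2) := by
        refine Finset.sum_le_sum fun T hT => ?_
        rw [← hθ T hT]
        exact integral_norm_sq_waveFn_le hR _ _ _
    _ = R⁻¹ * (9 * ∑ n ∈ 𝕋'.biUnion (tubeFreqs γ R δ 𝕋), ‖pieceCoef R g θ n‖ ^ 2) := by
        rw [Finset.sum_biUnion]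
        · simp only [Finset.mul_sum]
        · intro T hT T' hT' hne
          exact disjoint_tubeFreqs ((hθ T hT).trans (hθ T' hT').symm) hne
    _ ≤ _ := sum_norm_sq_pieceCoef_le hR hg hs θ _

lemma waveFn_biUnion {R : ℝ} (w : ℝ × ℝ) (c : ℤ × ℤ → ℂ) {S : Finset Tube}
    {A : Tube → Finset (ℤ × ℤ)} [DecidableEq (ℤ × ℤ)]
    (hA : ∀ T ∈ S, ∀ T' ∈ S, T ≠ T' → Disjoint (A T) (A T')) :
    waveFn R w c (S.biUnion A) = ∑ T ∈ S, waveFn R w c (A T) := by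
  funext z
  rw [Finset.sum_apply]
  simp only [waveFn, packet, trig]
  rw [Finset.sum_biUnion (fun T hT T' hT' h => hA T hT T' hT' h), Finset.mul_sum]

lemma integrable_wavePacket {R : ℝ} (hR : 0 < R) (γ δ : ℝ) (𝕋 : Finset Tube) (g : PlaneFun)
    (T : Tube) : Integrable (wavePacket γ R δ 𝕋 g T) :=
  integrable_of_memLp_of_support (memLp_waveFn hR _ _ _) (isCompact_square _ _)
    (support_waveFn hR _ _ _)

/-- A frequency assigned to no tube is not near the thin tube through ξ either, so dropping it
changes the extension at ξ only negligibly. -/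
lemma piece_reconstruct {γ R δ : ℝ} (h : IsLargeScale δ R) (hγ : |γ| ≤ 1) {𝕋 : Finset Tube}
    (h𝕋 : IsTubeFamily γ R δ 𝕋) {g : PlaneFun} (hg : MemLp g 2 volume)
    (hs : Function.support g ⊆ unitSquare) {θ : ℕ × ℕ} (hθ : IsThetaIndex R θ) {ξ : E3}
    (hξ : ξ ∈ cube R) {𝕋' : Finset Tube} (h𝕋' : ∀ T, T ∈ 𝕋' ↔ T ∈ 𝕋 ∧ T.theta = θ) :
    ‖ext γ (piece R g θ) ξ - ∑ T ∈ 𝕋', ext γ (wavePacket γ R δ 𝕋 g T) ξ‖ ≤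
      (R ^ 1005)⁻¹ * l2norm g := by
  classical
  have hR1 : 1 ≤ R := by linarith [h.hundred_le]
  have hR : 0 < R := by linarith
  obtain ⟨hw1, hw⟩ := abs_thetaCenter_le hR1 hθ
  have hsum : ∑ T ∈ 𝕋', ext γ (wavePacket γ R δ 𝕋 g T) ξ =
      ext γ (waveFn R (thetaCenter R θ) (pieceCoef R g θ)
        (𝕋'.biUnion (tubeFreqs γ R δ 𝕋))) ξ := by
    rw [← ext_sum 𝕋' fun T _ => integrable_wavePacket hR _ _ _ _ _, waveFn_biUnion]
    · congr 1
      refine Finset.sum_congr rfl fun T hT => ?_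
      rw [wavePacket, ((h𝕋' T).1 hT).2]
    · intro T hT T' hT' hne
      exact disjoint_tubeFreqs (((h𝕋' T).1 hT).2.trans ((h𝕋' T').1 hT').2.symm) hne
  rw [hsum]
  refine h.norm_ext_sub_waveFn_le hγ hw1 hw hξ (integrable_piece hg hs R θ)
    (piece_unscale hR hs) (norm_pieceCoef_le hR hg hs θ) fun n hn => ?_
  obtain ⟨T, hT, hTθ, hTξ⟩ := h𝕋.thin_cover θ hθ ξ hξ
  subst hTθ
  have h1 := norm_freq_sub_base_le hR hγ hw1 hw hTξ
  have h2 : R ^ δ / 2 < ‖freq γ R (thetaCenter R T.theta) T.base + fr n‖ := by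
    by_contra hle
    obtain ⟨T', hT', hθ', hn'⟩ := exists_mem_tubeFreqs (γ := γ) (R := R) (δ := δ) hT
      (n := n) (not_lt.1 hle)
    exact hn (Finset.mem_biUnion.2 ⟨T', (h𝕋' T').2 ⟨hT', hθ'⟩, hn'⟩)
  have h3 := norm_sub_le (freq γ R (thetaCenter R T.theta) ξ + fr n)
    (freq γ R (thetaCenter R T.theta) ξ - freq γ R (thetaCenter R T.theta) T.base)
  rw [add_sub_sub_cancel, add_comm (fr n)] at h3
  -- R^δ/2 - 10 ≥ R^δ/4 because R^δ ≥ 40; the 10 bounds the frequency offset within a thin tube.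
  have := h.rpow_le
  linarith

lemma wavePacket_reconstruct {γ R δ : ℝ} (h : IsLargeScale δ R) (hγ : |γ| ≤ 1) {𝕋 : Finset Tube}
    (h𝕋 : IsTubeFamily γ R δ 𝕋) {g : PlaneFun} (hg : MemLp g 2 volume)
    (hs : Function.support g ⊆ unitSquare) {ξ : E3} (hξ : ξ ∈ cube R) :
    ‖ext γ g ξ - ∑ T ∈ 𝕋, ext γ (wavePacket γ R δ 𝕋 g T) ξ‖ ≤ R ^ (-1000 : ℝ) * l2norm g := by
  classical
  have hR1 : 1 ≤ R := by linarith [h.hundred_le]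
  have hR : 0 < R := by linarith
  have hr : 0 < √R := Real.sqrt_pos.2 hR
  set Θ := Finset.range ⌈√R⌉₊ ×ˢ Finset.range ⌈√R⌉₊
  have hΘ : ∀ θ, θ ∈ Θ ↔ IsThetaIndex R θ := by
    intro θ
    simp only [Θ, Finset.mem_product, Finset.mem_range, Nat.lt_ceil, IsThetaIndex]
  have e1 : ext γ g ξ = ∑ θ ∈ Θ, ext γ (piece R g θ) ξ := by
    rw [← ext_sum Θ fun θ _ => integrable_piece hg hs R θ, sum_piece hR]
  have e2 : ∑ T ∈ 𝕋, ext γ (wavePacket γ R δ 𝕋 g T) ξ =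
      ∑ θ ∈ Θ, ∑ T ∈ 𝕋 with T.theta = θ, ext γ (wavePacket γ R δ 𝕋 g T) ξ :=
    (Finset.sum_fiberwise_of_maps_to (fun T hT => (hΘ _).2 (h𝕋.index T hT)) _).symm
  rw [e1, e2, ← Finset.sum_sub_distrib]
  -- At most R² small caps contribute R^{-1005} each, which leaves R^{-1003}.
  have hN : (⌈√R⌉₊ : ℝ) ≤ R := by
    have h1 := Nat.ceil_lt_add_one hr.le
    have h2 : 10 ≤ √R := by
      rw [show (10 : ℝ) = √(10 ^ 2) by simp]; exact Real.sqrt_le_sqrt (by linarith [h.hundred_le])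
    nlinarith [Real.sq_sqrt hR.le]
  have hX : 0 ≤ l2norm g := ENNReal.toReal_nonneg
  calc _ ≤ ∑ θ ∈ Θ, (R ^ 1005)⁻¹ * l2norm g :=
        norm_sum_le_of_le _ fun θ hθ => piece_reconstruct h hγ h𝕋 hg hs ((hΘ θ).1 hθ) hξ
          fun T => by rw [Finset.mem_filter]
    _ = (⌈√R⌉₊ : ℝ) * ⌈√R⌉₊ * ((R ^ 1005)⁻¹ * l2norm g) := by
        rw [Finset.sum_const, nsmul_eq_mul, Finset.card_product, Finset.card_range]; push_cast; rfl
    _ ≤ R * R * ((R ^ 1005)⁻¹ * l2norm g) := by gcongr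
    _ = (R ^ 1003)⁻¹ * l2norm g := by field_simp
    _ ≤ _ := by gcongr; exact inv_pow_le_rpow hR1 (by norm_num)

theorem exists_wavePacketDecomposition {γ R δ : ℝ} (h : IsLargeScale δ R) (hγ : |γ| ≤ 1)
    {𝕋 : Finset Tube} (h𝕋 : IsTubeFamily γ R δ 𝕋) {g : PlaneFun} (hg : MemLp g 2 volume)
    (hs : Function.support g ⊆ unitSquare) :
    ∃ F : Tube → PlaneFun, IsWavePacketDecomposition γ R δ 1 𝕋 g F := by
  have hR : 0 < R := by linarith [h.hundred_le]
  refine ⟨wavePacket γ R δ 𝕋 g, fun T _ => memLp_waveFn hR _ _ _,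
    fun T _ => support_waveFn hR _ _ _,
    fun T hT ξ hξ => wavePacket_localized h hγ h𝕋 hg hs hT hξ,
    fun ξ hξ => wavePacket_reconstruct h hγ h𝕋 hg hs hξ,
    fun T₁ h₁ T₂ h₂ hθ hd => wavePacket_orthogonal h h𝕋 hg hs h₁ h₂ hθ hd, fun θ _ => ?_⟩
  rw [one_mul]
  exact wavePacket_l2_bound hR hg hs θ fun T hT => (Finset.mem_filter.1 hT).2

end HypRestriction

/-! ### The main theorem -/

theorem mainTheorem7 :
    ∃ C₀ : ℝ, ∀ ε : ℝ, 0 < ε → ε < 10 ^ (-10 : ℤ) → ∃ R₀ : ℝ, 1 ≤ R₀ ∧ ∀ R : ℝ, R₀ ≤ R →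
      ∀ γ : ℝ, γ ∈ Set.Icc (-1 : ℝ) 1 →
      ∀ 𝕋 : Finset HypRestriction.Tube, HypRestriction.IsTubeFamily γ R (ε ^ 2) 𝕋 →
        -- wave packet decompositions exist
        (∀ g : HypRestriction.PlaneFun, MeasureTheory.MemLp g 2 MeasureTheory.volume →
          Function.support g ⊆ HypRestriction.unitSquare →
          ∃ F : HypRestriction.Tube → HypRestriction.PlaneFun,
            HypRestriction.IsWavePacketDecomposition γ R (ε ^ 2) C₀ 𝕋 g F) ∧
        -- and for all of them the broad function is controlled
        ∀ α μ : ℝ, HypRestriction.bigK ε ^ (-ε) ≤ α → α < 1 → 1 ≤ μ → α * μ ≤ 10 ^ (-5 : ℤ) →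
        ∀ 𝒞 : Finset HypRestriction.Cap,
          HypRestriction.IsCapFamily (HypRestriction.bigK ε) μ 𝒞 →
        ∀ f : HypRestriction.Cap → HypRestriction.PlaneFun,
          (∀ τ ∈ 𝒞, MeasureTheory.MemLp (f τ) 2 MeasureTheory.volume ∧
            Function.support (f τ) ⊆ τ.carrier) →
        ∀ (C : ℝ) (F : HypRestriction.Cap → HypRestriction.Tube → HypRestriction.PlaneFun),
          (∀ τ ∈ 𝒞,
            HypRestriction.IsWavePacketDecomposition γ R (ε ^ 2) C 𝕋 (f τ) (F τ)) →
        ∀ (P : MvPolynomial (Fin 3) ℝ) (c ξ : HypRestriction.E3),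
          ξ ∈ HypRestriction.cube R →
          ξ ∈ Metric.closedBall c (R ^ (1 - ε ^ 2)) ∩ HypRestriction.wall R (ε ^ 2) P →
          HypRestriction.Br γ (HypRestriction.bigK ε) μ 𝒞 α f ξ ≤
            2 * (∑ I ∈ 𝒞.powerset,
                HypRestriction.Br γ (HypRestriction.bigK ε) μ 𝒞 (60 * α)
                  (HypRestriction.restrictCaps I
                    (HypRestriction.transPart γ R (ε ^ 2) P c 𝕋 F)) ξ
              + HypRestriction.bigK ε ^ 100 *
                HypRestriction.Bil γ (HypRestriction.bigK ε) μ 𝒞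
                  (HypRestriction.tangPart γ R (ε ^ 2) P c 𝕋 F) ξ
              + R ^ (-900 : ℝ) * ∑ τ ∈ 𝒞, HypRestriction.l2norm (f τ)) := by
  refine ⟨1, fun ε hε0 hε => ?_⟩
  obtain ⟨R₁, h₁, hR₁⟩ := HypRestriction.exists_isLargeScale (pow_pos hε0 2)
  -- The first bound on R serves the existence of wave packets; the broad estimate itself needs only
  -- R ≥ K.
  refine ⟨max R₁ (HypRestriction.bigK ε), h₁.trans (le_max_left _ _), fun R hR γ hγ 𝕋 h𝕋 =>
    ⟨fun g hg hs => HypRestriction.exists_wavePacketDecomposition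
      (hR₁ R ((le_max_left _ _).trans hR)) (abs_le.2 hγ) h𝕋 hg hs, ?_⟩⟩
  intro α μ hα _ hμ hαμ 𝒞 h𝒞 f hf C F hF P c ξ hξ hξ'
  exact HypRestriction.broad_le hε0 hε ((le_max_right _ _).trans hR) h𝕋 hα hμ hαμ h𝒞 hf hF P hξ hξ'
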